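/- Setting. The disk is the closed upper half-plane (with its point at infinity), so that its boundary is the line $y=0$. A PBDTP graph $\mathcal G$ (planar bicolored directed trivalent perfect graph) is a finite directed graph drawn in the disk without crossings, with straight edges, such that: (1) its boundary vertices $b_1,\dots,b_n$ lie on the line $y=0$ in clockwise order, each of degree 1; $b_i$ is a source (sink) if its edge is outgoing (incoming); all other vertices, called internal, lie strictly inside the disk and have degree 2 or 3; no connected component is isolated from the boundary; (2) each internal vertex has exactly one incoming or exactly one outgoing edge; (3) internal vertices are colored black or white, and a trivalent vertex is white if and only if it has exactly one incoming edge; each internal face has trivalent vertices of both colors on its boundary; (4) each edge between internal vertices lies on a directed path from a boundary source to a boundary sink; (5) each $b_i$ is joined by its edge to a bivalent white internal vertex. The faces are the connected components of the open disk minus the drawing. A face is internal if its boundary does not meet the boundary of the disk, and a boundary face otherwise; the infinite face is the boundary face whose boundary contains the arc of the boundary of the disk that runs clockwise from $b_n$ to $b_1$; the other boundary faces are called finite. Let $k$ be the number of boundary sources. A gauge ray direction $\mathfrak l$ is a direction pointing from the boundary line into the disk, not parallel to any edge between internal vertices, and such that no ray with direction $\mathfrak l$ starting at a boundary vertex contains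 an internal vertex. For vectors $e,f$ let $s(e,f)\in\{1,0,-1\}$ be the sign of $\det(e,f)$. For consecutive edges $e,f$, let $\mathrm{wind}(e,f)=\pm1$ if $s(e,f)=s(e,\mathfrak l)=s(\mathfrak l,f)=\pm1$, and $\mathrm{wind}(e,f)=0$ otherwise. Let $\mathrm{int}(e)$ be the number of intersections of $e$ with the rays of direction $\mathfrak l$ that start at the boundary sources (the origins of the rays do not count). Given $\mathfrak l$, the signature of an edge $e=(U,V)$ directed from $U$ to $V$ is $$\epsilon_{U,V}=\mathrm{int}(e)+h(e)+t(e)\pmod 2,$$ where $h(e)=1$ if $V$ is white, $h(e)=\mathrm{wind}(e,f)$ if $V$ is black with outgoing edge $f$, $h(e)=0$ if $V$ is a boundary vertex; $t(e)=\mathrm{wind}(g,e)$ if $U$ is white with incoming edge $g$, and $t(e)=0$ if $U$ is black or a boundary vertex. A signature $\epsilon$, i.e. an assignment of an element of $\mathbb Z/2$ to each edge, is called geometric if it arises from such a signature, for some gauge ray direction, by adding $\eta(U)+\eta(V)$ to the value at each edge $(U,V)$, for some function $\eta$ on the vertices with values in $\mathbb Z/2$ that vanishes at the boundary vertices. Theorem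 (The total signature at faces). Let $\mathcal G$ be a PBDTP graph with $k$ boundary sources and let $\epsilon$ be a geometric signature on $\mathcal G$. For a face $\Omega$, let $\epsilon_\Omega=\sum_{e\in\partial\Omega}\epsilon_e$, let $n_{w,\Omega}$ be the number of white internal vertices in $\partial\Omega$, and let $s_\Omega$ be the number of boundary sources in $\partial\Omega$. Then: 1. if $\Omega$ is an internal face, $\epsilon_\Omega = n_{w,\Omega}-1 \pmod 2$; 2. if $\Omega$ is a boundary face, $$\epsilon_\Omega+n_{w,\Omega}+s_\Omega=\begin{cases}1 \pmod 2 & \text{if } \Omega \text{ is a finite face},\\ k \pmod 2 & \text{if } \Omega \text{ is the infinite face}.\end{cases}$$ -/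

import Mathlib

open scoped BigOperators

/-! The disk is the closed upper half-plane (together with the point at infinity); its boundary is
the line `y = 0`, with the boundary vertices on it. Edges are straight segments. -/

/-- Vertices: the boundary vertices `b_0, …, b_{n-1}` and the internal vertices. -/
abbrev Vert (n : ℕ) (ι : Type*) := Fin n ⊕ ι

/-- A directed graph with a two-colouring of the internal vertices and a straight-line drawing.
`Adj u v` says that there is an edge directed from `u` to `v`; an internal vertex is black if it is
not white. -/
structure DrawnDigraph (n : ℕ) (ι : Type*) extends Digraph (Vert n ι) where
  /-- the position of each vertex in the plane -/
  pos : Vert n ι → ℝ × ℝ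
  /-- the white internal vertices -/
  white : ι → Prop

namespace DrawnDigraph

variable {n : ℕ} {ι : Type*} (G : DrawnDigraph n ι)

/-- The number of incoming edges. -/
noncomputable def inDeg (v : Vert n ι) : ℕ := {u | G.Adj u v}.ncard

/-- The number of outgoing edges. -/
noncomputable def outDeg (v : Vert n ι) : ℕ := {w | G.Adj v w}.ncard

/-- The degree. -/
noncomputable def deg (v : Vert n ι) : ℕ := G.inDeg v + G.outDeg v

/-- The boundary vertex `b_j` is a source: its edge is outgoing. -/
def IsSource (j : Fin n) : Prop := ∃ v, G.Adj (Sum.inl j) v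

/-- The boundary vertex `b_j` is a sink: its edge is incoming. -/
def IsSink (j : Fin n) : Prop := ∃ v, G.Adj v (Sum.inl j)

/-- The segment that draws an edge from `u` to `v`. -/
def seg (u v : Vert n ι) : Set (ℝ × ℝ) := segment ℝ (G.pos u) (G.pos v)

/-- The direction vector of an edge from `u` to `v`. -/
def vec (u v : Vert n ι) : ℝ × ℝ := G.pos v - G.pos u

/-- The drawing is planar: it has no crossings, the boundary vertices lie clockwise on the boundary
line (the half-plane being above it), and the internal vertices lie strictly inside. -/
structure IsPlanarInDisk : Prop where
  pos_injective : Function.Injective G.pos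
  boundary_line : ∀ j, (G.pos (Sum.inl j)).2 = 0
  clockwise : StrictAnti fun j : Fin n => (G.pos (Sum.inl j)).1
  interior : ∀ a, 0 < (G.pos (Sum.inr a)).2
  loopless : ∀ v, ¬ G.Adj v v
  vertex_on_edge : ∀ u v w, G.Adj u v → G.pos w ∈ G.seg u v → w = u ∨ w = v
  edges_cross : ∀ u v u' v', G.Adj u v → G.Adj u' v' → (u, v) ≠ (u', v') →
    G.seg u v ∩ G.seg u' v' ⊆ {G.pos u, G.pos v} ∩ {G.pos u', G.pos v'}

/-- The points of the plane covered by the drawing. -/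
def drawing : Set (ℝ × ℝ) := {p | ∃ u v, G.Adj u v ∧ p ∈ G.seg u v}

/-- The open disk without the drawing. -/
def complement : Set (ℝ × ℝ) := {p | 0 < p.2} \ G.drawing

/-- A face is a connected component of the open disk without the drawing. -/
def IsFace (Ω : Set (ℝ × ℝ)) : Prop :=
  ∃ p ∈ G.complement, Ω = connectedComponentIn G.complement p

/-- A face is internal if its boundary does not meet the boundary of the disk. -/
def IsInternalFace (Ω : Set (ℝ × ℝ)) : Prop :=
  G.IsFace Ω ∧ frontier Ω ∩ {p | p.2 = 0} = ∅

/-- A face is a boundary face if it is not internal. -/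
def IsBoundaryFace (Ω : Set (ℝ × ℝ)) : Prop :=
  G.IsFace Ω ∧ (frontier Ω ∩ {p | p.2 = 0}).Nonempty

/-- The boundary arc of the disk that runs clockwise (through infinity) from the last boundary
vertex to the first: the points of the line that are not strictly between two boundary vertices. -/
def outerArc : Set (ℝ × ℝ) :=
  {p | p.2 = 0 ∧ ¬ ∃ i j, (G.pos (Sum.inl i)).1 < p.1 ∧ p.1 < (G.pos (Sum.inl j)).1}

/-- The infinite face is the one whose boundary includes the outer arc. -/
def IsInfiniteFace (Ω : Set (ℝ × ℝ)) : Prop :=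
  G.IsBoundaryFace Ω ∧ G.outerArc ⊆ frontier Ω

/-- All other boundary faces are finite. -/
def IsFiniteBoundaryFace (Ω : Set (ℝ × ℝ)) : Prop :=
  G.IsBoundaryFace Ω ∧ ¬ G.IsInfiniteFace Ω

/-- Planar bicolored directed trivalent perfect graphs in the disk. -/
structure IsPBDTP : Prop where
  planar : G.IsPlanarInDisk
  /-- no component is isolated from the boundary -/
  connected : ∀ a : ι, ∃ j : Fin n,
    Relation.ReflTransGen (fun u v => G.Adj u v ∨ G.Adj v u) (Sum.inr a) (Sum.inl j)
  boundary_deg : ∀ j : Fin n, G.deg (Sum.inl j) = 1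
  internal_deg : ∀ a : ι, G.deg (Sum.inr a) = 2 ∨ G.deg (Sum.inr a) = 3
  perfect : ∀ a : ι, G.inDeg (Sum.inr a) = 1 ∨ G.outDeg (Sum.inr a) = 1
  color : ∀ a : ι, G.deg (Sum.inr a) = 3 → (G.white a ↔ G.inDeg (Sum.inr a) = 1)
  internal_face : ∀ Ω, G.IsInternalFace Ω →
    (∃ a, G.deg (Sum.inr a) = 3 ∧ G.white a ∧ G.pos (Sum.inr a) ∈ frontier Ω) ∧
    (∃ a, G.deg (Sum.inr a) = 3 ∧ ¬ G.white a ∧ G.pos (Sum.inr a) ∈ frontier Ω)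
  /-- each internal edge lies on a directed path from a boundary source to a boundary sink -/
  path : ∀ a c : ι, G.Adj (Sum.inr a) (Sum.inr c) →
    ∃ i j : Fin n, G.IsSource i ∧ G.IsSink j ∧
      Relation.ReflTransGen G.Adj (Sum.inl i) (Sum.inr a) ∧
      Relation.ReflTransGen G.Adj (Sum.inr c) (Sum.inl j)
  /-- each boundary vertex is joined to a white bivalent internal vertex -/
  boundary_nbr : ∀ j : Fin n, ∃ a : ι,
    (G.Adj (Sum.inl j) (Sum.inr a) ∨ G.Adj (Sum.inr a) (Sum.inl j)) ∧
    G.white a ∧ G.deg (Sum.inr a) = 2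

end DrawnDigraph

/-- `s(e, f)`: `1`, `0` or `-1` according to whether the ordered pair of vectors is positively
oriented, parallel or negatively oriented. -/
noncomputable def orientSign (e f : ℝ × ℝ) : SignType := SignType.sign (e.1 * f.2 - e.2 * f.1)

/-- The local winding number of an ordered pair of directions with respect to the direction `l`. -/
noncomputable def localWind (l e f : ℝ × ℝ) : ℤ :=
  if orientSign e f = 1 ∧ orientSign e l = 1 ∧ orientSign l f = 1 then 1
  else if orientSign e f = -1 ∧ orientSign e l = -1 ∧ orientSign l f = -1 then -1
  else 0

namespace DrawnDigraph

variable {n : ℕ} {ι : Type*} (G : DrawnDigraph n ι)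

/-- `l` is a gauge ray direction: it points into the disk, no internal edge is parallel to it, and
the rays from the boundary vertices contain no internal vertex. -/
structure IsGaugeRay (l : ℝ × ℝ) : Prop where
  inward : 0 < l.2
  not_parallel : ∀ a c : ι, G.Adj (Sum.inr a) (Sum.inr c) →
    orientSign (G.vec (Sum.inr a) (Sum.inr c)) l ≠ 0
  avoids : ∀ (j : Fin n) (a : ι) (t : ℝ), 0 ≤ t → G.pos (Sum.inl j) + t • l ≠ G.pos (Sum.inr a)

/-- `int(e)`: the number of intersections of the edge from `u` to `v` with the gauge rays that start
at the boundary sources (the origin of a ray not counting as an intersection). A ray is never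
parallel to an edge that it meets, so it meets each edge at most once. -/
noncomputable def edgeInt (l : ℝ × ℝ) (u v : Vert n ι) : ℕ :=
  {i : Fin n | G.IsSource i ∧ ∃ t : ℝ, 0 < t ∧ G.pos (Sum.inl i) + t • l ∈ G.seg u v}.ncard

/-- Two signatures are equivalent if they differ by a gauge transformation at internal vertices. -/
def SignEquiv (ε₁ ε₂ : Vert n ι → Vert n ι → ZMod 2) : Prop :=
  ∃ η : ι → ZMod 2, ∀ u v, G.Adj u v →
    ε₂ u v = ε₁ u v + Sum.elim (fun _ => 0) η u + Sum.elim (fun _ => 0) η v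

/-- `n_{w,Ω}`: the number of white vertices in the boundary of `Ω`. -/
noncomputable def numWhite (Ω : Set (ℝ × ℝ)) : ℕ :=
  {a : ι | G.white a ∧ G.pos (Sum.inr a) ∈ frontier Ω}.ncard

/-- `s_Ω`: the number of boundary sources in the boundary of `Ω`. -/
noncomputable def numFaceSources (Ω : Set (ℝ × ℝ)) : ℕ :=
  {j : Fin n | G.IsSource j ∧ G.pos (Sum.inl j) ∈ frontier Ω}.ncard

/-- `k`: the number of all boundary sources. -/
noncomputable def numSources : ℕ := {j : Fin n | G.IsSource j}.ncard

variable [Fintype ι]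

open Classical in
/-- The contribution of the end point `v` to the signature of an edge `e` from `u` to `v`: `1` if
`v` is white, `wind(e, f)` if `v` is black and `f` is the unique edge going out of `v`. -/
noncomputable def headTerm (l : ℝ × ℝ) (u : Vert n ι) : Vert n ι → ZMod 2
  | Sum.inl _ => 0
  | Sum.inr a => if G.white a then 1 else
      ∑ w with G.Adj (Sum.inr a) w,
        (localWind l (G.vec u (Sum.inr a)) (G.vec (Sum.inr a) w) : ZMod 2)

open Classical in
/-- The contribution of the starting point `u` to the signature of an edge `e` from `u` to `v`:
`wind(f, e)` if `u` is white and `f` is the unique edge coming into `u`, and `0` if `u` is black. -/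
noncomputable def tailTerm (l : ℝ × ℝ) (v : Vert n ι) : Vert n ι → ZMod 2
  | Sum.inl _ => 0
  | Sum.inr a => if G.white a then
      ∑ w with G.Adj w (Sum.inr a),
        (localWind l (G.vec w (Sum.inr a)) (G.vec (Sum.inr a) v) : ZMod 2) else 0

/-- The signature of the oriented graph with the gauge ray direction `l`. It turns the relations
`E_e = ∑_f (-1)^(int(e) + wind(e, f)) w_e E_f`, with `f` running over the edges that leave the end
point of `e`, into the half-edge relations `z_{V,e} = z_{V,f}` at black vertices `V`,
`∑_e z_{V,e} = 0` at white vertices `V` and `z_{U,e} = (-1)^ε(U,V) w_e z_{V,e}` on edges `e = (U,V)`,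
by means of `z_{U,e} = (-1)^(tailTerm) E_e`. -/
noncomputable def raySignature (l : ℝ × ℝ) (u v : Vert n ι) : ZMod 2 :=
  (G.edgeInt l u v : ZMod 2) + G.headTerm l u v + G.tailTerm l v u

/-- Geometric signatures. -/
def IsGeometricSignature (ε : Vert n ι → Vert n ι → ZMod 2) : Prop :=
  ∃ l, G.IsGaugeRay l ∧ G.SignEquiv (G.raySignature l) ε

open Classical in
/-- `ε_Ω`: the sum of the signature over the edges in the boundary of `Ω`. -/
noncomputable def faceSign (ε : Vert n ι → Vert n ι → ZMod 2) (Ω : Set (ℝ × ℝ)) : ZMod 2 :=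
  ∑ e : Vert n ι × Vert n ι with G.Adj e.1 e.2 ∧ G.seg e.1 e.2 ⊆ frontier Ω, ε e.1 e.2

end DrawnDigraph

/-!
In coordinates in which the gauge ray direction is vertical, everything about a face `Ω` is read off
from the vertical direction: which edges have `Ω` above or below them, which vertices meet `Ω` in
the direction upwards or downwards, which gaps of the boundary line lie below `Ω`. Write `[F]` for
`1` if the face `F` is `Ω`, and for `0` otherwise, and say that an edge *borders* on `Ω` if one of
its sides does. No edge has `Ω` on both sides (`upE_ne_dnE`), so the edges in the boundary of `Ω`
are the bordering ones, each with one side, and `ε_Ω` is the sum of `ε` over them. Modulo 2, the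
number of bordering edges crossed by an arc is the difference of `[·]` at the ends of the arc.

* The gauge ray from a boundary source `b_i` runs from the face above `b_i` to the face at infinity,
  so it meets `[∞] - [above b_i]` bordering edges (`sum_border_mul_edgeInt`).
* A winding number at a vertex is odd if and only if the outgoing edge leaves it above the incoming
  one, on the same side (`localWind_eq_above`). So a sum of winding numbers counts bordering edges
  that are met in turning from an edge to the vertical. At an internal vertex `a` this leads to the
  value `d_a + [above a] + ∑_e [above e]`, with `e` running over the edges that end at `a` and with
  `2 d_a` the number of outgoing minus the number of incoming bordering edges
  (`exists_local_balance`). The summand `1` for white vertices in the boundary of `Ω` is included in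
  this value, and a vertex in the boundary has exactly one corner in `Ω` (`corners_eq`), as it
  would otherwise have degree at least four.
* A gauge transformation at `a` changes `ε_Ω` by an even number of terms, as every corner is bounded
  by two edges (`sum_border_mul_gauge`).

In the sum over all vertices, the numbers `d_a` and the gaps below `Ω` are both determined by the
boundary edges (`boundary_vertex`), and what remains is the number of edges and gaps (*cells*) below
`Ω` minus the number of vertices below `Ω`. This number is `1` (`euler_face`), and the assertion
follows (`total_signature`).

The last fact, and the absence of bridges, take the place of the Jordan curve theorem; both follow
from Euler's formula, which is obtained from two inequalities. The cells below `Ω` are linked with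
each other through the vertices below `Ω`, so there is at most one more cell than vertices
(`card_cellsBelow_le`); summed over the faces, this bounds the number of faces from below. The
jumps across edges of the `ZMod 2`-valued functions of the faces are cycles relative to the
boundary vertices, and only the constant functions have no jumps; as the graph is connected to the
boundary, the dimension of the cycle space bounds the number of faces from above. The two bounds
agree (`Arrangement.euler`). Hence every inequality used is an equality, and every cycle is
the set of jumps of some function (`exists_jump_eq`). Since every edge belongs to a relative cycle
(`exists_cycle`), it separates two faces.
-/

section FaceSignatures

open Set Filter Topology

/-! ### Drawings without vertical edges, and the faces next to edges and vertices -/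

/-- A finite straight-line drawing in the closed upper half-plane without vertical edges. The
vertices are the boundary vertices (on the line `y = 0`, numbered from right to left) and the
internal ones; an edge `e` is given by its left end point `lv e`, its right end point `rv e` and its
slope. No boundary vertex lies vertically below an internal one, and edges are disjoint apart from
common end points. -/
structure Arrangement (n : ℕ) (ι E : Type*) where
  /-- the first coordinate of a vertex -/
  x : Vert n ι → ℝ
  /-- the second coordinate of a vertex -/
  y : Vert n ι → ℝ
  /-- the left end point of an edge -/
  lv : E → Vert n ι
  /-- the right end point of an edge -/
  rv : E → Vert n ι
  /-- the slope of an edge -/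
  slope : E → ℝ
  lv_lt_rv : ∀ e, x (lv e) < x (rv e)
  y_rv : ∀ e, y (rv e) = y (lv e) + (x (rv e) - x (lv e)) * slope e
  y_inl : ∀ j, y (Sum.inl j) = 0
  y_inr : ∀ a, 0 < y (Sum.inr a)
  anti : StrictAnti fun j => x (Sum.inl j)
  x_inl_ne : ∀ j a, x (Sum.inl j) ≠ x (Sum.inr a)
  edge_inner : ∀ e, 0 < y (lv e) ∨ 0 < y (rv e)
  vertex_on_edge : ∀ e w, x (lv e) ≤ x w → x w ≤ x (rv e) →
    y w = y (lv e) + (x w - x (lv e)) * slope e → w = lv e ∨ w = rv e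
  inter : ∀ e e' t, x (lv e) < t → t < x (rv e) → x (lv e') ≤ t → t ≤ x (rv e') →
    y (lv e) + (t - x (lv e)) * slope e = y (lv e') + (t - x (lv e')) * slope e' → e = e'

namespace Arrangement

variable {n : ℕ} {ι E : Type*} (A : Arrangement n ι E)

/-- The height over the abscissa `t` of the line that carries the edge `e`. -/
def height (e : E) (t : ℝ) : ℝ := A.y (A.lv e) + (t - A.x (A.lv e)) * A.slope e

/-- The point `p` lies on the (closed) edge `e`. -/
def On (e : E) (p : ℝ × ℝ) : Prop :=
  A.x (A.lv e) ≤ p.1 ∧ p.1 ≤ A.x (A.rv e) ∧ p.2 = A.height e p.1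

/-- The open half-plane without the edges. -/
def free : Set (ℝ × ℝ) := {p | 0 < p.2 ∧ ∀ e, ¬ A.On e p}

/-- The face that contains `p`. -/
def face (p : ℝ × ℝ) : Set (ℝ × ℝ) := connectedComponentIn A.free p

@[simp] lemma height_lv (e : E) : A.height e (A.x (A.lv e)) = A.y (A.lv e) := by simp [height]

@[simp] lemma height_rv (e : E) : A.height e (A.x (A.rv e)) = A.y (A.rv e) := by
  simp [height, A.y_rv]

lemma continuous_height (e : E) : Continuous (A.height e) := by
  unfold height; fun_prop

lemma isClosed_on (e : E) : IsClosed {p | A.On e p} := by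
  have h := A.continuous_height e
  refine (isClosed_le continuous_const continuous_fst).inter
    ((isClosed_le continuous_fst continuous_const).inter (isClosed_eq continuous_snd ?_))
  fun_prop

lemma y_nonneg (v : Vert n ι) : 0 ≤ A.y v := by
  rcases v with j | a
  · exact (A.y_inl j).ge
  · exact (A.y_inr a).le

lemma height_pos {e : E} {t : ℝ} (h : t ∈ Ioo (A.x (A.lv e)) (A.x (A.rv e))) :
    0 < A.height e t := by
  obtain ⟨h1, h2⟩ := h
  have key : (A.x (A.rv e) - A.x (A.lv e)) * A.height e t =
      (A.x (A.rv e) - t) * A.y (A.lv e) + (t - A.x (A.lv e)) * A.y (A.rv e) := by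
    rw [A.y_rv, height]; ring
  have hl := A.y_nonneg (A.lv e)
  have hr := A.y_nonneg (A.rv e)
  have : 0 < (A.x (A.rv e) - A.x (A.lv e)) * A.height e t := by
    rw [key]
    rcases A.edge_inner e with h | h
    · have := mul_pos (sub_pos.2 h2) h
      have := mul_nonneg (sub_pos.2 h1).le hr
      linarith
    · have := mul_pos (sub_pos.2 h1) h
      have := mul_nonneg (sub_pos.2 h2).le hl
      linarith
  exact (pos_iff_pos_of_mul_pos this).1 (by linarith)

lemma height_nonneg {e : E} {t : ℝ} (h : t ∈ Icc (A.x (A.lv e)) (A.x (A.rv e))) :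
    0 ≤ A.height e t := by
  rcases eq_or_lt_of_le h.1 with h1 | h1
  · rw [← h1, height_lv]; exact A.y_nonneg _
  rcases eq_or_lt_of_le h.2 with h2 | h2
  · rw [h2, height_rv]; exact A.y_nonneg _
  exact (A.height_pos ⟨h1, h2⟩).le

section Faces

lemma face_eq_of_isPreconnected {S : Set (ℝ × ℝ)} (hS : IsPreconnected S) (h : S ⊆ A.free)
    {p q : ℝ × ℝ} (hp : p ∈ S) (hq : q ∈ S) : A.face p = A.face q :=
  connectedComponentIn_eq (hS.subset_connectedComponentIn hp h hq)

lemma face_vertical {t s s' : ℝ} (h : s ≤ s') (hf : ∀ r ∈ Icc s s', (t, r) ∈ A.free) :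
    A.face (t, s) = A.face (t, s') := by
  refine A.face_eq_of_isPreconnected (S := (fun r => (t, r)) '' Icc s s')
    (isPreconnected_Icc.image _ (by fun_prop)) ?_ ⟨s, by simp [h], rfl⟩ ⟨s', by simp [h], rfl⟩
  rintro _ ⟨r, hr, rfl⟩
  exact hf r hr

variable [Finite E]

lemma isOpen_free : IsOpen A.free := by
  have : A.free = {p | 0 < p.2} ∩ ⋂ e, {p | A.On e p}ᶜ := by
    ext p; simp [free]
  rw [this]
  exact (isOpen_lt continuous_const continuous_snd).inter
    (isOpen_iInter_of_finite fun e => (A.isClosed_on e).isOpen_compl)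

lemma exists_up (t : ℝ) {s : ℝ} (hs : 0 ≤ s) :
    ∃ ε > 0, ∀ r ∈ Ioo s (s + ε), (t, r) ∈ A.free := by
  have : ∀ᶠ r in 𝓝[>] s, (t, r) ∈ A.free := by
    have h1 : ∀ᶠ r in 𝓝[>] s, ∀ e, ¬ A.On e (t, r) := by
      refine eventually_all.2 fun e => ?_
      by_cases he : A.height e t ≤ s
      · filter_upwards [self_mem_nhdsWithin] with r hr h
        have := h.2.2
        simp only [mem_Ioi] at hr
        simp only at this
        linarith
      · filter_upwards [nhdsWithin_le_nhds (Iio_mem_nhds (not_le.1 he))] with r hr h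
        have := h.2.2
        simp only [mem_Iio] at hr
        simp only at this
        linarith
    filter_upwards [h1, self_mem_nhdsWithin] with r hr hr'
    exact ⟨hs.trans_lt hr', hr⟩
  obtain ⟨u, hu, hsub⟩ := mem_nhdsGT_iff_exists_Ioo_subset.1 this
  exact ⟨u - s, sub_pos.2 hu, fun r hr => hsub (by simpa using hr)⟩

lemma exists_dn (t : ℝ) {s : ℝ} (hs : 0 < s) :
    ∃ ε > 0, ∀ r ∈ Ioo (s - ε) s, (t, r) ∈ A.free := by
  have : ∀ᶠ r in 𝓝[<] s, (t, r) ∈ A.free := by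
    have h1 : ∀ᶠ r in 𝓝[<] s, ∀ e, ¬ A.On e (t, r) := by
      refine eventually_all.2 fun e => ?_
      by_cases he : s ≤ A.height e t
      · filter_upwards [self_mem_nhdsWithin] with r hr h
        have := h.2.2
        simp only [mem_Iio] at hr
        simp only at this
        linarith
      · filter_upwards [nhdsWithin_le_nhds (Ioi_mem_nhds (not_le.1 he))] with r hr h
        have := h.2.2
        simp only [mem_Ioi] at hr
        simp only at this
        linarith
    filter_upwards [h1, nhdsWithin_le_nhds (Ioi_mem_nhds hs)] with r hr hr'
    exact ⟨hr', hr⟩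
  obtain ⟨u, hu, hsub⟩ := mem_nhdsLT_iff_exists_Ioo_subset.1 this
  exact ⟨s - u, sub_pos.2 hu, fun r hr => hsub (by simpa using hr)⟩

end Faces

open Classical in
/-- The face just above the point `(t, s)` (the empty set if there is none). -/
noncomputable def upF (t s : ℝ) : Set (ℝ × ℝ) :=
  if h : ∃ ε > 0, ∀ r ∈ Ioo s (s + ε), (t, r) ∈ A.free then A.face (t, s + h.choose / 2) else ∅

open Classical in
/-- The face just below the point `(t, s)` (the empty set if there is none). -/
noncomputable def dnF (t s : ℝ) : Set (ℝ × ℝ) :=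
  if h : ∃ ε > 0, ∀ r ∈ Ioo (s - ε) s, (t, r) ∈ A.free then A.face (t, s - h.choose / 2) else ∅

lemma upF_eq {t s r : ℝ} (h : s < r) (hf : ∀ r' ∈ Ioc s r, (t, r') ∈ A.free) :
    A.upF t s = A.face (t, r) := by
  have hex : ∃ ε > 0, ∀ r ∈ Ioo s (s + ε), (t, r) ∈ A.free :=
    ⟨r - s, sub_pos.2 h, fun r' hr' => hf r' ⟨hr'.1, by linarith [hr'.2]⟩⟩
  rw [upF, dif_pos hex]
  have h0 := hex.choose_spec.1
  have h1 := hex.choose_spec.2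
  rcases le_total (s + hex.choose / 2) r with h2 | h2
  · exact A.face_vertical h2 fun r' hr' => hf r' ⟨by linarith [hr'.1], hr'.2⟩
  · exact (A.face_vertical h2 fun r' hr' => h1 r' ⟨by linarith [hr'.1], by linarith [hr'.2]⟩).symm

lemma dnF_eq {t s r : ℝ} (h : r < s) (hf : ∀ r' ∈ Ico r s, (t, r') ∈ A.free) :
    A.dnF t s = A.face (t, r) := by
  have hex : ∃ ε > 0, ∀ r ∈ Ioo (s - ε) s, (t, r) ∈ A.free :=
    ⟨s - r, sub_pos.2 h, fun r' hr' => hf r' ⟨by linarith [hr'.1], hr'.2⟩⟩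
  rw [dnF, dif_pos hex]
  have h0 := hex.choose_spec.1
  have h1 := hex.choose_spec.2
  rcases le_total r (s - hex.choose / 2) with h2 | h2
  · exact (A.face_vertical h2 fun r' hr' => hf r' ⟨hr'.1, by linarith [hr'.2]⟩).symm
  · exact A.face_vertical h2 fun r' hr' => h1 r' ⟨by linarith [hr'.1], by linarith [hr'.2]⟩

/-- Two consecutive obstacles on a vertical line bound the same face. -/
lemma upF_eq_dnF {t s s' : ℝ} (h : s < s') (hf : ∀ r ∈ Ioo s s', (t, r) ∈ A.free) :
    A.upF t s = A.dnF t s' := by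
  rw [A.upF_eq (r := (s + s') / 2) (by linarith) fun r hr => hf r ⟨hr.1, by linarith [hr.2]⟩,
    A.dnF_eq (r := (s + s') / 2) (by linarith) fun r hr => hf r ⟨by linarith [hr.1], hr.2⟩]

section Finite

variable [Finite E]

lemma upF_of_mem {t s : ℝ} (h : (t, s) ∈ A.free) : A.upF t s = A.face (t, s) := by
  obtain ⟨ε, hε, hf⟩ := A.exists_up t h.1.le
  rw [A.upF_eq (r := s + ε / 2) (by linarith)
    fun r hr => hf r ⟨hr.1, by linarith [hr.2]⟩]
  refine (A.face_vertical (by linarith) fun r hr => ?_).symm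
  rcases eq_or_lt_of_le hr.1 with h1 | h1
  · rwa [← h1]
  · exact hf r ⟨h1, by linarith [hr.2]⟩

lemma dnF_of_mem {t s : ℝ} (h : (t, s) ∈ A.free) : A.dnF t s = A.face (t, s) := by
  obtain ⟨ε, hε, hf⟩ := A.exists_dn t h.1
  rw [A.dnF_eq (r := s - ε / 2) (by linarith)
    fun r hr => hf r ⟨by linarith [hr.1], hr.2⟩]
  refine A.face_vertical (by linarith) fun r hr => ?_
  rcases eq_or_lt_of_le hr.2 with h1 | h1
  · rwa [h1]
  · exact hf r ⟨by linarith [hr.1], h1⟩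

end Finite

/-- The open interval of abscissae over which a cell lies: a cell is an edge or a gap of the boundary
line. As the boundary vertices are numbered from right to left, the gap `i` lies to the right of the
boundary vertex `i` and to the left of `i - 1`; the gaps `0` and `n` are unbounded. -/
def dom : E ⊕ Fin (n + 1) → Set ℝ
  | Sum.inl e => Ioo (A.x (A.lv e)) (A.x (A.rv e))
  | Sum.inr i => {t | ∀ j : Fin n, (j.val < i.val → t < A.x (Sum.inl j)) ∧
      (i.val ≤ j.val → A.x (Sum.inl j) < t)}

/-- The height of a cell (an edge or a gap of the boundary line) over an abscissa. -/
def base : E ⊕ Fin (n + 1) → ℝ → ℝ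
  | Sum.inl e => A.height e
  | Sum.inr _ => fun _ => 0

lemma base_affine (c : E ⊕ Fin (n + 1)) : ∃ k m : ℝ, ∀ t, A.base c t = k + t * m := by
  rcases c with e | i
  · exact ⟨A.y (A.lv e) - A.x (A.lv e) * A.slope e, A.slope e, fun t => by
      simp only [base, height]; ring⟩
  · exact ⟨0, 0, fun t => by simp [base]⟩

lemma continuous_base (c : E ⊕ Fin (n + 1)) : Continuous (A.base c) := by
  obtain ⟨k, m, h⟩ := A.base_affine c
  rw [show A.base c = fun t => k + t * m from funext h]
  fun_prop

lemma convex_above (c : E ⊕ Fin (n + 1)) : Convex ℝ {p : ℝ × ℝ | A.base c p.1 < p.2} := by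
  obtain ⟨k, m, h⟩ := A.base_affine c
  simp only [h]
  intro p hp q hq a b ha hb hab
  simp only [mem_ofPred_eq, Prod.fst_add, Prod.smul_fst, smul_eq_mul, Prod.snd_add,
    Prod.smul_snd] at *
  rcases eq_or_lt_of_le ha with h0 | h0
  · subst h0
    have : b = 1 := by linarith
    subst this
    linarith
  · have h1 := mul_lt_mul_of_pos_left hp h0
    have h2 := mul_le_mul_of_nonneg_left hq.le hb
    have h3 : a * k + b * k = k := by rw [← add_mul, hab, one_mul]
    linarith

lemma convex_below (c : E ⊕ Fin (n + 1)) : Convex ℝ {p : ℝ × ℝ | p.2 < A.base c p.1} := by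
  obtain ⟨k, m, h⟩ := A.base_affine c
  simp only [h]
  intro p hp q hq a b ha hb hab
  simp only [mem_ofPred_eq, Prod.fst_add, Prod.smul_fst, smul_eq_mul, Prod.snd_add,
    Prod.smul_snd] at *
  rcases eq_or_lt_of_le ha with h0 | h0
  · subst h0
    have : b = 1 := by linarith
    subst this
    linarith
  · have h1 := mul_lt_mul_of_pos_left hp h0
    have h2 := mul_le_mul_of_nonneg_left hq.le hb
    have h3 : a * k + b * k = k := by rw [← add_mul, hab, one_mul]
    linarith

lemma isOpen_dom (c : E ⊕ Fin (n + 1)) : IsOpen (A.dom c) := by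
  rcases c with e | i
  · exact isOpen_Ioo
  · have : A.dom (Sum.inr i) = ⋂ j : Fin n, {t | (j.val < i.val → t < A.x (Sum.inl j)) ∧
      (i.val ≤ j.val → A.x (Sum.inl j) < t)} := by ext t; simp [dom]
    rw [this]
    refine isOpen_iInter_of_finite fun j => ?_
    rcases lt_or_ge j.val i.val with h | h
    · simpa [h, h.not_ge] using isOpen_lt continuous_id continuous_const
    · simpa [h, h.not_gt] using isOpen_lt continuous_const continuous_id

lemma isPreconnected_dom (c : E ⊕ Fin (n + 1)) : IsPreconnected (A.dom c) := by
  rcases c with e | i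
  · exact isPreconnected_Ioo
  · refine OrdConnected.isPreconnected ⟨fun s hs t ht r hr j => ⟨fun h => ?_, fun h => ?_⟩⟩
    · exact hr.2.trans_lt ((ht j).1 h)
    · exact ((hs j).2 h).trans_le hr.1

lemma dom_nonempty (c : E ⊕ Fin (n + 1)) : (A.dom c).Nonempty := by
  classical
  rcases c with e | i
  · exact nonempty_Ioo.2 (A.lv_lt_rv e)
  · obtain ⟨m, h1, h2⟩ := Order.exists_between_finsets
      ((Finset.univ.filter fun j : Fin n => i.val ≤ j.val).image fun j => A.x (Sum.inl j))
      ((Finset.univ.filter fun j : Fin n => j.val < i.val).image fun j => A.x (Sum.inl j)) (by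
        intro x hx y hy
        simp only [Finset.mem_image, Finset.mem_filter, Finset.mem_univ, true_and] at hx hy
        obtain ⟨j, hj, rfl⟩ := hx
        obtain ⟨j', hj', rfl⟩ := hy
        exact A.anti (Fin.lt_def.2 (hj'.trans_le hj)))
    exact ⟨m, fun j => ⟨fun h => h2 _ (Finset.mem_image_of_mem _ (by simpa using h)),
      fun h => h1 _ (Finset.mem_image_of_mem _ (by simpa using h))⟩⟩

lemma base_nonneg {c : E ⊕ Fin (n + 1)} {t : ℝ} (h : t ∈ A.dom c) : 0 ≤ A.base c t := by
  rcases c with e | i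
  · exact (A.height_pos h).le
  · exact le_rfl

section Finite

variable [Finite E]

/-- Near an inner point of an edge there are no other edges. -/
lemma eventually_only {e : E} {t : ℝ} (h : t ∈ Ioo (A.x (A.lv e)) (A.x (A.rv e))) :
    ∀ᶠ p in 𝓝 (t, A.height e t), 0 < p.2 ∧ ∀ e', A.On e' p → e' = e := by
  refine ((isOpen_lt continuous_const continuous_snd).eventually_mem (A.height_pos h)).and
    (eventually_all.2 fun e' => ?_)
  by_cases he : e' = e
  · simp [he]
  · have : (t, A.height e t) ∈ {p | A.On e' p}ᶜ := fun h' =>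
      he (A.inter e e' t h.1 h.2 h'.1 h'.2.1 h'.2.2).symm
    filter_upwards [(A.isClosed_on e').isOpen_compl.eventually_mem this] with p hp hp'
    exact absurd hp' hp

lemma eventually_free_above {c : E ⊕ Fin (n + 1)} {t : ℝ} (h : t ∈ A.dom c) :
    ∀ᶠ p in 𝓝 (t, A.base c t), A.base c p.1 < p.2 → p ∈ A.free := by
  rcases c with e | i
  · filter_upwards [A.eventually_only h] with p hp hlt
    refine ⟨hp.1, fun e' he' => ?_⟩
    obtain rfl := hp.2 e' he'
    exact hlt.ne' he'.2.2
  · have : ∀ e', ∀ᶠ p in 𝓝 (t, A.base (Sum.inr i) t), ¬ A.On e' p := fun e' => by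
      refine (A.isClosed_on e').isOpen_compl.eventually_mem (x := (t, (0 : ℝ))) fun h' => ?_
      obtain ⟨h1, h2, h3⟩ := h'
      simp only at h1 h2 h3
      have key : ∀ v, A.y v = 0 → A.x v ≠ t := by
        rintro (j | a) hv rfl
        · rcases lt_or_ge j.val i.val with hj | hj
          · exact ((h j).1 hj).false
          · exact ((h j).2 hj).false
        · exact (A.y_inr a).ne' hv
      rcases eq_or_lt_of_le h1 with h4 | h4
      · exact key _ (by rw [← A.height_lv, h4, ← h3]) h4
      rcases eq_or_lt_of_le h2 with h5 | h5
      · exact key _ (by rw [← A.height_rv, ← h5, ← h3]) h5.symm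
      · exact (A.height_pos ⟨h4, h5⟩).ne h3
    filter_upwards [eventually_all.2 this] with p hp hlt
    exact ⟨hlt, hp⟩

lemma eventually_free_below {e : E} {t : ℝ} (h : t ∈ Ioo (A.x (A.lv e)) (A.x (A.rv e))) :
    ∀ᶠ p in 𝓝 (t, A.height e t), p.2 < A.height e p.1 → p ∈ A.free := by
  filter_upwards [A.eventually_only h] with p hp hlt
  refine ⟨hp.1, fun e' he' => ?_⟩
  obtain rfl := hp.2 e' he'
  exact hlt.ne he'.2.2

/-- Near a point of a cell, all points above the cell belong to the same face. -/
lemma eventually_face_above {c : E ⊕ Fin (n + 1)} {t : ℝ} (h : t ∈ A.dom c) :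
    ∀ᶠ p in 𝓝 (t, A.base c t), A.base c p.1 < p.2 →
      p ∈ A.free ∧ A.face p = A.upF t (A.base c t) := by
  obtain ⟨ε, hε, hf⟩ := Metric.eventually_nhds_iff_ball.1 (A.eventually_free_above h)
  filter_upwards [Metric.ball_mem_nhds _ hε] with p hp hlt
  refine ⟨hf p hp hlt, ?_⟩
  have h1 : ∀ r ∈ Ioc (A.base c t) (A.base c t + ε / 2),
      (t, r) ∈ Metric.ball (t, A.base c t) ε ∩ {p | A.base c p.1 < p.2} := fun r hr => by
    refine ⟨?_, hr.1⟩
    rw [Metric.mem_ball, Prod.dist_eq, dist_self, Real.dist_eq, max_eq_right (abs_nonneg _),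
      abs_of_pos (sub_pos.2 hr.1)]
    linarith [hr.2]
  rw [A.upF_eq (r := A.base c t + ε / 2) (by linarith) fun r hr => hf _ (h1 r hr).1 (h1 r hr).2]
  exact A.face_eq_of_isPreconnected
    ((convex_ball _ ε).inter (A.convex_above c)).isPreconnected
    (fun q hq => hf q hq.1 hq.2) ⟨hp, hlt⟩ (h1 _ ⟨by linarith, le_rfl⟩)

/-- Near an inner point of an edge, all points below the edge belong to the same face. -/
lemma eventually_face_below {e : E} {t : ℝ} (h : t ∈ Ioo (A.x (A.lv e)) (A.x (A.rv e))) :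
    ∀ᶠ p in 𝓝 (t, A.height e t), p.2 < A.height e p.1 →
      p ∈ A.free ∧ A.face p = A.dnF t (A.height e t) := by
  obtain ⟨ε, hε, hf⟩ := Metric.eventually_nhds_iff_ball.1 (A.eventually_free_below h)
  filter_upwards [Metric.ball_mem_nhds _ hε] with p hp hlt
  refine ⟨hf p hp hlt, ?_⟩
  have h1 : ∀ r ∈ Ico (A.height e t - ε / 2) (A.height e t),
      (t, r) ∈ Metric.ball (t, A.height e t) ε ∩ {p | p.2 < A.height e p.1} := fun r hr => by
    refine ⟨?_, hr.2⟩
    rw [Metric.mem_ball, Prod.dist_eq, dist_self, Real.dist_eq, max_eq_right (abs_nonneg _),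
      abs_of_neg (sub_neg.2 hr.2)]
    linarith [hr.1]
  rw [A.dnF_eq (r := A.height e t - ε / 2) (by linarith) fun r hr => hf _ (h1 r hr).1 (h1 r hr).2]
  exact A.face_eq_of_isPreconnected
    ((convex_ball _ ε).inter (A.convex_below (Sum.inl e))).isPreconnected
    (fun q hq => hf q hq.1 hq.2) ⟨hp, hlt⟩ (h1 _ ⟨le_rfl, by linarith⟩)

omit [Finite E] in
lemma tendsto_graph (c : E ⊕ Fin (n + 1)) (t : ℝ) :
    Tendsto (fun r => (r, A.base c r)) (𝓝 t) (𝓝 (t, A.base c t)) :=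
  (continuous_id.prodMk (A.continuous_base c)).tendsto t

/-- All along a cell, the face just above is the same. -/
lemma upF_base_eq {c : E ⊕ Fin (n + 1)} {t t' : ℝ} (h : t ∈ A.dom c) (h' : t' ∈ A.dom c) :
    A.upF t (A.base c t) = A.upF t' (A.base c t') := by
  refine (A.isPreconnected_dom c).induction₂ (fun t t' => A.upF t (A.base c t) =
    A.upF t' (A.base c t')) (fun r hr => ?_) (fun _ _ _ _ _ _ h1 h2 => h1.trans h2)
    (fun _ _ _ _ h => h.symm) h h'
  have h1 := (A.tendsto_graph c r).eventually (A.eventually_face_above hr).eventually_nhds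
  refine nhdsWithin_le_nhds ?_
  filter_upwards [h1, (A.isOpen_dom c).mem_nhds hr] with r' hr' hd
  obtain ⟨ε, hε, hf⟩ := Metric.eventually_nhds_iff_ball.1 hr'
  have h2 : ∀ s ∈ Ioc (A.base c r') (A.base c r' + ε / 2),
      (r', s) ∈ Metric.ball (r', A.base c r') ε := fun s hs => by
    rw [Metric.mem_ball, Prod.dist_eq, dist_self, Real.dist_eq, max_eq_right (abs_nonneg _),
      abs_of_pos (sub_pos.2 hs.1)]
    linarith [hs.2]
  rw [A.upF_eq (s := A.base c r') (r := A.base c r' + ε / 2) (by linarith)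
    fun s hs => (hf _ (h2 s hs) hs.1).1]
  exact (hf _ (h2 _ ⟨by linarith, le_rfl⟩) (by simp [hε])).2.symm

/-- All along an edge, the face just below is the same. -/
lemma dnF_height_eq {e : E} {t t' : ℝ} (h : t ∈ Ioo (A.x (A.lv e)) (A.x (A.rv e)))
    (h' : t' ∈ Ioo (A.x (A.lv e)) (A.x (A.rv e))) :
    A.dnF t (A.height e t) = A.dnF t' (A.height e t') := by
  refine isPreconnected_Ioo.induction₂ (fun t t' => A.dnF t (A.height e t) =
    A.dnF t' (A.height e t')) (fun r hr => ?_) (fun _ _ _ _ _ _ h1 h2 => h1.trans h2)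
    (fun _ _ _ _ h => h.symm) h h'
  have h1 := (A.tendsto_graph (Sum.inl e) r).eventually (A.eventually_face_below hr).eventually_nhds
  refine nhdsWithin_le_nhds ?_
  filter_upwards [h1] with r' hr'
  obtain ⟨ε, hε, hf⟩ := Metric.eventually_nhds_iff_ball.1 hr'
  have h2 : ∀ s ∈ Ico (A.height e r' - ε / 2) (A.height e r'),
      (r', s) ∈ Metric.ball (r', A.height e r') ε := fun s hs => by
    rw [Metric.mem_ball, Prod.dist_eq, dist_self, Real.dist_eq, max_eq_right (abs_nonneg _),
      abs_of_neg (sub_neg.2 hs.2)]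
    linarith [hs.1]
  rw [A.dnF_eq (s := A.height e r') (r := A.height e r' - ε / 2) (by linarith)
    fun s hs => (hf _ (h2 s hs) hs.2).1]
  exact (hf _ (h2 _ ⟨le_rfl, by linarith⟩) (by simp [hε])).2.symm

end Finite

/-- The face that lies above a cell, read off over an arbitrary point of the cell. -/
noncomputable def upCell (c : E ⊕ Fin (n + 1)) : Set (ℝ × ℝ) :=
  A.upF (A.dom_nonempty c).choose (A.base c (A.dom_nonempty c).choose)

/-- The face that lies above an edge. -/
noncomputable def upE (e : E) : Set (ℝ × ℝ) := A.upCell (Sum.inl e)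

/-- The face that lies above the gap `i` of the boundary line. -/
noncomputable def upG (i : Fin (n + 1)) : Set (ℝ × ℝ) := A.upCell (Sum.inr i)

/-- The face that lies below an edge. -/
noncomputable def dnE (e : E) : Set (ℝ × ℝ) :=
  A.dnF (A.dom_nonempty (Sum.inl e)).choose (A.height e (A.dom_nonempty (Sum.inl e)).choose)

/-- The face that a vertex meets in the direction upwards. -/
noncomputable def upV (v : Vert n ι) : Set (ℝ × ℝ) := A.upF (A.x v) (A.y v)

/-- The face that a vertex meets in the direction downwards. It is the empty set for a boundary
vertex, below which there is no face. -/
noncomputable def dnV (v : Vert n ι) : Set (ℝ × ℝ) := A.dnF (A.x v) (A.y v)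

section Finite

variable [Finite E]

lemma upCell_eq {c : E ⊕ Fin (n + 1)} {t : ℝ} (h : t ∈ A.dom c) :
    A.upF t (A.base c t) = A.upCell c := A.upF_base_eq h (A.dom_nonempty c).choose_spec

lemma upE_eq {e : E} {t : ℝ} (h : t ∈ Ioo (A.x (A.lv e)) (A.x (A.rv e))) :
    A.upF t (A.height e t) = A.upE e := A.upCell_eq (c := Sum.inl e) h

lemma dnE_eq {e : E} {t : ℝ} (h : t ∈ Ioo (A.x (A.lv e)) (A.x (A.rv e))) :
    A.dnF t (A.height e t) = A.dnE e :=
  A.dnF_height_eq h (A.dom_nonempty (Sum.inl e)).choose_spec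

end Finite

end Arrangement

/-! ### Jumps of face functions along arcs around vertices -/

namespace Arrangement

variable {n : ℕ} {ι E : Type*} (A : Arrangement n ι E)

section Walk

variable [Fintype E] {M : Type*} [AddCommGroup M] (f : Set (ℝ × ℝ) → M)

/-- The jump across the edge `e` of a function of the faces. -/
noncomputable def jump (e : E) : M := f (A.upE e) - f (A.dnE e)

open Classical in
/-- The edges that cross the open vertical segment over `t` between the heights `s₀` and `s₁`. -/
noncomputable def crossing (t s₀ s₁ : ℝ) : Finset E :=
  {e | t ∈ Ioo (A.x (A.lv e)) (A.x (A.rv e)) ∧ A.height e t ∈ Ioo s₀ s₁}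

/-- The change of a function of the faces along a vertical segment is the sum of its jumps across
the edges that are crossed. -/
lemma sum_jump_crossing {t s₀ s₁ : ℝ} (h : s₀ < s₁) (h0 : 0 ≤ s₀)
    (hv : ∀ e, t ∈ Icc (A.x (A.lv e)) (A.x (A.rv e)) → A.height e t ∈ Ioo s₀ s₁ →
      t ∈ Ioo (A.x (A.lv e)) (A.x (A.rv e))) :
    f (A.dnF t s₁) - f (A.upF t s₀) = ∑ e ∈ A.crossing t s₀ s₁, A.jump f e := by
  classical
  induction hN : (A.crossing t s₀ s₁).card using Nat.strong_induction_on generalizing s₀ with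
  | _ N ih =>
  rcases (A.crossing t s₀ s₁).eq_empty_or_nonempty with hE | hE
  · have hempty : ∀ r ∈ Ioo s₀ s₁, (t, r) ∈ A.free := fun r hr => by
      refine ⟨h0.trans_lt hr.1, fun e he => ?_⟩
      have h1 : A.height e t ∈ Ioo s₀ s₁ := by rw [← he.2.2]; exact hr
      have : e ∈ A.crossing t s₀ s₁ := by simp [crossing, h1.1, h1.2, (hv e ⟨he.1, he.2.1⟩ h1).1,
        (hv e ⟨he.1, he.2.1⟩ h1).2]
      simp [hE] at this
    rw [A.upF_eq_dnF h hempty, hE]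
    simp
  · -- pass the lowest crossing `e`, and go on from there
    obtain ⟨e, he, hmin⟩ := Finset.exists_min_image _ (fun e => A.height e t) hE
    have he' := he
    simp only [crossing, Finset.mem_filter, Finset.mem_univ, true_and] at he'
    obtain ⟨het, heh⟩ := he'
    have hcr : A.crossing t s₀ s₁ = insert e (A.crossing t (A.height e t) s₁) := by
      ext e'
      simp only [Finset.mem_insert]
      constructor
      · intro h'
        by_cases hee : e' = e
        · exact Or.inl hee
        refine Or.inr ?_
        have hle := hmin e' h'
        simp only [crossing, Finset.mem_filter, Finset.mem_univ, true_and] at h' ⊢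
        refine ⟨h'.1, lt_of_le_of_ne hle fun heq => hee ?_, h'.2.2⟩
        exact (A.inter e e' t het.1 het.2 h'.1.1.le h'.1.2.le heq).symm
      · rintro (rfl | h')
        · exact he
        · simp only [crossing, Finset.mem_filter, Finset.mem_univ, true_and] at h' ⊢
          exact ⟨h'.1, heh.1.trans h'.2.1, h'.2.2⟩
    have hnot : e ∉ A.crossing t (A.height e t) s₁ := by simp [crossing]
    have hlow : ∀ r ∈ Ioo s₀ (A.height e t), (t, r) ∈ A.free := fun r hr => by
      refine ⟨h0.trans_lt hr.1, fun e' he' => ?_⟩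
      have h2 : A.height e' t = r := he'.2.2.symm
      have h1 : A.height e' t ∈ Ioo s₀ s₁ := by rw [h2]; exact ⟨hr.1, hr.2.trans heh.2⟩
      have := hmin e' (by simp [crossing, h1.1, h1.2, (hv e' ⟨he'.1, he'.2.1⟩ h1).1,
        (hv e' ⟨he'.1, he'.2.1⟩ h1).2])
      rw [h2] at this
      exact this.not_gt hr.2
    have key := ih _ (by rw [← hN, hcr, Finset.card_insert_of_notMem hnot]; omega) heh.2
      (h0.trans heh.1.le) (fun e' h1 h2 => hv e' h1 ⟨heh.1.trans h2.1, h2.2⟩) rfl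
    rw [hcr, Finset.sum_insert hnot, ← key, jump, A.upE_eq het, A.upF_eq_dnF heh.1 hlow,
      A.dnE_eq het]
    abel

end Walk

/-- The end point of an edge from which it leaves to the right (`true`) or to the left (`false`). -/
def endp (b : Bool) (e : E) : Vert n ι := if b then A.lv e else A.rv e

/-- The sign of a horizontal direction: `true` means right. -/
def sg (b : Bool) : ℝ := if b then 1 else -1

/-- The slope of an edge that is run through to the right (`true`) or to the left (`false`). -/
def rs (b : Bool) (e : E) : ℝ := sg b * A.slope e

lemma height_near {b : Bool} {e : E} {v : Vert n ι} (h : A.endp b e = v) (δ : ℝ) :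
    A.height e (A.x v + sg b * δ) = A.y v + δ * A.rs b e := by
  cases b
  · simp only [endp] at h
    subst h
    simp only [height, sg, rs, A.y_rv, Bool.false_eq_true, if_false]
    ring
  · simp only [endp] at h
    subst h
    simp only [height, sg, rs, if_true]
    ring

section Finite

variable [Fintype E]

/-- A bound that exceeds the modulus of all slopes. -/
noncomputable def slopeBound : ℝ := 1 + ∑ e, |A.slope e|

lemma one_le_slopeBound : 1 ≤ A.slopeBound := by
  have : 0 ≤ ∑ e, |A.slope e| := Finset.sum_nonneg fun _ _ => abs_nonneg _
  unfold slopeBound; linarith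

lemma abs_slope_lt (e : E) : |A.slope e| < A.slopeBound := by
  have := Finset.single_le_sum (f := fun e => |A.slope e|) (fun _ _ => abs_nonneg _)
    (Finset.mem_univ e)
  unfold slopeBound; linarith

lemma rs_lt (b : Bool) (e : E) : A.rs b e < A.slopeBound := by
  have := abs_lt.1 (A.abs_slope_lt e)
  cases b <;> simp [rs, sg] <;> linarith

lemma neg_lt_rs (b : Bool) (e : E) : -A.slopeBound < A.rs b e := by
  have := abs_lt.1 (A.abs_slope_lt e)
  cases b <;> simp [rs, sg] <;> linarith

lemma eventually_incident (v : Vert n ι) :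
    ∀ᶠ p in 𝓝 (A.x v, A.y v), ∀ e, A.On e p → A.lv e = v ∨ A.rv e = v := by
  refine eventually_all.2 fun e => ?_
  by_cases h : A.lv e = v ∨ A.rv e = v
  · simp [h]
  · have : (A.x v, A.y v) ∈ {p | A.On e p}ᶜ := fun h' => h <| by
      rcases A.vertex_on_edge e v h'.1 h'.2.1 h'.2.2 with h1 | h1
      · exact Or.inl h1.symm
      · exact Or.inr h1.symm
    filter_upwards [(A.isClosed_on e).isOpen_compl.eventually_mem this] with p hp hp'
    exact absurd hp' hp

lemma exists_incident (v : Vert n ι) : ∃ ρ > 0, ∀ p : ℝ × ℝ, |p.1 - A.x v| < ρ →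
    |p.2 - A.y v| < ρ → ∀ e, A.On e p → A.lv e = v ∨ A.rv e = v := by
  obtain ⟨ρ, hρ, h⟩ := Metric.eventually_nhds_iff_ball.1 (A.eventually_incident v)
  refine ⟨ρ, hρ, fun p h1 h2 => h p ?_⟩
  rw [Metric.mem_ball, Prod.dist_eq, Real.dist_eq, Real.dist_eq]
  exact max_lt h1 h2

omit [Fintype E] in
lemma On.sub_eq {e : E} {p : ℝ × ℝ} (h : A.On e p) {v : Vert n ι}
    (hv : A.lv e = v ∨ A.rv e = v) : p.2 - A.y v = (p.1 - A.x v) * A.slope e := by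
  rcases hv with rfl | rfl
  · rw [h.2.2, height]; ring
  · rw [h.2.2, height, A.y_rv]; ring

/-- The edges at a vertex stay outside the double cone about the vertical through the vertex. -/
lemma On.abs_lt {e : E} {p : ℝ × ℝ} (h : A.On e p) {v : Vert n ι}
    (hv : A.lv e = v ∨ A.rv e = v) (hne : p.2 ≠ A.y v) :
    |p.2 - A.y v| < A.slopeBound * |p.1 - A.x v| := by
  have h1 := h.sub_eq A hv
  have h2 : 0 < |p.1 - A.x v| := abs_pos.2 fun h0 => hne (by rw [h0] at h1; linarith)
  rw [h1, abs_mul, mul_comm]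
  exact mul_lt_mul_of_pos_right (A.abs_slope_lt e) h2

/-- The part below height `ε` of the upper cone at the vertex `v`. -/
def cone (v : Vert n ι) (ε : ℝ) : Set (ℝ × ℝ) :=
  {p | A.slopeBound * |p.1 - A.x v| ≤ p.2 - A.y v ∧ 0 < p.2 - A.y v ∧ p.2 - A.y v < ε}

/-- The part above depth `ε` of the lower cone at the vertex `v`. -/
def coneDn (v : Vert n ι) (ε : ℝ) : Set (ℝ × ℝ) :=
  {p | A.slopeBound * |p.1 - A.x v| ≤ A.y v - p.2 ∧ 0 < A.y v - p.2 ∧ A.y v - p.2 < ε}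

lemma convex_abs_cone (K a c σ : ℝ) (hK : 0 ≤ K) :
    Convex ℝ {p : ℝ × ℝ | K * |p.1 - a| ≤ σ * (p.2 - c)} := by
  have : {p : ℝ × ℝ | K * |p.1 - a| ≤ σ * (p.2 - c)} =
      {p : ℝ × ℝ | K * (p.1 - a) ≤ σ * (p.2 - c)} ∩
        {p : ℝ × ℝ | K * (a - p.1) ≤ σ * (p.2 - c)} := by
    ext p
    simp only [mem_ofPred_eq, mem_inter_iff]
    constructor
    · intro h
      exact ⟨(mul_le_mul_of_nonneg_left (le_abs_self _) hK).trans h,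
        (mul_le_mul_of_nonneg_left (by rw [abs_sub_comm]; exact le_abs_self _) hK).trans h⟩
    · rintro ⟨h1, h2⟩
      rcases abs_choice (p.1 - a) with h | h <;> rw [h] <;> linarith
  rw [this]
  refine Convex.inter ?_ ?_ <;>
  · intro p hp q hq α β hα hβ hab
    simp only [mem_ofPred_eq, Prod.fst_add, Prod.smul_fst, smul_eq_mul, Prod.snd_add,
      Prod.smul_snd] at *
    have h1 := mul_le_mul_of_nonneg_left hp hα
    have h2 := mul_le_mul_of_nonneg_left hq hβ
    obtain rfl : β = 1 - α := by linarith
    linarith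

lemma convex_snd_Ioo (a b : ℝ) : Convex ℝ {p : ℝ × ℝ | p.2 ∈ Ioo a b} :=
  (convex_Ioo a b).is_linear_preimage (f := Prod.snd) ⟨fun _ _ => rfl, fun _ _ => rfl⟩

lemma convex_cone (v : Vert n ι) (ε : ℝ) : Convex ℝ (A.cone v ε) := by
  have : A.cone v ε = {p : ℝ × ℝ | A.slopeBound * |p.1 - A.x v| ≤ 1 * (p.2 - A.y v)} ∩
      {p : ℝ × ℝ | p.2 ∈ Ioo (A.y v) (A.y v + ε)} := by
    ext p
    simp only [cone, mem_ofPred_eq, mem_inter_iff, one_mul, mem_Ioo, sub_pos,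
      sub_lt_iff_lt_add']
  rw [this]
  exact (convex_abs_cone _ _ _ _ (by linarith [A.one_le_slopeBound])).inter (convex_snd_Ioo _ _)

lemma convex_coneDn (v : Vert n ι) (ε : ℝ) : Convex ℝ (A.coneDn v ε) := by
  have : A.coneDn v ε = {p : ℝ × ℝ | A.slopeBound * |p.1 - A.x v| ≤ -1 * (p.2 - A.y v)} ∩
      {p : ℝ × ℝ | p.2 ∈ Ioo (A.y v - ε) (A.y v)} := by
    ext p
    simp only [coneDn, mem_ofPred_eq, mem_inter_iff, neg_mul, one_mul, neg_sub, mem_Ioo, sub_pos]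
    constructor <;> rintro ⟨h1, h2, h3⟩ <;> exact ⟨h1, by linarith, by linarith⟩
  rw [this]
  exact (convex_abs_cone _ _ _ _ (by linarith [A.one_le_slopeBound])).inter (convex_snd_Ioo _ _)

/-- The tip of the upper cone at a vertex lies in a single face. -/
lemma exists_cone (v : Vert n ι) : ∃ ε > 0, ∀ p ∈ A.cone v ε, p ∈ A.free ∧ A.face p = A.upV v := by
  obtain ⟨ρ, hρ, h⟩ := A.exists_incident v
  have hfree : A.cone v ρ ⊆ A.free := by
    rintro p ⟨h1, h2, h3⟩
    refine ⟨by linarith [A.y_nonneg v], fun e he => ?_⟩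
    have hdx : |p.1 - A.x v| < ρ := by
      have := A.one_le_slopeBound
      have := abs_nonneg (p.1 - A.x v)
      nlinarith
    have hi := h p hdx (by rwa [abs_of_pos h2]) e he
    have := he.abs_lt A hi (by linarith)
    rw [abs_of_pos h2] at this
    linarith
  have hax : ∀ r, 0 < r → r < ρ → (A.x v, A.y v + r) ∈ A.cone v ρ := fun r h1 h2 => by
    simp [cone, h1, h2, h1.le]
  refine ⟨ρ, hρ, fun p hp => ⟨hfree hp, ?_⟩⟩
  rw [upV, A.upF_eq (r := A.y v + ρ / 2) (by linarith) fun r hr => ?_]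
  · exact A.face_eq_of_isPreconnected (A.convex_cone v ρ).isPreconnected hfree hp
      (hax _ (by linarith) (by linarith))
  · have := hfree (hax (r - A.y v) (by linarith [hr.1]) (by linarith [hr.2]))
    simpa using this

lemma exists_coneDn (a : ι) : ∃ ε > 0, ∀ p ∈ A.coneDn (Sum.inr a) ε,
    p ∈ A.free ∧ A.face p = A.dnV (Sum.inr a) := by
  obtain ⟨ρ', hρ', h⟩ := A.exists_incident (Sum.inr a)
  set v : Vert n ι := Sum.inr a
  have hy : 0 < A.y v := A.y_inr a
  set ρ := min ρ' (A.y v)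
  have hρ : 0 < ρ := lt_min hρ' hy
  have hfree : A.coneDn v ρ ⊆ A.free := by
    rintro p ⟨h1, h2, h3⟩
    have hlt := h3.trans_le (min_le_left _ _)
    refine ⟨by linarith [h3.trans_le (min_le_right _ _)], fun e he => ?_⟩
    have hdx : |p.1 - A.x v| < ρ' := by
      have := A.one_le_slopeBound
      have := abs_nonneg (p.1 - A.x v)
      nlinarith
    have hi := h p hdx (by rwa [abs_sub_comm, abs_of_pos h2]) e he
    have := he.abs_lt A hi (by linarith)
    rw [abs_sub_comm, abs_of_pos h2] at this
    linarith
  have hax : ∀ r, 0 < r → r < ρ → (A.x v, A.y v - r) ∈ A.coneDn v ρ := fun r h1 h2 => by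
    simp [coneDn, h1, h2, h1.le]
  refine ⟨ρ, hρ, fun p hp => ⟨hfree hp, ?_⟩⟩
  rw [dnV, A.dnF_eq (r := A.y v - ρ / 2) (by linarith) fun r hr => ?_]
  · exact A.face_eq_of_isPreconnected (A.convex_coneDn v ρ).isPreconnected hfree hp
      (hax _ (by linarith) (by linarith))
  · have := hfree (hax (A.y v - r) (by linarith [hr.2]) (by linarith [hr.1]))
    simpa using this

lemma abs_sg_mul (b : Bool) {δ : ℝ} (h : 0 < δ) : |sg b * δ| = δ := by
  cases b <;> simp [sg, abs_of_pos h]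

omit [Fintype E] in
lemma eventually_mem_Ioo (b : Bool) (e : E) : ∀ᶠ δ in 𝓝[>] (0 : ℝ),
    A.x (A.endp b e) + sg b * δ ∈ Ioo (A.x (A.lv e)) (A.x (A.rv e)) := by
  filter_upwards [Ioo_mem_nhdsGT (sub_pos.2 (A.lv_lt_rv e))] with δ hδ
  cases b <;> simp only [endp, sg, Bool.false_eq_true, if_false, if_true] <;>
    constructor <;> linarith [hδ.1, hδ.2]

/-- Close to a vertex `v`, a vertical line at distance `δ` meets between the two cones only
the edges that leave `v` to the side in question. -/
lemma eventually_side (v : Vert n ι) (b : Bool) : ∀ᶠ δ in 𝓝[>] (0 : ℝ),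
    (∀ e, A.endp b e = v → A.x v + sg b * δ ∈ Ioo (A.x (A.lv e)) (A.x (A.rv e))) ∧
    ∀ e, A.x v + sg b * δ ∈ Icc (A.x (A.lv e)) (A.x (A.rv e)) →
      |A.height e (A.x v + sg b * δ) - A.y v| ≤ δ * A.slopeBound → A.endp b e = v := by
  obtain ⟨ρ, hρ, h⟩ := A.exists_incident v
  have hK := A.one_le_slopeBound
  have h1 : ∀ᶠ δ in 𝓝[>] (0 : ℝ), ∀ e, A.endp b e = v →
      A.x v + sg b * δ ∈ Ioo (A.x (A.lv e)) (A.x (A.rv e)) := by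
    refine eventually_all.2 fun e => ?_
    by_cases he : A.endp b e = v
    · filter_upwards [A.eventually_mem_Ioo b e] with δ hδ _
      rwa [← he]
    · simp [he]
  filter_upwards [h1, Ioo_mem_nhdsGT (show 0 < ρ / A.slopeBound by positivity)] with δ h1 hδ
  refine ⟨h1, fun e he hh => ?_⟩
  have h2 : δ * A.slopeBound < ρ := (lt_div_iff₀ (by linarith)).1 hδ.2
  have h3 : δ < ρ := by nlinarith [hδ.1]
  have h4 := h (A.x v + sg b * δ, A.height e (A.x v + sg b * δ))
    (by simpa [abs_sg_mul b hδ.1] using h3) (hh.trans_lt h2) e ⟨he.1, he.2, rfl⟩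
  have hδ0 := hδ.1
  cases b
  · rcases h4 with h4 | h4
    · have := he.1
      rw [h4] at this
      simp only [sg, Bool.false_eq_true, if_false] at this
      linarith
    · simpa [endp] using h4
  · rcases h4 with h4 | h4
    · simpa [endp] using h4
    · have := he.2
      rw [h4] at this
      simp only [sg, if_true] at this
      linarith

lemma eventually_upV (v : Vert n ι) (b : Bool) : ∀ᶠ δ in 𝓝[>] (0 : ℝ),
    (A.x v + sg b * δ, A.y v + δ * A.slopeBound) ∈ A.free ∧
    A.face (A.x v + sg b * δ, A.y v + δ * A.slopeBound) = A.upV v := by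
  obtain ⟨ε, hε, h⟩ := A.exists_cone v
  have hK := A.one_le_slopeBound
  filter_upwards [Ioo_mem_nhdsGT (show 0 < ε / A.slopeBound by positivity)] with δ hδ
  have h2 : δ * A.slopeBound < ε := (lt_div_iff₀ (by linarith)).1 hδ.2
  refine h _ ⟨?_, ?_, ?_⟩
  · simp only [add_sub_cancel_left, abs_sg_mul b hδ.1]; linarith
  · simpa using mul_pos hδ.1 (show 0 < A.slopeBound by linarith)
  · simpa using h2

lemma eventually_dnV (a : ι) (b : Bool) : ∀ᶠ δ in 𝓝[>] (0 : ℝ),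
    (A.x (Sum.inr a) + sg b * δ, A.y (Sum.inr a) - δ * A.slopeBound) ∈ A.free ∧
    A.face (A.x (Sum.inr a) + sg b * δ, A.y (Sum.inr a) - δ * A.slopeBound) =
      A.dnV (Sum.inr a) := by
  obtain ⟨ε, hε, h⟩ := A.exists_coneDn a
  have hK := A.one_le_slopeBound
  filter_upwards [Ioo_mem_nhdsGT (show 0 < ε / A.slopeBound by positivity)] with δ hδ
  have h2 : δ * A.slopeBound < ε := (lt_div_iff₀ (by linarith)).1 hδ.2
  refine h _ ⟨?_, ?_, ?_⟩
  · simp only [add_sub_cancel_left, sub_sub_cancel, abs_sg_mul b hδ.1]; linarith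
  · simpa using mul_pos hδ.1 (show 0 < A.slopeBound by linarith)
  · simpa using h2

section Sums

variable {M : Type*} [AddCommGroup M] (f : Set (ℝ × ℝ) → M)

open Classical in
/-- Turning at a vertex from an edge up to the vertical direction. -/
lemma upV_sub_upE (v : Vert n ι) (b : Bool) {g : E} (hg : A.endp b g = v) :
    f (A.upV v) - f (A.upE g) =
      ∑ e with A.endp b e = v ∧ A.rs b g < A.rs b e, A.jump f e := by
  have hpos : ∀ᶠ δ in 𝓝[>] (0 : ℝ), 0 < δ := self_mem_nhdsWithin
  -- the turn is made along the vertical segment at a small distance `δ` from the vertex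
  obtain ⟨δ, ⟨⟨h1, h2⟩, h3, h4⟩, hδ⟩ :=
    (((A.eventually_side v b).and (A.eventually_upV v b)).and hpos).exists
  have hgt := h1 g hg
  have hgh := A.height_near hg δ
  have hlt : A.height g (A.x v + sg b * δ) < A.y v + δ * A.slopeBound := by
    rw [hgh]; linarith [mul_lt_mul_of_pos_left (A.rs_lt b g) hδ]
  have hside : ∀ e, A.x v + sg b * δ ∈ Icc (A.x (A.lv e)) (A.x (A.rv e)) →
      A.height e (A.x v + sg b * δ) ∈
        Ioo (A.height g (A.x v + sg b * δ)) (A.y v + δ * A.slopeBound) → A.endp b e = v := by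
    intro e he hh
    refine h2 e he (abs_le.2 ⟨?_, by linarith [hh.2]⟩)
    have := mul_lt_mul_of_pos_left (A.neg_lt_rs b g) hδ
    have := hh.1
    rw [hgh] at this
    linarith
  rw [← h4, ← A.dnF_of_mem h3, ← A.upE_eq hgt,
    A.sum_jump_crossing f hlt (A.height_pos hgt).le fun e he hh => h1 e (hside e he hh)]
  refine Finset.sum_congr (Finset.ext fun e => ?_) fun _ _ => rfl
  simp only [crossing, Finset.mem_filter, Finset.mem_univ, true_and]
  constructor
  · rintro ⟨h5, h6⟩
    have := hside e (Ioo_subset_Icc_self h5) h6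
    refine ⟨this, ?_⟩
    have := h6.1
    rw [hgh, A.height_near ‹_› δ] at this
    exact lt_of_mul_lt_mul_left (by linarith) hδ.le
  · rintro ⟨h5, h6⟩
    refine ⟨h1 e h5, ?_, ?_⟩
    · rw [hgh, A.height_near h5 δ]; linarith [mul_lt_mul_of_pos_left h6 hδ]
    · rw [A.height_near h5 δ]; linarith [mul_lt_mul_of_pos_left (A.rs_lt b e) hδ]

open Classical in
/-- Turning at an internal vertex from the direction downwards up to an edge. -/
lemma dnE_sub_dnV (a : ι) (b : Bool) {g : E} (hg : A.endp b g = Sum.inr a) :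
    f (A.dnE g) - f (A.dnV (Sum.inr a)) =
      ∑ e with A.endp b e = Sum.inr a ∧ A.rs b e < A.rs b g, A.jump f e := by
  have hpos : ∀ᶠ δ in 𝓝[>] (0 : ℝ), 0 < δ := self_mem_nhdsWithin
  obtain ⟨δ, ⟨⟨h1, h2⟩, h3, h4⟩, hδ⟩ :=
    (((A.eventually_side (Sum.inr a) b).and (A.eventually_dnV a b)).and hpos).exists
  set v : Vert n ι := Sum.inr a
  have hgt := h1 g hg
  have hgh := A.height_near hg δ
  have hlt : A.y v - δ * A.slopeBound < A.height g (A.x v + sg b * δ) := by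
    rw [hgh]; linarith [mul_lt_mul_of_pos_left (A.neg_lt_rs b g) hδ]
  have hside : ∀ e, A.x v + sg b * δ ∈ Icc (A.x (A.lv e)) (A.x (A.rv e)) →
      A.height e (A.x v + sg b * δ) ∈
        Ioo (A.y v - δ * A.slopeBound) (A.height g (A.x v + sg b * δ)) → A.endp b e = v := by
    intro e he hh
    refine h2 e he (abs_le.2 ⟨by linarith [hh.1], ?_⟩)
    have := mul_lt_mul_of_pos_left (A.rs_lt b g) hδ
    have := hh.2
    rw [hgh] at this
    linarith
  rw [← h4, ← A.upF_of_mem h3, ← A.dnE_eq hgt,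
    A.sum_jump_crossing f hlt h3.1.le fun e he hh => h1 e (hside e he hh)]
  refine Finset.sum_congr (Finset.ext fun e => ?_) fun _ _ => rfl
  simp only [crossing, Finset.mem_filter, Finset.mem_univ, true_and]
  constructor
  · rintro ⟨h5, h6⟩
    have := hside e (Ioo_subset_Icc_self h5) h6
    refine ⟨this, ?_⟩
    have := h6.2
    rw [hgh, A.height_near ‹_› δ] at this
    exact lt_of_mul_lt_mul_left (by linarith) hδ.le
  · rintro ⟨h5, h6⟩
    refine ⟨h1 e h5, ?_, ?_⟩
    · rw [A.height_near h5 δ]; linarith [mul_lt_mul_of_pos_left (A.neg_lt_rs b e) hδ]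
    · rw [hgh, A.height_near h5 δ]; linarith [mul_lt_mul_of_pos_left h6 hδ]

open Classical in
/-- The half-turn at an internal vertex from the direction downwards to the direction upwards. -/
lemma upV_sub_dnV (a : ι) (b : Bool) :
    f (A.upV (Sum.inr a)) - f (A.dnV (Sum.inr a)) =
      ∑ e with A.endp b e = Sum.inr a, A.jump f e := by
  have hpos : ∀ᶠ δ in 𝓝[>] (0 : ℝ), 0 < δ := self_mem_nhdsWithin
  obtain ⟨δ, ⟨⟨⟨h1, h2⟩, h3, h4⟩, h5, h6⟩, hδ⟩ :=
    ((((A.eventually_side (Sum.inr a) b).and (A.eventually_dnV a b)).and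
      (A.eventually_upV (Sum.inr a) b)).and hpos).exists
  set v : Vert n ι := Sum.inr a
  have hK := A.one_le_slopeBound
  have hlt : A.y v - δ * A.slopeBound < A.y v + δ * A.slopeBound := by nlinarith
  have hside : ∀ e, A.x v + sg b * δ ∈ Icc (A.x (A.lv e)) (A.x (A.rv e)) →
      A.height e (A.x v + sg b * δ) ∈
        Ioo (A.y v - δ * A.slopeBound) (A.y v + δ * A.slopeBound) → A.endp b e = v :=
    fun e he hh => h2 e he (abs_le.2 ⟨by linarith [hh.1], by linarith [hh.2]⟩)
  rw [← h4, ← h6, ← A.upF_of_mem h3, ← A.dnF_of_mem h5,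
    A.sum_jump_crossing f hlt h3.1.le fun e he hh => h1 e (hside e he hh)]
  refine Finset.sum_congr (Finset.ext fun e => ?_) fun _ _ => rfl
  simp only [crossing, Finset.mem_filter, Finset.mem_univ, true_and]
  refine ⟨fun h => hside e (Ioo_subset_Icc_self h.1) h.2, fun h => ⟨h1 e h, ?_, ?_⟩⟩
  · rw [A.height_near h δ]; linarith [mul_lt_mul_of_pos_left (A.neg_lt_rs b e) hδ]
  · rw [A.height_near h δ]; linarith [mul_lt_mul_of_pos_left (A.rs_lt b e) hδ]

/-- The gap of the boundary line next to a boundary vertex on the right or on the left. -/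
def gapAt (b : Bool) (j : Fin n) : Fin (n + 1) := if b then j.castSucc else j.succ

omit [Fintype E] in
lemma eventually_mem_gapAt (b : Bool) (j : Fin n) : ∀ᶠ δ in 𝓝[>] (0 : ℝ),
    A.x (Sum.inl j) + sg b * δ ∈ A.dom (Sum.inr (gapAt b j)) := by
  have h : ∀ j', ∀ᶠ δ in 𝓝[>] (0 : ℝ), j' ≠ j → δ < |A.x (Sum.inl j') - A.x (Sum.inl j)| := by
    intro j'
    by_cases hj : j' = j
    · simp [hj]
    · have : 0 < |A.x (Sum.inl j') - A.x (Sum.inl j)| :=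
        abs_pos.2 (sub_ne_zero.2 fun h => hj (A.anti.injective h))
      filter_upwards [Ioo_mem_nhdsGT this] with δ hδ _
      exact hδ.2
  filter_upwards [eventually_all.2 h, self_mem_nhdsWithin] with δ hδ hpos j'
  have hpos : 0 < δ := hpos
  rcases lt_trichotomy j' j with hj | rfl | hj
  · have h1 := A.anti hj
    have h2 := hδ j' hj.ne
    simp only at h1
    rw [abs_of_pos (sub_pos.2 h1)] at h2
    cases b <;> simp only [gapAt, sg, Bool.false_eq_true, if_false, if_true, Fin.val_succ,
      Fin.val_castSucc] <;> rw [Fin.lt_def] at hj <;> constructor <;> intro h3 <;>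
      first | omega | linarith
  · cases b <;> simp only [gapAt, sg, Bool.false_eq_true, if_false, if_true, Fin.val_succ,
      Fin.val_castSucc] <;> constructor <;> intro h3 <;>
      first | omega | linarith
  · have h1 := A.anti hj
    have h2 := hδ j' hj.ne'
    simp only at h1
    rw [abs_of_neg (sub_neg.2 h1)] at h2
    cases b <;> simp only [gapAt, sg, Bool.false_eq_true, if_false, if_true, Fin.val_succ,
      Fin.val_castSucc] <;> rw [Fin.lt_def] at hj <;> constructor <;> intro h3 <;>
      first | omega | linarith

open Classical in
/-- The quarter-turn at a boundary vertex from the boundary line to the direction upwards. -/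
lemma upV_sub_upG (j : Fin n) (b : Bool) :
    f (A.upV (Sum.inl j)) - f (A.upG (gapAt b j)) =
      ∑ e with A.endp b e = Sum.inl j, A.jump f e := by
  have hpos : ∀ᶠ δ in 𝓝[>] (0 : ℝ), 0 < δ := self_mem_nhdsWithin
  obtain ⟨δ, ⟨⟨⟨h1, h2⟩, h3⟩, h5, h6⟩, hδ⟩ :=
    ((((A.eventually_side (Sum.inl j) b).and (A.eventually_mem_gapAt b j)).and
      (A.eventually_upV (Sum.inl j) b)).and hpos).exists
  have hy := A.y_inl j
  set v : Vert n ι := Sum.inl j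
  have hK := A.one_le_slopeBound
  have hlt : 0 < A.y v + δ * A.slopeBound := by rw [hy, zero_add]; positivity
  have hside : ∀ e, A.x v + sg b * δ ∈ Icc (A.x (A.lv e)) (A.x (A.rv e)) →
      A.height e (A.x v + sg b * δ) ∈ Ioo 0 (A.y v + δ * A.slopeBound) → A.endp b e = v :=
    fun e he hh => h2 e he (abs_le.2 ⟨by linarith [hh.1], by linarith [hh.2]⟩)
  have h7 := A.upCell_eq h3
  rw [upG, ← h7, ← h6, ← A.dnF_of_mem h5]
  simp only [base]
  rw [A.sum_jump_crossing f hlt le_rfl fun e he hh => h1 e (hside e he hh)]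
  refine Finset.sum_congr (Finset.ext fun e => ?_) fun _ _ => rfl
  simp only [crossing, Finset.mem_filter, Finset.mem_univ, true_and]
  refine ⟨fun h => hside e (Ioo_subset_Icc_self h.1) h.2, fun h => ⟨h1 e h, ?_, ?_⟩⟩
  · exact A.height_pos (h1 e h)
  · rw [A.height_near h δ]; linarith [mul_lt_mul_of_pos_left (A.rs_lt b e) hδ]

end Sums

end Finite

end Arrangement

/-! ### The face at infinity and the boundary of a face -/

namespace Arrangement

variable {n : ℕ} {ι E : Type*} (A : Arrangement n ι E)

section Top

variable [Fintype E]

/-- A height above which there are no edges. -/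
noncomputable def topHeight : ℝ := 1 + ∑ e, (A.y (A.lv e) + A.y (A.rv e))

/-- The face at infinity. -/
noncomputable def top : Set (ℝ × ℝ) := A.face (0, A.topHeight)

lemma one_le_topHeight : 1 ≤ A.topHeight := by
  have : 0 ≤ ∑ e, (A.y (A.lv e) + A.y (A.rv e)) :=
    Finset.sum_nonneg fun _ _ => add_nonneg (A.y_nonneg _) (A.y_nonneg _)
  unfold topHeight; linarith

lemma height_lt_topHeight {e : E} {t : ℝ} (h : t ∈ Icc (A.x (A.lv e)) (A.x (A.rv e))) :
    A.height e t < A.topHeight := by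
  have h1 := Finset.single_le_sum (f := fun e => A.y (A.lv e) + A.y (A.rv e))
    (fun _ _ => add_nonneg (A.y_nonneg _) (A.y_nonneg _)) (Finset.mem_univ e)
  have key : (A.x (A.rv e) - A.x (A.lv e)) * (A.y (A.lv e) + A.y (A.rv e) - A.height e t) =
      (t - A.x (A.lv e)) * A.y (A.lv e) + (A.x (A.rv e) - t) * A.y (A.rv e) := by
    rw [A.y_rv, height]; ring
  have h2 : 0 ≤ (A.x (A.rv e) - A.x (A.lv e)) *
      (A.y (A.lv e) + A.y (A.rv e) - A.height e t) := by
    rw [key]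
    exact add_nonneg (mul_nonneg (sub_nonneg.2 h.1) (A.y_nonneg _))
      (mul_nonneg (sub_nonneg.2 h.2) (A.y_nonneg _))
  have h3 := nonneg_of_mul_nonneg_right h2 (sub_pos.2 (A.lv_lt_rv e))
  unfold topHeight; linarith

lemma mem_free_of_topHeight_le {p : ℝ × ℝ} (h : A.topHeight ≤ p.2) : p ∈ A.free := by
  refine ⟨by linarith [A.one_le_topHeight], fun e he => ?_⟩
  have := A.height_lt_topHeight (e := e) ⟨he.1, he.2.1⟩
  rw [← he.2.2] at this
  exact this.not_ge h

lemma face_of_topHeight_le {p : ℝ × ℝ} (h : A.topHeight ≤ p.2) : A.face p = A.top := by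
  refine A.face_eq_of_isPreconnected (S := {p : ℝ × ℝ | p.2 ∈ Ici A.topHeight})
    (Convex.isPreconnected ?_) (fun q hq => A.mem_free_of_topHeight_le hq) h (le_refl A.topHeight)
  exact (convex_Ici _).is_linear_preimage (f := Prod.snd) ⟨fun _ _ => rfl, fun _ _ => rfl⟩

omit [Fintype E] in
lemma face_eq_of_mem {p q : ℝ × ℝ} (h : q ∈ A.face p) : A.face p = A.face q :=
  connectedComponentIn_eq h

omit [Fintype E] in
lemma face_subset (p : ℝ × ℝ) : A.face p ⊆ A.free := connectedComponentIn_subset _ _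

omit [Fintype E] in
lemma mem_face {p : ℝ × ℝ} (h : p ∈ A.free) : p ∈ A.face p := mem_connectedComponentIn h

lemma isOpen_face (p : ℝ × ℝ) : IsOpen (A.face p) := A.isOpen_free.connectedComponentIn

lemma eventually_face_eq {p : ℝ × ℝ} (h : p ∈ A.free) :
    ∀ᶠ q in 𝓝 p, q ∈ A.free ∧ A.face q = A.face p := by
  filter_upwards [(A.isOpen_face p).mem_nhds (A.mem_face h)] with q hq
  exact ⟨A.face_subset p hq, (A.face_eq_of_mem hq).symm⟩

/-- A point can be moved within its face off the verticals through the ends of edges. -/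
lemma exists_generic {p : ℝ × ℝ} (h : p ∈ A.free) :
    ∃ t, (t, p.2) ∈ A.free ∧ A.face (t, p.2) = A.face p ∧
      ∀ e, t ≠ A.x (A.lv e) ∧ t ≠ A.x (A.rv e) := by
  have h1 : Tendsto (fun t => (t, p.2)) (𝓝[>] p.1) (𝓝 p) :=
    ((Continuous.prodMk_left p.2).tendsto p.1).mono_left nhdsWithin_le_nhds
  have h2 : ∀ c : ℝ, ∀ᶠ t in 𝓝[>] p.1, t ≠ c := fun c => by
    rcases le_or_gt c p.1 with hc | hc
    · filter_upwards [self_mem_nhdsWithin] with t ht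
      exact (hc.trans_lt ht).ne'
    · filter_upwards [Ioo_mem_nhdsGT hc] with t ht
      exact ht.2.ne
  obtain ⟨t, ht, hg⟩ := ((h1.eventually (A.eventually_face_eq h)).and
    (eventually_all.2 fun e => (h2 (A.x (A.lv e))).and (h2 (A.x (A.rv e))))).exists
  exact ⟨t, ht.1, ht.2, hg⟩

/-- A function of the faces without jumps is constant. -/
lemma eq_top_of_jump_eq_zero {M : Type*} [AddCommGroup M] (f : Set (ℝ × ℝ) → M)
    (hf : ∀ e, A.jump f e = 0) {p : ℝ × ℝ} (hp : p ∈ A.free) : f (A.face p) = f A.top := by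
  obtain ⟨t, h1, h2, h3⟩ := A.exists_generic hp
  have key := A.sum_jump_crossing f (t := t) (s₀ := p.2) (s₁ := max A.topHeight (p.2 + 1))
    (lt_max_of_lt_right (by linarith)) h1.1.le
    (fun e he _ => ⟨lt_of_le_of_ne he.1 (h3 e).1.symm, lt_of_le_of_ne he.2 (h3 e).2⟩)
  rw [Finset.sum_eq_zero fun e _ => hf e, A.upF_of_mem h1,
    A.dnF_of_mem (A.mem_free_of_topHeight_le (le_max_left _ _)),
    A.face_of_topHeight_le (le_max_left _ _), sub_eq_zero, h2] at key
  exact key.symm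

open Classical in
/-- The vertical ray from a boundary vertex leads to the face at infinity. -/
lemma top_sub_upV {M : Type*} [AddCommGroup M] (f : Set (ℝ × ℝ) → M) (j : Fin n) :
    f A.top - f (A.upV (Sum.inl j)) =
      ∑ e with A.x (Sum.inl j) ∈ Ioo (A.x (A.lv e)) (A.x (A.rv e)), A.jump f e := by
  have hT := A.one_le_topHeight
  have hne : ∀ v, 0 < A.y v → A.x (Sum.inl j) ≠ A.x v := by
    rintro (j' | a) hv
    · exact absurd (A.y_inl j') hv.ne'
    · exact A.x_inl_ne j a
  have key := A.sum_jump_crossing f (t := A.x (Sum.inl j)) (s₀ := A.y (Sum.inl j))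
    (s₁ := A.topHeight) (by rw [A.y_inl]; linarith) (A.y_inl j).ge (fun e he hh => ?_)
  · rw [A.dnF_of_mem (A.mem_free_of_topHeight_le (p := (_, A.topHeight)) le_rfl),
      A.face_of_topHeight_le (p := (_, A.topHeight)) le_rfl] at key
    rw [upV, key]
    refine Finset.sum_congr (Finset.ext fun e => ?_) fun _ _ => rfl
    simp only [crossing, Finset.mem_filter, Finset.mem_univ, true_and]
    refine ⟨fun h => h.1, fun h => ⟨h, ?_, A.height_lt_topHeight (Ioo_subset_Icc_self h)⟩⟩
    rw [A.y_inl]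
    exact A.height_pos h
  · rw [A.y_inl] at hh
    refine ⟨lt_of_le_of_ne he.1 fun h => ?_, lt_of_le_of_ne he.2 fun h => ?_⟩
    · refine hne _ ?_ h.symm
      rw [← A.height_lv, h]
      exact hh.1
    · refine hne _ ?_ h
      rw [← A.height_rv, ← h]
      exact hh.1

lemma upF_zero_eq_top {t : ℝ} (h : ∀ e, t ∉ Icc (A.x (A.lv e)) (A.x (A.rv e))) :
    A.upF t 0 = A.top := by
  rw [A.upF_eq (r := A.topHeight) (by linarith [A.one_le_topHeight])
    fun r hr => ⟨hr.1, fun e he => h e ⟨he.1, he.2.1⟩⟩]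
  exact A.face_of_topHeight_le le_rfl

lemma exists_right : ∃ t, (∀ e, A.x (A.rv e) < t) ∧ ∀ j : Fin n, A.x (Sum.inl j) < t := by
  obtain ⟨M, hM⟩ := Finite.exists_le fun e => A.x (A.rv e)
  obtain ⟨M', hM'⟩ := Finite.exists_le fun j : Fin n => A.x (Sum.inl j)
  exact ⟨max M M' + 1, fun e => by linarith [hM e, le_max_left M M'],
    fun j => by linarith [hM' j, le_max_right M M']⟩

lemma exists_left : ∃ t, (∀ e, t < A.x (A.lv e)) ∧ ∀ j : Fin n, t < A.x (Sum.inl j) := by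
  obtain ⟨M, hM⟩ := Finite.exists_ge fun e => A.x (A.lv e)
  obtain ⟨M', hM'⟩ := Finite.exists_ge fun j : Fin n => A.x (Sum.inl j)
  exact ⟨min M M' - 1, fun e => by linarith [hM e, min_le_left M M'],
    fun j => by linarith [hM' j, min_le_right M M']⟩

omit [Fintype E] in
lemma mem_dom_zero {t : ℝ} : t ∈ A.dom (Sum.inr 0) ↔ ∀ j : Fin n, A.x (Sum.inl j) < t := by
  simp [dom]

omit [Fintype E] in
lemma mem_dom_last {t : ℝ} :
    t ∈ A.dom (Sum.inr (Fin.last n)) ↔ ∀ j : Fin n, t < A.x (Sum.inl j) := by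
  refine ⟨fun h j => (h j).1 j.isLt, fun h j => ⟨fun _ => h j, fun h' => ?_⟩⟩
  exact absurd h' (by simp)

lemma upG_zero : A.upG 0 = A.top := by
  obtain ⟨t, h1, h2⟩ := A.exists_right
  rw [upG, ← A.upCell_eq (A.mem_dom_zero.2 h2)]
  exact A.upF_zero_eq_top fun e he => (h1 e).not_ge he.2

lemma upG_last : A.upG (Fin.last n) = A.top := by
  obtain ⟨t, h1, h2⟩ := A.exists_left
  rw [upG, ← A.upCell_eq (A.mem_dom_last.2 h2)]
  exact A.upF_zero_eq_top fun e he => (h1 e).not_ge he.1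

end Top

section Frontier

variable [Fintype E] {p₀ : ℝ × ℝ}

lemma mem_closure_of_upF_eq {t s : ℝ} (hs : 0 ≤ s) (h : A.upF t s = A.face p₀) :
    (t, s) ∈ closure (A.face p₀) := by
  obtain ⟨ε, hε, hf⟩ := A.exists_up t hs
  have h1 : ∀ r ∈ Ioo s (s + ε), (t, r) ∈ A.face p₀ := fun r hr => by
    rw [← h, A.upF_eq hr.1 fun r' hr' => hf r' ⟨hr'.1, hr'.2.trans_lt hr.2⟩]
    exact A.mem_face (hf r hr)
  have h2 : s ∈ closure (Ioo s (s + ε)) := by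
    rw [closure_Ioo (by linarith)]; exact ⟨le_rfl, by linarith⟩
  exact map_mem_closure (Continuous.prodMk_right t) h2 h1

lemma mem_closure_of_dnF_eq {t s : ℝ} (hs : 0 < s) (h : A.dnF t s = A.face p₀) :
    (t, s) ∈ closure (A.face p₀) := by
  obtain ⟨ε, hε, hf⟩ := A.exists_dn t hs
  have h1 : ∀ r ∈ Ioo (s - ε) s, (t, r) ∈ A.face p₀ := fun r hr => by
    rw [← h, A.dnF_eq hr.2 fun r' hr' => hf r' ⟨hr.1.trans_le hr'.1, hr'.2⟩]
    exact A.mem_face (hf r hr)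
  have h2 : s ∈ closure (Ioo (s - ε) s) := by
    rw [closure_Ioo (by linarith)]; exact ⟨by linarith, le_rfl⟩
  exact map_mem_closure (Continuous.prodMk_right t) h2 h1

lemma mem_frontier_iff {p : ℝ × ℝ} (h : p ∉ A.free) :
    p ∈ frontier (A.face p₀) ↔ p ∈ closure (A.face p₀) := by
  rw [(A.isOpen_face p₀).frontier_eq]
  exact ⟨fun h => h.1, fun h' => ⟨h', fun h'' => h (A.face_subset _ h'')⟩⟩

omit [Fintype E] in
lemma not_mem_free_of_on {e : E} {p : ℝ × ℝ} (h : A.On e p) : p ∉ A.free := fun h' => h'.2 e h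

/-- The edges in the boundary of a face. -/
lemma on_subset_frontier_iff {e : E} :
    {p | A.On e p} ⊆ frontier (A.face p₀) ↔ A.upE e = A.face p₀ ∨ A.dnE e = A.face p₀ := by
  constructor
  · intro h
    obtain ⟨t, ht⟩ := A.dom_nonempty (Sum.inl e : E ⊕ Fin (n + 1))
    have hon : A.On e (t, A.height e t) := ⟨ht.1.le, ht.2.le, rfl⟩
    have h1 := (A.mem_frontier_iff (A.not_mem_free_of_on hon)).1 (h hon)
    obtain ⟨p, hp, ha, hb, hd⟩ := ((mem_closure_iff_frequently.1 h1).and_eventually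
      ((A.eventually_face_above ht).and ((A.eventually_face_below ht).and
        (continuous_fst.continuousAt.eventually_mem (isOpen_Ioo.mem_nhds ht))))).exists
    rw [A.face_eq_of_mem hp]
    rcases lt_trichotomy p.2 (A.height e p.1) with hlt | heq | hgt
    · right; rw [(hb hlt).2, A.dnE_eq ht]
    · exact absurd (A.face_subset _ hp) (A.not_mem_free_of_on ⟨hd.1.le, hd.2.le, heq⟩)
    · left; rw [(ha hgt).2, A.upCell_eq ht]; rfl
  · intro h
    have h1 : ∀ t ∈ Ioo (A.x (A.lv e)) (A.x (A.rv e)),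
        (t, A.height e t) ∈ frontier (A.face p₀) := fun t ht => by
      rw [A.mem_frontier_iff (A.not_mem_free_of_on (e := e) ⟨ht.1.le, ht.2.le, rfl⟩)]
      rcases h with h | h
      · exact A.mem_closure_of_upF_eq (A.height_pos ht).le (by rw [A.upE_eq ht, h])
      · exact A.mem_closure_of_dnF_eq (A.height_pos ht) (by rw [A.dnE_eq ht, h])
    intro p hp
    have h2 : p.1 ∈ closure (Ioo (A.x (A.lv e)) (A.x (A.rv e))) := by
      rw [closure_Ioo (A.lv_lt_rv e).ne]; exact ⟨hp.1, hp.2.1⟩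
    have h3 := map_mem_closure (f := fun t => (t, A.height e t))
      (continuous_id.prodMk (A.continuous_height e)) h2 h1
    rw [isClosed_frontier.closure_eq] at h3
    rwa [← hp.2.2] at h3

omit [Fintype E] in
lemma on_endp (b : Bool) (e : E) : A.On e (A.x (A.endp b e), A.y (A.endp b e)) := by
  have := (A.lv_lt_rv e).le
  cases b
  · exact ⟨this, le_rfl, by simp [endp]⟩
  · exact ⟨le_rfl, this, by simp [endp]⟩

/-- The vertices in the boundary of a face. -/
lemma vertex_mem_frontier_iff {v : Vert n ι} (hv : ∃ b e, A.endp b e = v) :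
    (A.x v, A.y v) ∈ frontier (A.face p₀) ↔
      ∃ b e, A.endp b e = v ∧ (A.upE e = A.face p₀ ∨ A.dnE e = A.face p₀) := by
  classical
  constructor
  swap
  · rintro ⟨b, e, rfl, h⟩
    exact A.on_subset_frontier_iff.2 h (A.on_endp b e)
  intro hfr
  by_contra! hne
  obtain ⟨b₀, e₀, he₀⟩ := hv
  have hfree : (A.x v, A.y v) ∉ A.free := by
    rw [← he₀]; exact A.not_mem_free_of_on (A.on_endp b₀ e₀)
  have hcl := (A.mem_frontier_iff hfree).1 hfr
  -- if no edge at `v` borders on the face, its indicator function `f` vanishes all around `v`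
  set f : Set (ℝ × ℝ) → ℤ := fun S => if S = A.face p₀ then 1 else 0
  have hU : ∀ b e, A.endp b e = v → f (A.upE e) = 0 := fun b e h => if_neg (hne b e h).1
  have hJ : ∀ b e, A.endp b e = v → A.jump f e = 0 := fun b e h => by
    rw [jump, hU b e h, show f (A.dnE e) = 0 from if_neg (hne b e h).2, sub_zero]
  have hup : f (A.upV v) = 0 := by
    have := A.upV_sub_upE f v b₀ he₀
    rw [hU _ _ he₀, Finset.sum_eq_zero fun e he =>
      hJ b₀ e (by simpa using (Finset.mem_filter.1 he).2.1)] at this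
    simpa using this
  have hdn : ∀ a, v = Sum.inr a → f (A.dnV v) = 0 := by
    rintro a rfl
    have := A.upV_sub_dnV f a b₀
    rw [hup, Finset.sum_eq_zero fun e he => hJ b₀ e (by simpa using he)] at this
    simpa using this
  obtain ⟨ε, hε, hcone⟩ := A.exists_cone v
  obtain ⟨ε', hε', hconeDn⟩ : ∃ ε > 0, ∀ p ∈ A.coneDn v ε, p ∈ A.free → f (A.face p) = 0 := by
    rcases v with j | a
    · refine ⟨1, one_pos, fun p hp hp' => ?_⟩
      have := hp.2.1
      rw [A.y_inl] at this
      linarith [hp'.1]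
    · obtain ⟨ε, hε, h⟩ := A.exists_coneDn a
      exact ⟨ε, hε, fun p hp _ => by rw [(h p hp).2]; exact hdn a rfl⟩
  have hside := fun b => mem_nhdsGT_iff_exists_Ioo_subset.1
    (eventually_iff.1 ((A.eventually_side v b).and (A.eventually_upV v b)))
  choose δ₀ hδ₀ hside using hside
  have hδmin : 0 < min (δ₀ true) (δ₀ false) := lt_min (hδ₀ _) (hδ₀ _)
  -- a point of the face close to `v` lies outside the cones, and a vertical segment leads from it
  -- to the upper cone
  obtain ⟨p, hp, hp1, hp2⟩ := ((mem_closure_iff_frequently.1 hcl).and_eventually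
    ((continuous_fst.continuousAt.eventually_mem (Metric.ball_mem_nhds _ hδmin)).and
      (continuous_snd.continuousAt.eventually_mem
        (Metric.ball_mem_nhds _ (lt_min hε hε'))))).exists
  simp only [Metric.mem_ball, Real.dist_eq] at hp1 hp2
  have hpf := A.face_subset _ hp
  have hfp : f (A.face p) ≠ 0 := by
    rw [← A.face_eq_of_mem hp]; simp [f]
  have hpy : |p.2 - A.y v| < A.slopeBound * |p.1 - A.x v| := by
    by_contra! hge
    have hne' : p.2 ≠ A.y v := fun h => by
      rw [h, sub_self, abs_zero] at hge
      have h1 := A.one_le_slopeBound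
      have h2 := abs_nonneg (p.1 - A.x v)
      have h3 : p.1 = A.x v := sub_eq_zero.1 (abs_eq_zero.1 (by nlinarith))
      exact hfree (by rw [← h, ← h3]; exact hpf)
    rcases lt_or_gt_of_ne hne' with hlt | hgt
    · rw [abs_of_neg (sub_neg.2 hlt)] at hge hp2
      exact hfp (hconeDn p ⟨by linarith, by linarith, by linarith [hp2.trans_le (min_le_right _ _)]⟩
        hpf)
    · rw [abs_of_pos (sub_pos.2 hgt)] at hge hp2
      refine hfp ?_
      rw [(hcone p ⟨hge, by linarith, hp2.trans_le (min_le_left _ _)⟩).2, hup]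
  have hdx : 0 < |p.1 - A.x v| :=
    pos_of_mul_pos_right ((abs_nonneg _).trans_lt hpy) (by linarith [A.one_le_slopeBound])
  obtain ⟨b, hb⟩ : ∃ b, p.1 = A.x v + sg b * |p.1 - A.x v| := by
    rcases abs_choice (p.1 - A.x v) with h | h
    · exact ⟨true, by rw [h]; simp [sg]⟩
    · exact ⟨false, by rw [h]; simp [sg]⟩
  set δ := |p.1 - A.x v|
  have hδb : δ < δ₀ b := by
    cases b
    · exact hp1.trans_le (min_le_right _ _)
    · exact hp1.trans_le (min_le_left _ _)
  obtain ⟨⟨h1, h2⟩, h3, h4⟩ := hside b ⟨hdx, hδb⟩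
  have hpe : p = (A.x v + sg b * δ, p.2) := Prod.ext hb rfl
  rw [abs_lt] at hpy
  have hinc : ∀ e, A.x v + sg b * δ ∈ Icc (A.x (A.lv e)) (A.x (A.rv e)) →
      A.height e (A.x v + sg b * δ) ∈ Ioo p.2 (A.y v + δ * A.slopeBound) → A.endp b e = v :=
    fun e he hh => h2 e he (abs_le.2 ⟨by linarith [hh.1], by linarith [hh.2]⟩)
  have key := A.sum_jump_crossing f (t := A.x v + sg b * δ) (s₀ := p.2)
    (s₁ := A.y v + δ * A.slopeBound) (by linarith) hpf.1.le (fun e he hh => h1 e (hinc e he hh))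
  rw [Finset.sum_eq_zero, A.dnF_of_mem h3, h4, hup, A.upF_of_mem (by rwa [← hpe]), ← hpe] at key
  · exact hfp (by linarith)
  · intro e he
    simp only [crossing, Finset.mem_filter, Finset.mem_univ, true_and] at he
    exact hJ b e (hinc e (Ioo_subset_Icc_self he.1) he.2)

/-- The gaps of the boundary line in the boundary of a face. -/
lemma gap_mem_frontier_iff {i : Fin (n + 1)} {t : ℝ} (h : t ∈ A.dom (Sum.inr i)) :
    (t, (0 : ℝ)) ∈ frontier (A.face p₀) ↔ A.upG i = A.face p₀ := by
  rw [A.mem_frontier_iff fun h => h.1.false]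
  constructor
  · intro hcl
    obtain ⟨p, hp, ha⟩ := ((mem_closure_iff_frequently.1 hcl).and_eventually
      (A.eventually_face_above h)).exists
    rw [A.face_eq_of_mem hp, (ha (A.face_subset _ hp).1).2, A.upCell_eq h]
    rfl
  · intro hi
    refine A.mem_closure_of_upF_eq le_rfl ?_
    rw [← hi]
    exact A.upCell_eq h

/-- The arc of the boundary line outside the boundary vertices. -/
def outer : Set (ℝ × ℝ) :=
  {p | p.2 = 0 ∧ ¬ ∃ i j : Fin n, A.x (Sum.inl i) < p.1 ∧ p.1 < A.x (Sum.inl j)}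

lemma outer_subset_frontier_iff : A.outer ⊆ frontier (A.face p₀) ↔ A.face p₀ = A.top := by
  constructor
  · intro h
    obtain ⟨t, -, ht⟩ := A.exists_right
    have h1 : (t, (0 : ℝ)) ∈ A.outer :=
      ⟨rfl, fun ⟨i, j, _, hj⟩ => (ht j).not_gt hj⟩
    rw [← A.upG_zero]
    exact ((A.gap_mem_frontier_iff (A.mem_dom_zero.2 ht)).1 (h h1)).symm
  · rintro h ⟨t, s⟩ ⟨hs, hp⟩
    simp only at hs hp
    subst hs
    have hcont : Continuous fun t : ℝ => (t, (0 : ℝ)) := by fun_prop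
    have hcl : ∀ S : Set ℝ, t ∈ closure S → (∀ r ∈ S, (r, (0 : ℝ)) ∈ frontier (A.face p₀)) →
        (t, (0 : ℝ)) ∈ frontier (A.face p₀) := fun S h1 h2 => by
      have := map_mem_closure hcont h1 h2
      rwa [isClosed_frontier.closure_eq] at this
    by_cases hall : ∀ j : Fin n, t ≤ A.x (Sum.inl j)
    · refine hcl (Iio t) (by simp) fun r hr => ?_
      exact (A.gap_mem_frontier_iff (A.mem_dom_last.2 fun j => lt_of_lt_of_le hr (hall j))).2
        (by rw [A.upG_last, h])
    · push Not at hall hp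
      obtain ⟨i, hi⟩ := hall
      refine hcl (Ioi t) (by simp) fun r hr => ?_
      exact (A.gap_mem_frontier_iff (A.mem_dom_zero.2 fun j => (hp i j hi).trans_lt hr)).2
        (by rw [A.upG_zero, h])

end Frontier

end Arrangement

/-! ### The first cell below a point -/

namespace Arrangement

variable {n : ℕ} {ι E : Type*} (A : Arrangement n ι E)

/-- The vertical ray that goes down from `(t, s)` first meets the cell `c`, in its interior. -/
def FirstBelow (t s : ℝ) (c : E ⊕ Fin (n + 1)) : Prop :=
  t ∈ A.dom c ∧ A.base c t < s ∧ ∀ r ∈ Ioo (A.base c t) s, (t, r) ∈ A.free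

section Uniqueness

variable {A}

lemma not_mem_free_base {c : E ⊕ Fin (n + 1)} {t : ℝ} (h : t ∈ A.dom c) :
    (t, A.base c t) ∉ A.free := by
  rcases c with e | i
  · exact A.not_mem_free_of_on (e := e) ⟨h.1.le, h.2.le, rfl⟩
  · exact fun h => h.1.false

lemma eq_of_base_eq {c c' : E ⊕ Fin (n + 1)} {t : ℝ} (h : t ∈ A.dom c) (h' : t ∈ A.dom c')
    (hb : A.base c t = A.base c' t) : c = c' := by
  rcases c with e | i <;> rcases c' with e' | i'
  · rw [A.inter e e' t h.1 h.2 h'.1.le h'.2.le hb]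
  · exact absurd hb (A.height_pos h).ne'
  · exact absurd hb (A.height_pos h').ne
  · congr 1
    by_contra hne
    rcases lt_or_gt_of_ne hne with hlt | hlt
    · have hi : i.val < n := by omega
      exact ((h ⟨i, hi⟩).2 le_rfl).not_gt ((h' ⟨i, hi⟩).1 hlt)
    · have hi : i'.val < n := by omega
      exact ((h' ⟨i', hi⟩).2 le_rfl).not_gt ((h ⟨i', hi⟩).1 hlt)

lemma FirstBelow.unique {c c' : E ⊕ Fin (n + 1)} {t s : ℝ} (h : A.FirstBelow t s c)
    (h' : A.FirstBelow t s c') : c = c' := by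
  rcases lt_trichotomy (A.base c t) (A.base c' t) with hlt | heq | hlt
  · exact absurd (h.2.2 _ ⟨hlt, h'.2.1⟩) (not_mem_free_base h'.1)
  · exact eq_of_base_eq h.1 h'.1 heq
  · exact absurd (h'.2.2 _ ⟨hlt, h.2.1⟩) (not_mem_free_base h.1)

end Uniqueness

lemma exists_gap {t : ℝ} (h : ∀ j : Fin n, A.x (Sum.inl j) ≠ t) :
    ∃ i : Fin (n + 1), t ∈ A.dom (Sum.inr i) := by
  classical
  have hex : ∃ m, ∀ j : Fin n, m ≤ j.val → A.x (Sum.inl j) < t := ⟨n, fun j hj => by omega⟩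
  have hle : Nat.find hex ≤ n := Nat.find_min' hex fun j hj => by omega
  refine ⟨⟨Nat.find hex, by omega⟩, fun j => ⟨fun hj => ?_, fun hj => Nat.find_spec hex j hj⟩⟩
  simp only at hj
  have := Nat.find_min hex (m := Nat.find hex - 1) (by omega)
  push Not at this
  obtain ⟨j', hj', ht⟩ := this
  have h1 : A.x (Sum.inl j') ≤ A.x (Sum.inl j) := A.anti.antitone (Fin.le_def.2 (by omega))
  exact (lt_of_le_of_ne ht (h j').symm).trans_le h1

section Finite

variable [Fintype E]

lemma FirstBelow.face_eq {t s : ℝ} {c : E ⊕ Fin (n + 1)} (h : A.FirstBelow t s c)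
    (hf : (t, s) ∈ A.free) : A.face (t, s) = A.upCell c := by
  rw [← A.upCell_eq h.1, A.upF_eq h.2.1 fun r hr => ?_]
  rcases eq_or_lt_of_le hr.2 with h1 | h1
  · rwa [h1]
  · exact h.2.2 r ⟨hr.1, h1⟩

/-- Going down from a point one first meets a cell or a vertex. -/
lemma exists_firstBelow_or_vertex (t : ℝ) {s : ℝ} (hs : 0 < s) :
    (∃ c, A.FirstBelow t s c) ∨
      ∃ v, A.x v = t ∧ A.y v < s ∧ ∀ r ∈ Ioo (A.y v) s, (t, r) ∈ A.free := by
  classical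
  set F : Finset E := {e | t ∈ Icc (A.x (A.lv e)) (A.x (A.rv e)) ∧ A.height e t < s}
  rcases F.eq_empty_or_nonempty with hF | hF
  · have hfree : ∀ r ∈ Ioo 0 s, (t, r) ∈ A.free := fun r hr => ⟨hr.1, fun e he => by
      have : e ∈ F := by
        simp only [F, Finset.mem_filter, Finset.mem_univ, true_and]
        exact ⟨⟨he.1, he.2.1⟩, by rw [← he.2.2]; exact hr.2⟩
      simp [hF] at this⟩
    by_cases h : ∀ j : Fin n, A.x (Sum.inl j) ≠ t
    · obtain ⟨i, hi⟩ := A.exists_gap h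
      exact Or.inl ⟨Sum.inr i, hi, hs, hfree⟩
    · push Not at h
      obtain ⟨j, hj⟩ := h
      exact Or.inr ⟨Sum.inl j, hj, by rwa [A.y_inl], by rwa [A.y_inl]⟩
  · obtain ⟨e, he, hmax⟩ := F.exists_max_image (fun e => A.height e t) hF
    simp only [F, Finset.mem_filter, Finset.mem_univ, true_and] at he hmax
    obtain ⟨het, hes⟩ := he
    have hfree : ∀ r ∈ Ioo (A.height e t) s, (t, r) ∈ A.free := fun r hr =>
      ⟨(A.height_nonneg het).trans_lt hr.1, fun e' he' => by
        have h1 : A.height e' t = r := he'.2.2.symm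
        have := hmax e' ⟨⟨he'.1, he'.2.1⟩, by rw [h1]; exact hr.2⟩
        rw [h1] at this
        exact this.not_gt hr.1⟩
    rcases eq_or_lt_of_le het.1 with h1 | h1
    · refine Or.inr ⟨A.lv e, h1, ?_⟩
      rw [← A.height_lv, h1]
      exact ⟨hes, hfree⟩
    rcases eq_or_lt_of_le het.2 with h2 | h2
    · refine Or.inr ⟨A.rv e, h2.symm, ?_⟩
      rw [← A.height_rv, ← h2]
      exact ⟨hes, hfree⟩
    · exact Or.inl ⟨Sum.inl e, ⟨h1, h2⟩, hes, hfree⟩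

/-- A vertical segment in the complement of the edges can be moved and extended a little. -/
lemma eventually_free_vertical {t r s : ℝ} (hr : ∀ r' ∈ Icc r s, (t, r') ∈ A.free)
    (hrs : r ≤ s) : ∃ s' > s, ∀ᶠ t' in 𝓝 t, ∀ r' ∈ Icc r s', (t', r') ∈ A.free := by
  obtain ⟨ε, hε, hf⟩ := A.exists_up t (hr s ⟨hrs, le_rfl⟩).1.le
  refine ⟨s + ε / 2, by linarith, ?_⟩
  refine isCompact_Icc.eventually_forall_of_forall_eventually fun r' hr' => ?_
  have : (t, r') ∈ A.free := by
    rcases le_or_gt r' s with h | h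
    · exact hr r' ⟨hr'.1, h⟩
    · exact hf r' ⟨h, by linarith [hr'.2]⟩
  exact A.isOpen_free.eventually_mem this

lemma FirstBelow.eventually {t s : ℝ} {c : E ⊕ Fin (n + 1)} (h : A.FirstBelow t s c)
    (hf : (t, s) ∈ A.free) : ∀ᶠ q in 𝓝 (t, s), A.FirstBelow q.1 q.2 c := by
  obtain ⟨ε, hε, hb⟩ := Metric.eventually_nhds_iff_ball.1 (A.eventually_free_above h.1)
  set m := A.base c t
  have hms : m < s := h.2.1
  obtain ⟨r, hr1, hr2⟩ := exists_between (lt_min hms (show m < m + ε by linarith))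
  rw [lt_min_iff] at hr2
  obtain ⟨s', hs', hv⟩ := A.eventually_free_vertical (t := t) (r := r) (s := s)
    (fun r' hr' => by
      rcases eq_or_lt_of_le hr'.2 with h1 | h1
      · rwa [h1]
      · exact h.2.2 r' ⟨hr1.trans_le hr'.1, h1⟩) hr2.1.le
  have h1 := (A.continuous_base c).continuousAt.eventually_mem
    (Ioo_mem_nhds (show m - ε < m by linarith) hr1) (x := t)
  have h2 := ((hv.and h1).and ((A.isOpen_dom c).eventually_mem h.1)).and
    (Metric.ball_mem_nhds t hε)
  rw [nhds_prod_eq]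
  refine (h2.prod_mk (Ioo_mem_nhds hr2.1 hs')).mono ?_
  rintro ⟨t', s''⟩ ⟨⟨⟨⟨h3, h4⟩, h5⟩, h6⟩, h7⟩
  simp only at h3 h4 h5 h6 h7
  refine ⟨h5, h4.2.trans h7.1, fun r' hr' => ?_⟩
  rcases le_or_gt r r' with h8 | h8
  · exact h3 r' ⟨h8, by linarith [hr'.2, h7.2]⟩
  · refine hb _ ?_ hr'.1
    rw [Metric.mem_ball, Prod.dist_eq]
    refine max_lt h6 ?_
    rw [Real.dist_eq, abs_lt]
    constructor <;> linarith [hr'.1, h4.1]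

/-- Over a connected set without edges, and off the verticals through the vertices, the first cell
below does not change. -/
lemma exists_firstBelow_of_isPreconnected {S : Set (ℝ × ℝ)} (hS : IsPreconnected S)
    (hSf : S ⊆ A.free) (hg : ∀ q ∈ S, ∀ v, A.x v ≠ q.1) :
    ∃ c, ∀ q ∈ S, A.FirstBelow q.1 q.2 c := by
  have hex : ∀ q ∈ S, ∃ c, A.FirstBelow q.1 q.2 c := fun q hq =>
    (A.exists_firstBelow_or_vertex q.1 (hSf hq).1).resolve_right
      fun ⟨v, hv, _⟩ => hg q hq v hv
  rcases S.eq_empty_or_nonempty with rfl | ⟨p, hp⟩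
  · exact ⟨Sum.inr 0, by simp⟩
  obtain ⟨c, hc⟩ := hex p hp
  refine ⟨c, fun q hq => ?_⟩
  obtain ⟨c', h1, h2⟩ := hS.induction₂
    (fun p q => ∃ c, A.FirstBelow p.1 p.2 c ∧ A.FirstBelow q.1 q.2 c)
    (fun q hq => by
      obtain ⟨c, hc⟩ := hex q hq
      exact nhdsWithin_le_nhds ((hc.eventually A (hSf hq)).mono fun q' hq' => ⟨c, hc, hq'⟩))
    (fun _ _ _ _ _ _ ⟨c, h1, h2⟩ ⟨c', h3, h4⟩ => ⟨c, h1, by rwa [h2.unique h3]⟩)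
    (fun _ _ _ _ ⟨c, h1, h2⟩ => ⟨c, h2, h1⟩) hp hq
  rwa [hc.unique h1]

variable [Finite ι]

/-- Just above a vertex, and strictly to one side of it, the first cell below is always the same. -/
lemma exists_sideCell (b : Bool) (v : Vert n ι) : ∃ c, ∃ ε > 0, ∀ q ∈ A.cone v ε,
    0 < sg b * (q.1 - A.x v) → A.FirstBelow q.1 q.2 c := by
  obtain ⟨ε, hε, hc⟩ := A.exists_cone v
  have h1 : ∀ᶠ δ in 𝓝[>] (0 : ℝ), ∀ w, A.x w ≠ A.x v → δ < |A.x w - A.x v| := by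
    refine eventually_all.2 fun w => ?_
    by_cases hw : A.x w = A.x v
    · simp [hw]
    · filter_upwards [Ioo_mem_nhdsGT (abs_pos.2 (sub_ne_zero.2 hw))] with δ hδ _
      exact hδ.2
  obtain ⟨δ, ⟨hδ, hδε⟩, hδ0⟩ := ((h1.and (Ioo_mem_nhdsGT hε)).and self_mem_nhdsWithin).exists
  have hδ0 : 0 < δ := hδ0
  have hsub : A.cone v δ ⊆ A.cone v ε := fun q hq => ⟨hq.1, hq.2.1, hq.2.2.trans hδε.2⟩
  have hconv : Convex ℝ (A.cone v δ ∩ {q | 0 < sg b * (q.1 - A.x v)}) := by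
    refine (A.convex_cone v δ).inter ?_
    intro p hp q hq α β hα hβ hab
    simp only [mem_ofPred_eq, Prod.fst_add, Prod.smul_fst, smul_eq_mul] at *
    obtain rfl : β = 1 - α := by linarith
    rcases eq_or_lt_of_le hα with rfl | h0
    · linarith
    · have h1 := mul_pos h0 hp
      have h2 := mul_nonneg hβ hq.le
      linarith
  obtain ⟨c, h⟩ := A.exists_firstBelow_of_isPreconnected hconv.isPreconnected
    (fun q hq => (hc q (hsub hq.1)).1) (fun q hq w hw => by
      have h3 : q.1 - A.x v ≠ 0 := fun h0 => by
        have := hq.2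
        simp [h0] at this
      have h4 := hδ w (by rw [hw]; exact sub_ne_zero.1 h3)
      rw [hw] at h4
      have h5 := A.one_le_slopeBound
      have h6 := hq.1.1
      have h7 := hq.1.2.2
      nlinarith)
  exact ⟨c, δ, hδ0, fun q hq hs => h q ⟨hq, hs⟩⟩

/-- The cell that lies below the points just above a vertex and slightly to one side of it. -/
noncomputable def sideCell (b : Bool) (v : Vert n ι) : E ⊕ Fin (n + 1) :=
  (A.exists_sideCell b v).choose

/-- Along the vertical segment above a vertex, the first cell below does not change on either
side. -/
lemma eventually_firstBelow_sideCell (b : Bool) {v : Vert n ι} {s : ℝ} (hs : A.y v < s)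
    (hf : ∀ r ∈ Ioc (A.y v) s, (A.x v, r) ∈ A.free) :
    ∀ᶠ q in 𝓝 (A.x v, s), 0 < sg b * (q.1 - A.x v) → A.FirstBelow q.1 q.2 (A.sideCell b v) := by
  obtain ⟨ε, hε, hc⟩ := (A.exists_sideCell b v).choose_spec
  obtain ⟨r, hr1, hr2⟩ := exists_between (lt_min hs (show A.y v < A.y v + ε by linarith))
  rw [lt_min_iff] at hr2
  obtain ⟨s', hs', hv⟩ := A.eventually_free_vertical (t := A.x v) (r := r) (s := s)
    (fun r' hr' => hf r' ⟨hr1.trans_le hr'.1, hr'.2⟩) hr2.1.le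
  have h1 : ∀ᶠ t in 𝓝 (A.x v), A.slopeBound * |t - A.x v| ≤ r - A.y v := by
    have : Tendsto (fun t => A.slopeBound * |t - A.x v|) (𝓝 (A.x v))
        (𝓝 (A.slopeBound * |A.x v - A.x v|)) := Continuous.tendsto (by fun_prop) _
    rw [sub_self, abs_zero, mul_zero] at this
    exact (this.eventually (gt_mem_nhds (sub_pos.2 hr1))).mono fun _ h => h.le
  rw [nhds_prod_eq]
  refine ((hv.and h1).prod_mk (Ioo_mem_nhds hr2.1 hs')).mono ?_
  rintro ⟨t, s''⟩ ⟨⟨h2, h3⟩, h4⟩ hside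
  simp only at h2 h3 h4 hside
  obtain ⟨h5, h6, h7⟩ := hc (t, r) ⟨h3, by simpa using hr1, by linarith [hr2.2]⟩ hside
  refine ⟨h5, h6.trans h4.1, fun r' hr' => ?_⟩
  rcases lt_or_ge r' r with h8 | h8
  · exact h7 r' ⟨hr'.1, h8⟩
  · exact h2 r' ⟨h8, by linarith [hr'.2, h4.2]⟩

/-- Off the verticals through the vertices there is always a first cell below. -/
lemma frequently_firstBelow {p : ℝ × ℝ} (hp : p ∈ A.free) :
    ∃ᶠ q in 𝓝 p, (∀ v, A.x v ≠ q.1) ∧ ∃ c, A.FirstBelow q.1 q.2 c := by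
  have h1 : Tendsto (fun t => (t, p.2)) (𝓝[>] p.1) (𝓝 p) :=
    ((Continuous.prodMk_left p.2).tendsto p.1).mono_left nhdsWithin_le_nhds
  refine h1.frequently (Eventually.frequently ?_)
  have h2 : ∀ᶠ t in 𝓝[>] p.1, ∀ v, A.x v ≠ t := eventually_all.2 fun v => by
    rcases le_or_gt (A.x v) p.1 with hc | hc
    · filter_upwards [self_mem_nhdsWithin] with t ht
      exact (hc.trans_lt ht).ne
    · filter_upwards [Ioo_mem_nhdsGT hc] with t ht
      exact ht.2.ne'
  filter_upwards [h2] with t ht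
  exact ⟨ht, (A.exists_firstBelow_or_vertex t hp.1).resolve_right fun ⟨v, hv, _⟩ => ht v hv⟩

/-- Every face lies above some cell. -/
lemma exists_upCell_eq {p : ℝ × ℝ} (hp : p ∈ A.free) : ∃ c, A.upCell c = A.face p := by
  obtain ⟨q, ⟨-, c, hc⟩, hq, hqp⟩ :=
    ((A.frequently_firstBelow hp).and_eventually (A.eventually_face_eq hp)).exists
  exact ⟨c, by rw [← hqp, ← hc.face_eq A hq]⟩

/-- The cells below a face are linked with each other through the vertices below it: if `φ` agrees
on the two cells next to each such vertex, it is constant. -/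
theorem eq_of_upCell_eq {α : Type*} (φ : E ⊕ Fin (n + 1) → α) {p₀ : ℝ × ℝ}
    (hφ : ∀ v, A.upV v = A.face p₀ → φ (A.sideCell true v) = φ (A.sideCell false v))
    {c c' : E ⊕ Fin (n + 1)} (hc : A.upCell c = A.face p₀) (hc' : A.upCell c' = A.face p₀) :
    φ c = φ c' := by
  -- `H p y`: the value of `φ` at the first cell below points near `p` is `y`
  set H : ℝ × ℝ → α → Prop := fun p y =>
    ∀ᶠ q in 𝓝 p, (∀ v, A.x v ≠ q.1) → ∀ c, A.FirstBelow q.1 q.2 c → φ c = y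
  -- such a value exists, is unique and is locally constant on the face; passing over a vertex is
  -- harmless by `hφ`
  have hfirst : ∀ t s c, (t, s) ∈ A.free → A.FirstBelow t s c → H (t, s) (φ c) :=
    fun t s c hf h => (h.eventually A hf).mono fun q hq _ c' hc' => by rw [hc'.unique hq]
  have huniq : ∀ p ∈ A.face p₀, ∀ y y', H p y → H p y' → y = y' := fun p hp y y' h h' => by
    obtain ⟨q, ⟨hg, c, hc⟩, h1, h2⟩ :=
      ((A.frequently_firstBelow (A.face_subset _ hp)).and_eventually (h.and h')).exists
    rw [← h1 hg c hc, ← h2 hg c hc]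
  have hex : ∀ p ∈ A.face p₀, ∃ y, H p y := by
    rintro ⟨t, s⟩ hp
    have hf := A.face_subset _ hp
    rcases A.exists_firstBelow_or_vertex t hf.1 with ⟨c, hc⟩ | ⟨v, rfl, hs, hv⟩
    · exact ⟨_, hfirst t s c hf hc⟩
    · have hv' : ∀ r ∈ Ioc (A.y v) s, (A.x v, r) ∈ A.free := fun r hr => by
        rcases eq_or_lt_of_le hr.2 with h1 | h1
        · rwa [h1]
        · exact hv r ⟨hr.1, h1⟩
      have hup : A.upV v = A.face p₀ := by
        rw [upV, A.upF_eq hs hv', A.face_eq_of_mem hp]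
      refine ⟨φ (A.sideCell true v), ?_⟩
      filter_upwards [A.eventually_firstBelow_sideCell true hs hv',
        A.eventually_firstBelow_sideCell false hs hv'] with q h1 h2 hg c hc
      rcases lt_or_gt_of_ne (hg v) with h3 | h3
      · rw [hc.unique (h1 (by simp [sg, h3]))]
      · rw [hc.unique (h2 (by simp [sg, h3])), hφ v hup]
  have hstart : ∀ c, A.upCell c = A.face p₀ → ∃ p ∈ A.face p₀, H p (φ c) := fun c hc => by
    obtain ⟨t, ht⟩ := A.dom_nonempty c
    obtain ⟨ε, hε, hf⟩ := A.exists_up t (A.base_nonneg ht)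
    have h1 : A.FirstBelow t (A.base c t + ε / 2) c :=
      ⟨ht, by linarith, fun r hr => hf r ⟨hr.1, by linarith [hr.2]⟩⟩
    have h2 : (t, A.base c t + ε / 2) ∈ A.free := hf _ ⟨by linarith, by linarith⟩
    refine ⟨_, ?_, hfirst _ _ _ h2 h1⟩
    rw [← hc, ← h1.face_eq A h2]
    exact A.mem_face h2
  obtain ⟨p, hp, hpc⟩ := hstart c hc
  obtain ⟨p', hp', hpc'⟩ := hstart c' hc'
  obtain ⟨y, h1, h2⟩ := (isPreconnected_connectedComponentIn (x := p₀) (F := A.free)).induction₂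
    (fun p q => ∃ y, H p y ∧ H q y)
    (fun q hq => by
      obtain ⟨y, hy⟩ := hex q hq
      exact nhdsWithin_le_nhds ((eventually_eventually_nhds.2 hy).mono fun q' hq' => ⟨y, hy, hq'⟩))
    (fun p q r _ hq _ ⟨y, h1, h2⟩ ⟨y', h3, h4⟩ => ⟨y, h1, by rwa [huniq q hq _ _ h2 h3]⟩)
    (fun _ _ _ _ ⟨y, h1, h2⟩ => ⟨y, h2, h1⟩) hp hp'
  rw [huniq p hp _ _ hpc h1, huniq p' hp' _ _ hpc' h2]

end Finite

end Arrangement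

/-! ### The Euler characteristic of a face -/

namespace Arrangement

variable {n : ℕ} {ι E : Type*} (A : Arrangement n ι E) [Fintype E]

lemma exists_upF_eq (t : ℝ) {s : ℝ} (hs : 0 ≤ s) : ∃ p ∈ A.free, A.upF t s = A.face p := by
  obtain ⟨ε, hε, hf⟩ := A.exists_up t hs
  exact ⟨(t, s + ε / 2), hf _ ⟨by linarith, by linarith⟩,
    A.upF_eq (by linarith) fun r hr => hf r ⟨hr.1, by linarith [hr.2]⟩⟩

lemma exists_dnF_eq (t : ℝ) {s : ℝ} (hs : 0 < s) : ∃ p ∈ A.free, A.dnF t s = A.face p := by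
  obtain ⟨ε, hε, hf⟩ := A.exists_dn t hs
  exact ⟨(t, s - ε / 2), hf _ ⟨by linarith, by linarith⟩,
    A.dnF_eq (by linarith) fun r hr => hf r ⟨by linarith [hr.1], hr.2⟩⟩

open Classical in
/-- The finite set of all faces. -/
noncomputable def faces : Finset (Set (ℝ × ℝ)) := Finset.univ.image A.upCell

lemma exists_of_mem_faces {Ω : Set (ℝ × ℝ)} (h : Ω ∈ A.faces) : ∃ p ∈ A.free, Ω = A.face p := by
  classical
  simp only [faces, Finset.mem_image, Finset.mem_univ, true_and] at h
  obtain ⟨c, rfl⟩ := h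
  exact A.exists_upF_eq _ (A.base_nonneg (A.dom_nonempty c).choose_spec)

section Fintype

variable [Fintype ι]

lemma face_mem_faces {p : ℝ × ℝ} (hp : p ∈ A.free) : A.face p ∈ A.faces := by
  classical
  obtain ⟨c, hc⟩ := A.exists_upCell_eq hp
  simp only [faces, Finset.mem_image, Finset.mem_univ, true_and]
  exact ⟨c, hc⟩

omit [Fintype ι] in
lemma upE_mem_faces (e : E) : A.upE e ∈ A.faces := by
  classical
  exact Finset.mem_image_of_mem _ (Finset.mem_univ _)

lemma dnE_mem_faces (e : E) : A.dnE e ∈ A.faces := by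
  obtain ⟨p, hp, h⟩ := A.exists_dnF_eq (A.dom_nonempty (Sum.inl e)).choose
    (A.height_pos (A.dom_nonempty (Sum.inl e)).choose_spec)
  rw [dnE, h]
  exact A.face_mem_faces hp

lemma upV_mem_faces (v : Vert n ι) : A.upV v ∈ A.faces := by
  obtain ⟨p, hp, h⟩ := A.exists_upF_eq (A.x v) (A.y_nonneg v)
  rw [upV, h]
  exact A.face_mem_faces hp

open Classical in
/-- The cells below the face `Ω`. -/
noncomputable def cellsBelow (Ω : Set (ℝ × ℝ)) : Finset (E ⊕ Fin (n + 1)) := {c | A.upCell c = Ω}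

open Classical in
/-- The vertices from which the direction upwards leads into the face `Ω`. -/
noncomputable def vertsBelow (Ω : Set (ℝ × ℝ)) : Finset (Vert n ι) := {v | A.upV v = Ω}

open Classical in
/-- A connected graph has at most one more vertices than edges: here the graph whose vertices are
the cells below a face, and whose edges are the vertices of the drawing below the face, each
linking the cells on its two sides. -/
lemma card_cellsBelow_le {p : ℝ × ℝ} :
    (A.cellsBelow (A.face p)).card ≤ (A.vertsBelow (A.face p)).card + 1 := by
  set C := A.cellsBelow (A.face p)
  set W := A.vertsBelow (A.face p)
  let ext (φ : C → ZMod 2) (c : E ⊕ Fin (n + 1)) : ZMod 2 := if h : c ∈ C then φ ⟨c, h⟩ else 0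
  let d : (C → ZMod 2) →ₗ[ZMod 2] (W → ZMod 2) :=
    { toFun := fun φ v => ext φ (A.sideCell true v) - ext φ (A.sideCell false v)
      map_add' := fun φ ψ => by
        funext v
        simp only [ext, Pi.add_apply]
        split_ifs <;> ring
      map_smul' := fun k φ => by
        funext v
        simp only [ext, Pi.smul_apply, smul_eq_mul, RingHom.id_apply]
        split_ifs <;> ring }
  -- the kernel of the coboundary map `d` of this graph consists of the constant functions
  have hker : LinearMap.ker d ≤ Submodule.span (ZMod 2) {fun _ => 1} := by
    intro φ hφ
    have hφ' : ∀ v, A.upV v = A.face p → ext φ (A.sideCell true v) = ext φ (A.sideCell false v) :=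
      fun v hv => by
        have := congrFun (LinearMap.mem_ker.1 hφ) ⟨v, by simp [W, vertsBelow, hv]⟩
        exact sub_eq_zero.1 this
    have key : ∀ c c' : C, φ c = φ c' := fun c c' => by
      have h := A.eq_of_upCell_eq (ext φ) hφ' (c := c) (c' := c')
        (Finset.mem_filter.1 c.2).2 (Finset.mem_filter.1 c'.2).2
      simpa [ext] using h
    rw [Submodule.mem_span_singleton]
    rcases isEmpty_or_nonempty C with hC | ⟨⟨c⟩⟩
    · exact ⟨0, Subsingleton.elim _ _⟩
    · exact ⟨φ c, funext fun c' => by simp [key c' c]⟩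
  have h1 : Module.finrank (ZMod 2) (LinearMap.ker d) ≤ 1 :=
    (Submodule.finrank_mono hker).trans ((finrank_span_le_card _).trans (by simp))
  have h2 := d.finrank_range_add_finrank_ker
  have h3 := (LinearMap.range d).finrank_le
  simp only [Module.finrank_fintype_fun_eq_card, Fintype.card_coe] at h2 h3
  omega

open Classical in
/-- The map that sends a function of the faces to its jumps across the edges. -/
noncomputable def jumpMap : (A.faces → ZMod 2) →ₗ[ZMod 2] (E → ZMod 2) where
  toFun f e := f ⟨A.upE e, A.upE_mem_faces e⟩ - f ⟨A.dnE e, A.dnE_mem_faces e⟩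
  map_add' f g := by funext e; simp only [Pi.add_apply]; ring
  map_smul' k f := by
    funext e; simp only [Pi.smul_apply, smul_eq_mul, RingHom.id_apply]; ring

open Classical in
/-- The extension by zero of a function of the faces. -/
noncomputable def extFaces (f : A.faces → ZMod 2) (Ω : Set (ℝ × ℝ)) : ZMod 2 :=
  if h : Ω ∈ A.faces then f ⟨Ω, h⟩ else 0

lemma jump_extFaces (f : A.faces → ZMod 2) (e : E) : A.jump (A.extFaces f) e = A.jumpMap f e := by
  simp [jump, extFaces, jumpMap, A.upE_mem_faces, A.dnE_mem_faces]

lemma finrank_ker_jumpMap_le : Module.finrank (ZMod 2) (LinearMap.ker A.jumpMap) ≤ 1 := by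
  have hker : LinearMap.ker A.jumpMap ≤ Submodule.span (ZMod 2) {fun _ => 1} := by
    intro f hf
    rw [Submodule.mem_span_singleton]
    refine ⟨A.extFaces f A.top, funext fun Ω => ?_⟩
    obtain ⟨p, hp, h⟩ := A.exists_of_mem_faces Ω.2
    have h1 := A.eq_top_of_jump_eq_zero (A.extFaces f) (fun e => by
      rw [jump_extFaces, LinearMap.mem_ker.1 hf, Pi.zero_apply]) hp
    rw [← h] at h1
    rw [Pi.smul_apply, smul_eq_mul, mul_one, ← h1]
    simp [extFaces]
  exact (Submodule.finrank_mono hker).trans ((finrank_span_le_card _).trans (by simp))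

open Classical in
/-- The indicator function of a vertex on the set of internal vertices. -/
noncomputable def vertInd (v : Vert n ι) (a : ι) : ZMod 2 := if v = Sum.inr a then 1 else 0

/-- The boundary map modulo 2, from functions of the edges to functions of the internal vertices:
the value at a vertex is the sum over the edges at the vertex. -/
noncomputable def bdryMap : (E → ZMod 2) →ₗ[ZMod 2] (ι → ZMod 2) :=
  Fintype.linearCombination (ZMod 2) fun e => vertInd (A.lv e) + vertInd (A.rv e)

omit [Fintype ι] in
open Classical in
lemma bdryMap_apply (x : E → ZMod 2) (a : ι) : A.bdryMap x a =
    ∑ e with A.lv e = Sum.inr a, x e + ∑ e with A.rv e = Sum.inr a, x e := by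
  simp only [bdryMap, Fintype.linearCombination_apply, Finset.sum_apply, Pi.smul_apply,
    Pi.add_apply, smul_eq_mul, mul_add, Finset.sum_add_distrib, vertInd, mul_ite, mul_one,
    mul_zero, Finset.sum_filter]

/-- The jumps at an internal vertex cancel: in a full turn around it a function of the faces
returns to its value. -/
lemma range_jumpMap_le : LinearMap.range A.jumpMap ≤ LinearMap.ker A.bdryMap := by
  classical
  rintro _ ⟨f, rfl⟩
  rw [LinearMap.mem_ker]
  funext a
  simp only [bdryMap_apply, ← jump_extFaces]
  have h1 := A.upV_sub_dnV (A.extFaces f) a true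
  have h2 := A.upV_sub_dnV (A.extFaces f) a false
  simp only [endp, if_true, Bool.false_eq_true, if_false] at h1 h2
  rw [← h1, ← h2]
  exact CharTwo.add_self_eq_zero _

/-- Two vertices are joined by an edge. -/
def Joined (u v : Vert n ι) : Prop :=
  ∃ e, (A.lv e = u ∧ A.rv e = v) ∨ (A.lv e = v ∧ A.rv e = u)

omit [Fintype ι] in
lemma vertInd_add_mem_range {u v : Vert n ι} (h : A.Joined u v) :
    vertInd u + vertInd v ∈ LinearMap.range A.bdryMap := by
  classical
  obtain ⟨e, ⟨rfl, rfl⟩ | ⟨rfl, rfl⟩⟩ := h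
  · exact ⟨Pi.single e 1, by rw [bdryMap, Fintype.linearCombination_apply_single, one_smul]⟩
  · exact ⟨Pi.single e 1, by
      rw [bdryMap, Fintype.linearCombination_apply_single, one_smul, add_comm]⟩

/-- If every vertex is connected to the boundary, every vertex is a relative boundary. -/
lemma bdryMap_surjective
    (hconn : ∀ a : ι, ∃ j : Fin n, Relation.ReflTransGen A.Joined (Sum.inr a) (Sum.inl j)) :
    LinearMap.range A.bdryMap = ⊤ := by
  classical
  have key : ∀ u v, Relation.ReflTransGen A.Joined u v →
      vertInd v ∈ LinearMap.range A.bdryMap → vertInd u ∈ LinearMap.range A.bdryMap := by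
    intro u v h hv
    induction h using Relation.ReflTransGen.head_induction_on with
    | refl => exact hv
    | head h _ ih =>
      have := Submodule.sub_mem _ (A.vertInd_add_mem_range h) ih
      rwa [add_sub_cancel_right] at this
  rw [eq_top_iff]
  intro y _
  have hy : y = ∑ a, y a • (vertInd (Sum.inr a : Vert n ι) : ι → ZMod 2) := by
    funext b
    simp [vertInd, Finset.sum_apply]
  rw [hy]
  refine Submodule.sum_mem _ fun a _ => Submodule.smul_mem _ _ ?_
  obtain ⟨j, hj⟩ := hconn a
  refine key _ _ hj ?_
  have : (vertInd (Sum.inl j : Vert n ι) : ι → ZMod 2) = 0 := by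
    funext b; simp [vertInd]
  rw [this]
  exact Submodule.zero_mem _

/-- Two forms of Euler's formula. The lower bound for the number of faces comes from
`card_cellsBelow_le`, the upper one from `finrank_ker_jumpMap_le`; as they agree, the inequalities
used are equalities. -/
lemma euler
    (hconn : ∀ a : ι, ∃ j : Fin n, Relation.ReflTransGen A.Joined (Sum.inr a) (Sum.inl j)) :
    (∀ Ω ∈ A.faces, (A.cellsBelow Ω).card = (A.vertsBelow Ω).card + 1) ∧
      LinearMap.range A.jumpMap = LinearMap.ker A.bdryMap := by
  classical
  have h1 : ∑ Ω ∈ A.faces, (A.cellsBelow Ω).card = Fintype.card E + (n + 1) := by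
    have := Finset.card_eq_sum_card_fiberwise (s := Finset.univ) (t := A.faces) (f := A.upCell)
      fun c _ => Finset.mem_coe.2 (Finset.mem_image_of_mem _ (Finset.mem_univ c))
    rw [Finset.card_univ, Fintype.card_sum, Fintype.card_fin] at this
    exact this.symm
  have h2 : ∑ Ω ∈ A.faces, (A.vertsBelow Ω).card = n + Fintype.card ι := by
    have := Finset.card_eq_sum_card_fiberwise (s := Finset.univ) (t := A.faces) (f := A.upV)
      fun v _ => Finset.mem_coe.2 (A.upV_mem_faces v)
    rw [Finset.card_univ, Fintype.card_sum, Fintype.card_fin] at this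
    exact this.symm
  have hle : ∀ Ω ∈ A.faces, (A.cellsBelow Ω).card ≤ (A.vertsBelow Ω).card + 1 := fun Ω hΩ => by
    obtain ⟨p, -, rfl⟩ := A.exists_of_mem_faces hΩ
    exact A.card_cellsBelow_le
  have h3 := Finset.sum_le_sum hle
  have h4 := A.jumpMap.finrank_range_add_finrank_ker
  have h5 := A.finrank_ker_jumpMap_le
  have h6 := A.bdryMap.finrank_range_add_finrank_ker
  have h7 := Submodule.finrank_mono A.range_jumpMap_le
  rw [A.bdryMap_surjective hconn, finrank_top] at h6
  simp only [Module.finrank_fintype_fun_eq_card, Fintype.card_coe] at h4 h6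
  rw [Finset.sum_add_distrib, Finset.sum_const, smul_eq_mul, mul_one, h1, h2] at h3
  refine ⟨(Finset.sum_eq_sum_iff_of_le hle).1 ?_,
    Submodule.eq_of_le_of_finrank_eq A.range_jumpMap_le (by omega)⟩
  rw [Finset.sum_add_distrib, Finset.sum_const, smul_eq_mul, mul_one, h1, h2]
  omega

/-- Every cycle relative to the boundary vertices separates faces: it is the set of edges across
which some function of the faces jumps. -/
lemma exists_jump_eq
    (hconn : ∀ a : ι, ∃ j : Fin n, Relation.ReflTransGen A.Joined (Sum.inr a) (Sum.inl j))
    {x : E → ZMod 2} (hx : A.bdryMap x = 0) :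
    ∃ f : Set (ℝ × ℝ) → ZMod 2, ∀ e, A.jump f e = x e := by
  have : x ∈ LinearMap.range A.jumpMap := by
    rw [(A.euler hconn).2]; exact hx
  obtain ⟨f, rfl⟩ := this
  exact ⟨A.extFaces f, A.jump_extFaces f⟩

end Fintype

end Arrangement

/-! ### The drawing of a graph in gauge ray coordinates -/

namespace DrawnDigraph

/-- The abscissa of a point in the coordinates in which the direction `l` is vertical. -/
noncomputable def absc (l p : ℝ × ℝ) : ℝ := p.1 - l.1 / l.2 * p.2

/-- The linear coordinate change that makes the direction `l` vertical. -/
noncomputable def shear (l : ℝ × ℝ) : (ℝ × ℝ) ≃ₜ (ℝ × ℝ) where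
  toFun p := (absc l p, p.2)
  invFun p := (p.1 + l.1 / l.2 * p.2, p.2)
  left_inv p := by ext <;> simp [absc]
  right_inv p := by ext <;> simp [absc]
  continuous_toFun := by unfold absc; fun_prop
  continuous_invFun := by fun_prop

lemma shear_apply (l p : ℝ × ℝ) : shear l p = (absc l p, p.2) := rfl

lemma mem_segment_iff_absc {l P Q q : ℝ × ℝ} (h : absc l P < absc l Q) :
    q ∈ segment ℝ P Q ↔ absc l P ≤ absc l q ∧ absc l q ≤ absc l Q ∧
      q.2 = P.2 + (absc l q - absc l P) * ((Q.2 - P.2) / (absc l Q - absc l P)) := by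
  have hd : 0 < absc l Q - absc l P := sub_pos.2 h
  have hne := hd.ne'
  constructor
  · rintro ⟨a, b, ha, hb, hab, rfl⟩
    obtain rfl : a = 1 - b := by linarith
    have e1 : absc l ((1 - b) • P + b • Q) = absc l P + b * (absc l Q - absc l P) := by
      simp only [absc, Prod.fst_add, Prod.smul_fst, smul_eq_mul, Prod.snd_add, Prod.smul_snd]
      ring
    rw [e1]
    refine ⟨?_, ?_, ?_⟩
    · nlinarith
    · nlinarith
    · rw [add_sub_cancel_left, mul_assoc, mul_div_cancel₀ _ hne]
      simp only [smul_eq_mul, Prod.snd_add, Prod.smul_snd]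
      ring
  · rintro ⟨h1, h2, h3⟩
    set b := (absc l q - absc l P) / (absc l Q - absc l P)
    have hb : b * (absc l Q - absc l P) = absc l q - absc l P := div_mul_cancel₀ _ hne
    have h4 : q.2 = P.2 + b * (Q.2 - P.2) := by rw [h3]; simp only [b]; ring
    refine ⟨1 - b, b, ?_, ?_, by ring, ?_⟩
    · rw [sub_nonneg, div_le_one hd]; linarith
    · exact div_nonneg (by linarith) hd.le
    · ext
      · simp only [Prod.fst_add, Prod.smul_fst, smul_eq_mul]
        simp only [absc] at hb
        rw [h4] at hb
        linear_combination hb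
      · simp only [Prod.snd_add, Prod.smul_snd, smul_eq_mul]
        rw [h4]; ring

variable {n : ℕ} {ι : Type*} {G : DrawnDigraph n ι}

section Degrees

variable [Finite ι]

lemma inDeg_pos {u v : Vert n ι} (h : G.Adj u v) : 0 < G.inDeg v :=
  (ncard_pos (toFinite _)).2 ⟨u, h⟩

lemma outDeg_pos {u v : Vert n ι} (h : G.Adj u v) : 0 < G.outDeg u :=
  (ncard_pos (toFinite _)).2 ⟨v, h⟩

lemma eq_of_inDeg_le_one {u u' v : Vert n ι} (hd : G.inDeg v ≤ 1) (h : G.Adj u v)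
    (h' : G.Adj u' v) : u = u' := (ncard_le_one (toFinite _)).1 hd u h u' h'

lemma eq_of_outDeg_le_one {u v v' : Vert n ι} (hd : G.outDeg u ≤ 1) (h : G.Adj u v)
    (h' : G.Adj u v') : v = v' := (ncard_le_one (toFinite _)).1 hd v h v' h'

lemma IsPBDTP.not_adj_inl_inl (hG : G.IsPBDTP) (i j : Fin n) :
    ¬ G.Adj (Sum.inl i) (Sum.inl j) := by
  intro h
  obtain ⟨a, ha | ha, -, -⟩ := hG.boundary_nbr i
  · have h1 := hG.boundary_deg i
    have := eq_of_outDeg_le_one (by unfold deg at h1; omega) h ha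
    simp at this
  · have h1 := hG.boundary_deg i
    have h2 := inDeg_pos ha
    have h3 := outDeg_pos h
    unfold deg at h1
    omega

omit [Finite ι] in
lemma IsPBDTP.absc_inl_ne (hG : G.IsPBDTP) {l : ℝ × ℝ} (hl : G.IsGaugeRay l) (j : Fin n) (a : ι) :
    absc l (G.pos (Sum.inl j)) ≠ absc l (G.pos (Sum.inr a)) := by
  have hl2 := hl.inward
  intro heq
  simp only [absc, hG.planar.boundary_line j] at heq
  refine hl.avoids j a ((G.pos (Sum.inr a)).2 / l.2)
    (div_nonneg (hG.planar.interior a).le hl2.le) (Prod.ext ?_ ?_)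
  · simp only [Prod.fst_add, Prod.smul_fst, smul_eq_mul]
    have : (G.pos (Sum.inr a)).2 / l.2 * l.1 = l.1 / l.2 * (G.pos (Sum.inr a)).2 := by ring
    linarith
  · simp only [Prod.snd_add, Prod.smul_snd, smul_eq_mul, hG.planar.boundary_line j]
    field_simp
    ring

lemma IsPBDTP.absc_ne (hG : G.IsPBDTP) {l : ℝ × ℝ} (hl : G.IsGaugeRay l) {u v : Vert n ι}
    (h : G.Adj u v) : absc l (G.pos u) ≠ absc l (G.pos v) := by
  have hl2 := hl.inward
  rcases u with i | a <;> rcases v with j | b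
  · exact absurd h (hG.not_adj_inl_inl i j)
  · exact hG.absc_inl_ne hl i b
  · exact (hG.absc_inl_ne hl j a).symm
  · intro heq
    apply hl.not_parallel a b h
    simp only [absc] at heq
    rw [orientSign, sign_eq_zero_iff, vec, Prod.fst_sub, Prod.snd_sub]
    have h1 : (G.pos (Sum.inr b)).1 - (G.pos (Sum.inr a)).1 =
      l.1 / l.2 * ((G.pos (Sum.inr b)).2 - (G.pos (Sum.inr a)).2) := by linarith
    rw [h1]
    field_simp
    ring

end Degrees

/-- The edges of a drawn digraph. -/
abbrev Edge (G : DrawnDigraph n ι) := {e : Vert n ι × Vert n ι // G.Adj e.1 e.2}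

open Classical in
/-- The left end point of an edge, with respect to a gauge ray direction. -/
noncomputable def leftEnd (l : ℝ × ℝ) (e : G.Edge) : Vert n ι :=
  if absc l (G.pos e.1.1) < absc l (G.pos e.1.2) then e.1.1 else e.1.2

open Classical in
/-- The right end point of an edge, with respect to a gauge ray direction. -/
noncomputable def rightEnd (l : ℝ × ℝ) (e : G.Edge) : Vert n ι :=
  if absc l (G.pos e.1.1) < absc l (G.pos e.1.2) then e.1.2 else e.1.1

lemma leftEnd_rightEnd (l : ℝ × ℝ) (e : G.Edge) :
    (leftEnd l e = e.1.1 ∧ rightEnd l e = e.1.2) ∨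
      (leftEnd l e = e.1.2 ∧ rightEnd l e = e.1.1) := by
  unfold leftEnd rightEnd
  split_ifs <;> simp

lemma seg_eq (l : ℝ × ℝ) (e : G.Edge) :
    G.seg e.1.1 e.1.2 = segment ℝ (G.pos (leftEnd l e)) (G.pos (rightEnd l e)) := by
  rcases leftEnd_rightEnd l e with ⟨h1, h2⟩ | ⟨h1, h2⟩ <;> rw [h1, h2, seg]
  exact segment_symm _ _ _

lemma leftEnd_lt_rightEnd [Finite ι] (hG : G.IsPBDTP) {l : ℝ × ℝ} (hl : G.IsGaugeRay l)
    (e : G.Edge) : absc l (G.pos (leftEnd l e)) < absc l (G.pos (rightEnd l e)) := by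
  unfold leftEnd rightEnd
  split_ifs with h
  · exact h
  · exact lt_of_le_of_ne (not_lt.1 h) (hG.absc_ne hl e.2).symm

/-- The drawing of a graph in the coordinates in which a gauge ray direction is vertical. -/
noncomputable def arr [Finite ι] (hG : G.IsPBDTP) {l : ℝ × ℝ} (hl : G.IsGaugeRay l) :
    Arrangement n ι G.Edge where
  x v := absc l (G.pos v)
  y v := (G.pos v).2
  lv := leftEnd l
  rv := rightEnd l
  slope e := ((G.pos (rightEnd l e)).2 - (G.pos (leftEnd l e)).2) /
    (absc l (G.pos (rightEnd l e)) - absc l (G.pos (leftEnd l e)))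
  lv_lt_rv := leftEnd_lt_rightEnd hG hl
  y_rv e := by
    rw [mul_div_cancel₀ _ (sub_pos.2 (leftEnd_lt_rightEnd hG hl e)).ne']; ring
  y_inl := hG.planar.boundary_line
  y_inr := hG.planar.interior
  anti := by
    have := hG.planar.clockwise
    simp only [absc, hG.planar.boundary_line, mul_zero, sub_zero]
    exact this
  x_inl_ne := hG.absc_inl_ne hl
  edge_inner e := by
    have key : ∀ u v, G.Adj u v → 0 < (G.pos u).2 ∨ 0 < (G.pos v).2 := by
      rintro (i | a) (j | b) h
      · exact absurd h (hG.not_adj_inl_inl i j)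
      · exact Or.inr (hG.planar.interior b)
      · exact Or.inl (hG.planar.interior a)
      · exact Or.inl (hG.planar.interior a)
    rcases leftEnd_rightEnd l e with ⟨h1, h2⟩ | ⟨h1, h2⟩ <;> rw [h1, h2]
    · exact key _ _ e.2
    · exact (key _ _ e.2).symm
  vertex_on_edge e w h1 h2 h3 := by
    have h : G.pos w ∈ G.seg e.1.1 e.1.2 := by
      rw [seg_eq l, mem_segment_iff_absc (leftEnd_lt_rightEnd hG hl e)]
      exact ⟨h1, h2, h3⟩
    have := hG.planar.vertex_on_edge _ _ w e.2 h
    rcases leftEnd_rightEnd l e with ⟨h1, h2⟩ | ⟨h1, h2⟩ <;> rw [h1, h2]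
    · exact this
    · exact this.symm
  inter e e' t h1 h2 h3 h4 h5 := by
    by_contra hne
    set q := (shear l).symm (t, (G.pos (leftEnd l e)).2 + (t - absc l (G.pos (leftEnd l e))) *
      (((G.pos (rightEnd l e)).2 - (G.pos (leftEnd l e)).2) /
        (absc l (G.pos (rightEnd l e)) - absc l (G.pos (leftEnd l e))))) with hq
    have hsq : (absc l q, q.2) = _ := (shear l).apply_symm_apply _
    rw [Prod.ext_iff] at hsq
    simp only at hsq
    have m1 : q ∈ G.seg e.1.1 e.1.2 := by
      rw [seg_eq l, mem_segment_iff_absc (leftEnd_lt_rightEnd hG hl e), hsq.1, hsq.2]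
      exact ⟨h1.le, h2.le, rfl⟩
    have m2 : q ∈ G.seg e'.1.1 e'.1.2 := by
      rw [seg_eq l, mem_segment_iff_absc (leftEnd_lt_rightEnd hG hl e'), hsq.1, hsq.2]
      exact ⟨h3, h4, h5⟩
    have := (hG.planar.edges_cross _ _ _ _ e.2 e'.2 (fun h => hne (Subtype.ext h)) ⟨m1, m2⟩).1
    have hx : absc l q = absc l (G.pos (leftEnd l e)) ∨
        absc l q = absc l (G.pos (rightEnd l e)) := by
      rcases this with h | h <;> rw [h] <;>
        rcases leftEnd_rightEnd l e with ⟨h1, h2⟩ | ⟨h1, h2⟩ <;> rw [h1, h2] <;> simp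
    rcases hx with h | h
    · rw [hsq.1] at h; exact h1.ne' h
    · rw [hsq.1] at h; exact h2.ne h

section Transfer

variable [Finite ι] (hG : G.IsPBDTP) {l : ℝ × ℝ} (hl : G.IsGaugeRay l)

lemma on_arr_iff (e : G.Edge) (q : ℝ × ℝ) :
    (arr hG hl).On e (shear l q) ↔ q ∈ G.seg e.1.1 e.1.2 := by
  rw [seg_eq l, mem_segment_iff_absc (leftEnd_lt_rightEnd hG hl e)]
  rfl

lemma mem_free_arr_iff (q : ℝ × ℝ) : shear l q ∈ (arr hG hl).free ↔ q ∈ G.complement := by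
  simp only [Arrangement.free, mem_ofPred_eq, on_arr_iff, complement, drawing, Set.mem_sdiff,
    Subtype.forall, Prod.forall]
  simp only [shear_apply]
  push Not
  rfl

lemma image_complement : shear l '' G.complement = (arr hG hl).free := by
  ext p
  obtain ⟨q, rfl⟩ := (shear l).surjective p
  rw [mem_free_arr_iff, (shear l).injective.mem_set_image]

lemma IsFace.exists_eq_face {Ω : Set (ℝ × ℝ)} (h : G.IsFace Ω) :
    ∃ p ∈ (arr hG hl).free, shear l '' Ω = (arr hG hl).face p := by
  obtain ⟨q, hq, rfl⟩ := h
  refine ⟨shear l q, (mem_free_arr_iff hG hl q).2 hq, ?_⟩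
  rw [(shear l).image_connectedComponentIn hq, image_complement hG hl]
  rfl

omit [Finite ι] in
lemma mem_frontier_iff_shear (l : ℝ × ℝ) {Ω : Set (ℝ × ℝ)} {q : ℝ × ℝ} :
    q ∈ frontier Ω ↔ shear l q ∈ frontier (shear l '' Ω) := by
  rw [← (shear l).image_frontier, (shear l).injective.mem_set_image]

lemma seg_subset_frontier_iff (e : G.Edge) {Ω : Set (ℝ × ℝ)} :
    G.seg e.1.1 e.1.2 ⊆ frontier Ω ↔ {p | (arr hG hl).On e p} ⊆ frontier (shear l '' Ω) := by
  constructor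
  · intro h p hp
    obtain ⟨q, rfl⟩ := (shear l).surjective p
    exact (mem_frontier_iff_shear l).1 (h ((on_arr_iff hG hl e q).1 hp))
  · intro h q hq
    exact (mem_frontier_iff_shear l).2 (h ((on_arr_iff hG hl e q).2 hq))

lemma reflTransGen_joined (a : ι) : ∃ j : Fin n,
    Relation.ReflTransGen (arr hG hl).Joined (Sum.inr a) (Sum.inl j) := by
  obtain ⟨j, hj⟩ := hG.connected a
  refine ⟨j, Relation.ReflTransGen.mono ?_ _ _ hj⟩
  rintro u v (h | h)
  · exact ⟨⟨(u, v), h⟩, leftEnd_rightEnd l ⟨(u, v), h⟩⟩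
  · exact ⟨⟨(v, u), h⟩, (leftEnd_rightEnd l ⟨(v, u), h⟩).symm⟩

open Classical in
/-- The sum over the edges at a vertex, arranged by geometric position or by orientation. -/
lemma sum_left_add_sum_right [Fintype G.Edge] {M : Type*} [AddCommMonoid M] (F : G.Edge → M)
    (v : Vert n ι) :
    ∑ e with (arr hG hl).lv e = v, F e + ∑ e with (arr hG hl).rv e = v, F e =
      ∑ e : G.Edge with e.1.1 = v, F e + ∑ e : G.Edge with e.1.2 = v, F e := by
  simp only [Finset.sum_filter, ← Finset.sum_add_distrib]
  refine Finset.sum_congr rfl fun e _ => ?_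
  rcases leftEnd_rightEnd l e with ⟨h1, h2⟩ | ⟨h1, h2⟩
  · simp only [arr, h1, h2]
  · simp only [arr, h1, h2]
    rw [add_comm]

end Transfer

end DrawnDigraph

/-! ### Every edge separates two faces -/

section Trim

variable {α : Type*} {r : α → α → Prop} {u v : α}

/-- A path can be stopped when it first reaches its end. -/
lemma Relation.ReflTransGen.trim_end (h : Relation.ReflTransGen r u v) :
    Relation.ReflTransGen (fun a b => r a b ∧ a ≠ v) u v := by
  induction h using Relation.ReflTransGen.head_induction_on with
  | refl => exact .refl
  | @head a b h _ ih =>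
    by_cases ha : a = v
    · subst ha; exact .refl
    · exact .head ⟨h, ha⟩ ih

/-- A path can be started when it last leaves its origin. -/
lemma Relation.ReflTransGen.trim_start (h : Relation.ReflTransGen r u v) :
    Relation.ReflTransGen (fun a b => r a b ∧ b ≠ u) u v := by
  induction h with
  | refl => exact .refl
  | @tail b c _ h ih =>
    by_cases hc : c = u
    · subst hc; exact .refl
    · exact .tail ih ⟨h, hc⟩

end Trim

namespace DrawnDigraph

open Arrangement

variable {n : ℕ} {ι : Type*} {G : DrawnDigraph n ι}

section NoBridges

open Classical

variable [Fintype ι] (hG : G.IsPBDTP) {l : ℝ × ℝ} (hl : G.IsGaugeRay l)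

lemma bdryMap_single (e : G.Edge) :
    (arr hG hl).bdryMap (Pi.single e 1) = vertInd e.1.1 + vertInd e.1.2 := by
  rw [bdryMap, Fintype.linearCombination_apply_single, one_smul]
  rcases leftEnd_rightEnd l e with ⟨h1, h2⟩ | ⟨h1, h2⟩
  · simp only [arr, h1, h2]
  · simp only [arr, h1, h2]
    rw [add_comm]

omit [Fintype ι] in
lemma add_self_zmod (f : ι → ZMod 2) : f + f = 0 := by
  funext a; exact CharTwo.add_self_eq_zero _

/-- The edges of a path, counted with multiplicities modulo 2. -/
lemma exists_chain {R : Vert n ι → Vert n ι → Prop} {u v : Vert n ι}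
    (h : Relation.ReflTransGen (fun a b => G.Adj a b ∧ R a b) u v) :
    ∃ x : G.Edge → ZMod 2, (arr hG hl).bdryMap x = vertInd u + vertInd v ∧
      ∀ e : G.Edge, x e ≠ 0 → R e.1.1 e.1.2 := by
  induction h with
  | refl => exact ⟨0, by rw [map_zero, add_self_zmod], by simp⟩
  | @tail b c _ h ih =>
    obtain ⟨x, hx, hR⟩ := ih
    refine ⟨x + Pi.single ⟨(b, c), h.1⟩ 1, ?_, fun e he => ?_⟩
    · rw [map_add, hx, bdryMap_single]
      have := add_self_zmod (vertInd b : ι → ZMod 2)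
      calc vertInd u + vertInd b + (vertInd b + vertInd c)
          = vertInd u + (vertInd b + vertInd b) + vertInd c := by abel
        _ = _ := by rw [this, add_zero]
    · by_cases heq : e = ⟨(b, c), h.1⟩
      · subst heq; exact h.2
      · exact hR e (by simpa [heq] using he)

omit [Fintype ι] in
lemma vertInd_inl (j : Fin n) : (vertInd (Sum.inl j : Vert n ι) : ι → ZMod 2) = 0 := by
  funext a; simp [vertInd]

/-- An edge between internal vertices belongs to a relative cycle: there is a directed walk from the
boundary to the boundary that runs through this edge exactly once. -/
lemma exists_cycle_of_internal {a c : ι} (h : G.Adj (Sum.inr a) (Sum.inr c)) :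
    ∃ x : G.Edge → ZMod 2, (arr hG hl).bdryMap x = 0 ∧ x ⟨(Sum.inr a, Sum.inr c), h⟩ = 1 := by
  obtain ⟨i, j, -, -, h1, h2⟩ := hG.path a c h
  obtain ⟨x, hx, hxR⟩ := exists_chain hG hl h1.trim_end
  obtain ⟨y, hy, hyR⟩ := exists_chain hG hl h2.trim_start
  refine ⟨x + y + Pi.single ⟨(Sum.inr a, Sum.inr c), h⟩ 1, ?_, ?_⟩
  · rw [map_add, map_add, hx, hy, bdryMap_single, vertInd_inl, vertInd_inl, zero_add, add_zero,
      add_self_zmod]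
  · have hx0 : x ⟨(Sum.inr a, Sum.inr c), h⟩ = 0 := by
      by_contra h0
      exact hxR _ h0 rfl
    have hy0 : y ⟨(Sum.inr a, Sum.inr c), h⟩ = 0 := by
      by_contra h0
      exact hyR _ h0 rfl
    simp [hx0, hy0]

/-- The two edges at an internal vertex with one incoming and one outgoing edge belong to the same
cycles. -/
lemma cycle_apply_eq {a : ι} (hin : G.inDeg (Sum.inr a) = 1) (hout : G.outDeg (Sum.inr a) = 1)
    {e e' : G.Edge} (he : e.1.2 = Sum.inr a) (he' : e'.1.1 = Sum.inr a) {x : G.Edge → ZMod 2}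
    (hx : (arr hG hl).bdryMap x = 0) : x e = x e' := by
  have h := congrFun hx a
  rw [bdryMap_apply, sum_left_add_sum_right, Pi.zero_apply] at h
  have h1 : (Finset.univ.filter fun f : G.Edge => f.1.1 = Sum.inr a) = {e'} := by
    ext f
    simp only [Finset.mem_filter, Finset.mem_univ, true_and, Finset.mem_singleton]
    refine ⟨fun hf => ?_, fun hf => by rw [hf, he']⟩
    have ha := f.2
    have ha' := e'.2
    rw [hf] at ha
    rw [he'] at ha'
    exact Subtype.ext (Prod.ext (by rw [hf, he']) (eq_of_outDeg_le_one hout.le ha ha'))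
  have h2 : (Finset.univ.filter fun f : G.Edge => f.1.2 = Sum.inr a) = {e} := by
    ext f
    simp only [Finset.mem_filter, Finset.mem_univ, true_and, Finset.mem_singleton]
    refine ⟨fun hf => ?_, fun hf => by rw [hf, he]⟩
    have ha := f.2
    have ha' := e.2
    rw [hf] at ha
    rw [he] at ha'
    exact Subtype.ext (Prod.ext (eq_of_inDeg_le_one hin.le ha ha') (by rw [hf, he]))
  rw [h1, h2, Finset.sum_singleton, Finset.sum_singleton] at h
  exact (CharTwo.add_eq_zero.1 h).symm

omit [Fintype ι] in
lemma deg_eq_one_of_boundary_adj [Finite ι] (hG : G.IsPBDTP) {j : Fin n} {a : ι}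
    (h : G.Adj (Sum.inl j) (Sum.inr a) ∨ G.Adj (Sum.inr a) (Sum.inl j)) :
    G.inDeg (Sum.inr a) = 1 ∧ G.outDeg (Sum.inr a) = 1 := by
  obtain ⟨b, hb, -, hd⟩ := hG.boundary_nbr j
  have h1 := hG.boundary_deg j
  unfold deg at h1 hd
  have hab : a = b := by
    rcases h with h | h <;> rcases hb with hb | hb
    · have := eq_of_outDeg_le_one (by omega) h hb
      simpa using this
    · have := outDeg_pos h
      have := inDeg_pos hb
      omega
    · have := inDeg_pos h
      have := outDeg_pos hb
      omega
    · have := eq_of_inDeg_le_one (by omega) h hb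
      simpa using this
  subst hab
  have := hG.perfect a
  omega

/-- Every edge belongs to a relative cycle. -/
lemma exists_cycle (e : G.Edge) :
    ∃ x : G.Edge → ZMod 2, (arr hG hl).bdryMap x = 0 ∧ x e = 1 := by
  -- two boundary edges with a common end point form a cycle by themselves
  have hshort : ∀ (j j' : Fin n) (a : ι) (h : G.Adj (Sum.inl j) (Sum.inr a))
      (h' : G.Adj (Sum.inr a) (Sum.inl j')), ∃ x : G.Edge → ZMod 2,
      (arr hG hl).bdryMap x = 0 ∧ x ⟨(Sum.inl j, Sum.inr a), h⟩ = 1 ∧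
        x ⟨(Sum.inr a, Sum.inl j'), h'⟩ = 1 := by
    intro j j' a h h'
    refine ⟨Pi.single ⟨(Sum.inl j, Sum.inr a), h⟩ 1 + Pi.single ⟨(Sum.inr a, Sum.inl j'), h'⟩ 1,
      ?_, ?_, ?_⟩
    · rw [map_add, bdryMap_single, bdryMap_single, vertInd_inl, vertInd_inl, zero_add, add_zero,
        add_self_zmod]
    · simp
    · simp
  obtain ⟨⟨u, v⟩, h⟩ := e
  rcases u with j | a <;> rcases v with j' | c
  · exact absurd h (hG.not_adj_inl_inl j j')
  · obtain ⟨hin, hout⟩ := deg_eq_one_of_boundary_adj hG (Or.inl h)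
    obtain ⟨w, hw⟩ : {w | G.Adj (Sum.inr c) w}.Nonempty :=
      (ncard_pos (toFinite _)).1 (by rw [outDeg] at hout; omega)
    rcases w with j' | d
    · obtain ⟨x, h1, h2, -⟩ := hshort j j' c h hw
      exact ⟨x, h1, h2⟩
    · obtain ⟨x, h1, h2⟩ := exists_cycle_of_internal hG hl hw
      exact ⟨x, h1, (cycle_apply_eq hG hl hin hout rfl rfl h1).trans h2⟩
  · obtain ⟨hin, hout⟩ := deg_eq_one_of_boundary_adj hG (Or.inr h)
    obtain ⟨w, hw⟩ : {w | G.Adj w (Sum.inr a)}.Nonempty :=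
      (ncard_pos (toFinite _)).1 (by rw [inDeg] at hin; omega)
    rcases w with j | d
    · obtain ⟨x, h1, -, h2⟩ := hshort j j' a hw h
      exact ⟨x, h1, h2⟩
    · obtain ⟨x, h1, h2⟩ := exists_cycle_of_internal hG hl hw
      exact ⟨x, h1, (cycle_apply_eq hG hl hin hout rfl rfl h1).symm.trans h2⟩
  · exact exists_cycle_of_internal hG hl h

/-- There are no bridges: the faces on the two sides of an edge are different. -/
lemma upE_ne_dnE (e : G.Edge) : (arr hG hl).upE e ≠ (arr hG hl).dnE e := by
  obtain ⟨x, hx, hxe⟩ := exists_cycle hG hl e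
  obtain ⟨f, hf⟩ := (arr hG hl).exists_jump_eq (reflTransGen_joined hG hl) hx
  intro heq
  have := hf e
  rw [jump, heq, sub_self, hxe] at this
  exact zero_ne_one this

end NoBridges

end DrawnDigraph

/-! ### Local winding numbers -/

namespace Arrangement

variable {n : ℕ} {ι E : Type*} (A : Arrangement n ι E)

/-- The edges `g` and `e` leave the vertex `v` on the same side, and `e` leaves it above `g`. -/
def Above (v : Vert n ι) (g e : E) : Prop :=
  ∃ b, A.endp b g = v ∧ A.endp b e = v ∧ A.rs b g < A.rs b e

variable {A}

lemma endp_inj {b b' : Bool} {e : E} (h : A.endp b e = A.endp b' e) : b = b' := by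
  have hne : A.lv e ≠ A.rv e := fun h => (A.lv_lt_rv e).ne (congrArg A.x h)
  cases b <;> cases b' <;> simp_all [endp, eq_comm]

lemma exists_endp {v : Vert n ι} {e : E} (h : A.lv e = v ∨ A.rv e = v) : ∃ b, A.endp b e = v :=
  h.elim (fun h => ⟨true, by simpa [endp] using h⟩) fun h => ⟨false, by simpa [endp] using h⟩

lemma above_iff_left {v : Vert n ι} {b : Bool} {g e : E} (hg : A.endp b g = v) :
    A.Above v g e ↔ A.endp b e = v ∧ A.rs b g < A.rs b e := by
  refine ⟨?_, fun h => ⟨b, hg, h⟩⟩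
  rintro ⟨b', h1, h2⟩
  obtain rfl := endp_inj (h1.trans hg.symm)
  exact h2

lemma above_iff_right {v : Vert n ι} {b : Bool} {g e : E} (he : A.endp b e = v) :
    A.Above v g e ↔ A.endp b g = v ∧ A.rs b g < A.rs b e := by
  refine ⟨?_, fun h => ⟨b, h.1, he, h.2⟩⟩
  rintro ⟨b', h1, h2, h3⟩
  obtain rfl := endp_inj (h2.trans he.symm)
  exact ⟨h1, h3⟩

variable (A)

section Sums

variable [Fintype E] {M : Type*} [AddCommGroup M] (f : Set (ℝ × ℝ) → M)

open Classical in
lemma upV_sub_upE_eq_sum_above {v : Vert n ι} {g : E} (hg : A.lv g = v ∨ A.rv g = v) :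
    f (A.upV v) - f (A.upE g) = ∑ e with A.Above v g e, A.jump f e := by
  obtain ⟨b, hb⟩ := exists_endp hg
  rw [A.upV_sub_upE f v b hb]
  exact Finset.sum_congr (Finset.filter_congr fun e _ => (above_iff_left hb).symm) fun _ _ => rfl

open Classical in
lemma dnE_sub_dnV_eq_sum_above {a : ι} {g : E} (hg : A.lv g = Sum.inr a ∨ A.rv g = Sum.inr a) :
    f (A.dnE g) - f (A.dnV (Sum.inr a)) = ∑ e with A.Above (Sum.inr a) e g, A.jump f e := by
  obtain ⟨b, hb⟩ := exists_endp hg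
  rw [A.dnE_sub_dnV f a b hb]
  exact Finset.sum_congr (Finset.filter_congr fun e _ => (above_iff_right hb).symm) fun _ _ => rfl

end Sums

end Arrangement

namespace DrawnDigraph

open Arrangement

lemma localWind_eq {l : ℝ × ℝ} (hl : 0 < l.2) (e f : ℝ × ℝ) :
    (localWind l e f : ZMod 2) =
      if (0 < absc l e ∧ absc l f < 0 ∧ 0 < absc l e * f.2 - e.2 * absc l f) ∨
        (absc l e < 0 ∧ 0 < absc l f ∧ absc l e * f.2 - e.2 * absc l f < 0) then 1 else 0 := by
  have h1 : e.1 * f.2 - e.2 * f.1 = absc l e * f.2 - e.2 * absc l f := by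
    simp only [absc]; ring
  have h2 : e.1 * l.2 - e.2 * l.1 = l.2 * absc l e := by
    simp only [absc]; field_simp
  have h3 : l.1 * f.2 - l.2 * f.1 = -(l.2 * absc l f) := by
    simp only [absc]; field_simp; ring
  simp only [localWind, orientSign, h1, h2, h3, sign_eq_one_iff, sign_eq_neg_one_iff,
    mul_pos_iff_of_pos_left hl, neg_pos, neg_neg_iff_pos,
    show ∀ x, l.2 * x < 0 ↔ x < 0 from fun x => by
      rw [mul_neg_iff]; exact ⟨fun h => h.elim And.right fun h => absurd h.1 hl.not_gt,
        fun h => Or.inl ⟨hl, h⟩⟩]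
  by_cases h4 : 0 < absc l e * f.2 - e.2 * absc l f ∧ 0 < absc l e ∧ absc l f < 0
  · rw [if_pos h4, if_pos (Or.inl ⟨h4.2.1, h4.2.2, h4.1⟩), Int.cast_one]
  rw [if_neg h4]
  by_cases h5 : absc l e * f.2 - e.2 * absc l f < 0 ∧ absc l e < 0 ∧ 0 < absc l f
  · rw [if_pos h5, if_pos (Or.inr ⟨h5.2.1, h5.2.2, h5.1⟩)]
    rfl
  rw [if_neg h5, if_neg, Int.cast_zero]
  rintro (h6 | h6)
  · exact h4 ⟨h6.2.2, h6.1, h6.2.1⟩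
  · exact h5 ⟨h6.2.2, h6.1, h6.2.1⟩

variable {n : ℕ} {ι : Type*} {G : DrawnDigraph n ι}

lemma absc_vec (l : ℝ × ℝ) (u v : Vert n ι) :
    absc l (G.vec u v) = absc l (G.pos v) - absc l (G.pos u) := by
  simp only [absc, vec, Prod.fst_sub, Prod.snd_sub]; ring

section Wind

variable [Finite ι] (hG : G.IsPBDTP) {l : ℝ × ℝ} (hl : G.IsGaugeRay l)

lemma slope_arr (e : G.Edge) : (arr hG hl).slope e =
    (G.vec e.1.1 e.1.2).2 / absc l (G.vec e.1.1 e.1.2) := by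
  rw [absc_vec]
  rcases leftEnd_rightEnd l e with ⟨h1, h2⟩ | ⟨h1, h2⟩ <;> simp only [arr, h1, h2, vec, Prod.snd_sub]
  rw [← neg_sub, ← neg_sub (absc l (G.pos e.1.2)), neg_div_neg_eq]

/-- The head of an edge is its left end point if and only if the edge is directed to the left. -/
lemma endp_eq_head_iff (b : Bool) (e : G.Edge) :
    (arr hG hl).endp b e = e.1.2 ↔ sg b * absc l (G.vec e.1.1 e.1.2) < 0 := by
  have hne : e.1.1 ≠ e.1.2 := fun h => hG.absc_ne hl e.2 (by rw [h])
  have hne' := hG.absc_ne hl e.2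
  rw [absc_vec]
  cases b <;> simp only [endp, arr, leftEnd, rightEnd, sg, Bool.false_eq_true, if_false, if_true]
  · split_ifs with h
    · simpa using h
    · simpa [hne] using h
  · split_ifs with h
    · simpa [hne] using h.le
    · simpa using lt_of_le_of_ne (not_lt.1 h) hne'.symm

lemma endp_eq_tail_iff (b : Bool) (e : G.Edge) :
    (arr hG hl).endp b e = e.1.1 ↔ 0 < sg b * absc l (G.vec e.1.1 e.1.2) := by
  have hne : e.1.1 ≠ e.1.2 := fun h => hG.absc_ne hl e.2 (by rw [h])
  have hne' := hG.absc_ne hl e.2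
  rw [absc_vec]
  cases b <;> simp only [endp, arr, leftEnd, rightEnd, sg, Bool.false_eq_true, if_false, if_true]
  · split_ifs with h
    · simpa [hne.symm] using h.le
    · simpa using lt_of_le_of_ne (not_lt.1 h) hne'.symm
  · split_ifs with h
    · simpa using h
    · simpa [hne.symm] using h

open Classical in
/-- Modulo 2, the local winding number at a vertex tells whether the outgoing edge leaves the vertex
above the incoming one, on the same side. -/
lemma localWind_eq_above {u v w : Vert n ι} (h : G.Adj u v) (h' : G.Adj v w) :
    (localWind l (G.vec u v) (G.vec v w) : ZMod 2) =
      if (arr hG hl).Above v ⟨(u, v), h⟩ ⟨(v, w), h'⟩ then 1 else 0 := by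
  rw [localWind_eq hl.inward]
  refine if_congr ?_ rfl rfl
  have hs := slope_arr hG hl ⟨(u, v), h⟩
  have hs' := slope_arr hG hl ⟨(v, w), h'⟩
  have e1 := fun b => endp_eq_head_iff hG hl b ⟨(u, v), h⟩
  have e2 := fun b => endp_eq_tail_iff hG hl b ⟨(v, w), h'⟩
  simp only at hs hs' e1 e2
  simp only [Above, e1, e2, Bool.exists_bool, rs, sg, Bool.false_eq_true, if_false, if_true,
    neg_mul, one_mul, neg_pos, neg_lt_neg_iff, neg_neg_iff_pos]
  set p := absc l (G.vec u v)
  set q := absc l (G.vec v w)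
  set s := (arr hG hl).slope ⟨(u, v), h⟩
  set s' := (arr hG hl).slope ⟨(v, w), h'⟩
  have key : ∀ (_ : p ≠ 0) (_ : q ≠ 0), p * (G.vec v w).2 - (G.vec u v).2 * q =
      (p * q) * (s' - s) := fun hp hq => by
    have h1 : (G.vec u v).2 = s * p := by rw [hs, div_mul_cancel₀ _ hp]
    have h2 : (G.vec v w).2 = s' * q := by rw [hs', div_mul_cancel₀ _ hq]
    rw [h1, h2]; ring
  refine or_congr (and_congr_right fun hp => and_congr_right fun hq => ?_)
    (and_congr_right fun hp => and_congr_right fun hq => ?_)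
  · have hpq := mul_neg_of_pos_of_neg hp hq
    rw [key hp.ne' hq.ne, ← smul_eq_mul, smul_pos_iff_of_neg_left hpq, sub_neg]
  · have hpq := mul_neg_of_neg_of_pos hp hq
    rw [key hp.ne hq.ne', ← smul_eq_mul, smul_neg_iff_of_neg_left hpq, sub_pos]

end Wind

end DrawnDigraph

/-! ### Corners of a face -/

namespace DrawnDigraph

open Arrangement

open Classical in
/-- The indicator function of the face `Φ` on the set of faces. -/
noncomputable def indic (Φ S : Set (ℝ × ℝ)) : ℤ := if S = Φ then 1 else 0

variable {n : ℕ} {ι : Type*} {G : DrawnDigraph n ι}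

section Corners

open Classical

variable [Fintype ι] (hG : G.IsPBDTP) {l : ℝ × ℝ} (hl : G.IsGaugeRay l)

/-- The number of sides, one or none, on which the edge `e` borders on the face `Φ`. -/
noncomputable def border (Φ : Set (ℝ × ℝ)) (e : G.Edge) : ℤ :=
  indic Φ ((arr hG hl).upE e) + indic Φ ((arr hG hl).dnE e)

lemma border_eq (Φ : Set (ℝ × ℝ)) (e : G.Edge) : border hG hl Φ e =
    if (arr hG hl).upE e = Φ ∨ (arr hG hl).dnE e = Φ then 1 else 0 := by
  have h := upE_ne_dnE hG hl e
  unfold border indic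
  by_cases h1 : (arr hG hl).upE e = Φ <;> by_cases h2 : (arr hG hl).dnE e = Φ
  · exact absurd (h1.trans h2.symm) h
  all_goals simp [h1, h2]

lemma border_nonneg (Φ : Set (ℝ × ℝ)) (e : G.Edge) : 0 ≤ border hG hl Φ e := by
  rw [border_eq]; split_ifs <;> simp

lemma border_le_one (Φ : Set (ℝ × ℝ)) (e : G.Edge) : border hG hl Φ e ≤ 1 := by
  rw [border_eq]; split_ifs <;> simp

omit [Fintype ι] in
lemma sum_edges_at [Finite ι] [Fintype G.Edge] (F : G.Edge → ℤ) (v : Vert n ι) :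
    ∑ b, ∑ e with (arr hG hl).endp b e = v, F e =
      ∑ e : G.Edge with e.1.1 = v, F e + ∑ e : G.Edge with e.1.2 = v, F e := by
  rw [← sum_left_add_sum_right hG hl F v, Fintype.sum_bool]
  simp only [endp, if_true, Bool.false_eq_true, if_false]

omit [Fintype ι] in
lemma lv_or_rv_iff [Finite ι] (e : G.Edge) (v : Vert n ι) :
    ((arr hG hl).lv e = v ∨ (arr hG hl).rv e = v) ↔ e.1.1 = v ∨ e.1.2 = v := by
  rcases leftEnd_rightEnd l e with ⟨h1, h2⟩ | ⟨h1, h2⟩ <;> simp only [arr, h1, h2]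
  exact or_comm

lemma card_tail_eq (v : Vert n ι) :
    (Finset.univ.filter fun e : G.Edge => e.1.1 = v).card = G.outDeg v := by
  have : {w | G.Adj v w} =
      ((Finset.univ.filter fun e : G.Edge => e.1.1 = v).image fun e => e.1.2 : Finset _) := by
    ext w
    simp only [mem_ofPred_eq, Finset.coe_image, Finset.coe_filter, Finset.mem_univ, true_and,
      Set.mem_image]
    constructor
    · exact fun h => ⟨⟨(v, w), h⟩, rfl, rfl⟩
    · rintro ⟨e, he, rfl⟩
      rw [← he]; exact e.2
  rw [outDeg, this, ncard_coe_finset, Finset.card_image_of_injOn]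
  intro e he e' he' h
  simp only [Finset.coe_filter, Finset.mem_univ, true_and, mem_ofPred_eq] at he he'
  exact Subtype.ext (Prod.ext (he.trans he'.symm) h)

lemma card_head_eq (v : Vert n ι) :
    (Finset.univ.filter fun e : G.Edge => e.1.2 = v).card = G.inDeg v := by
  have : {w | G.Adj w v} =
      ((Finset.univ.filter fun e : G.Edge => e.1.2 = v).image fun e => e.1.1 : Finset _) := by
    ext w
    simp only [mem_ofPred_eq, Finset.coe_image, Finset.coe_filter, Finset.mem_univ, true_and,
      Set.mem_image]
    constructor
    · exact fun h => ⟨⟨(w, v), h⟩, rfl, rfl⟩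
    · rintro ⟨e, he, rfl⟩
      rw [← he]; exact e.2
  rw [inDeg, this, ncard_coe_finset, Finset.card_image_of_injOn]
  intro e he e' he' h
  simp only [Finset.coe_filter, Finset.mem_univ, true_and, mem_ofPred_eq] at he he'
  exact Subtype.ext (Prod.ext h (he.trans he'.symm))

/-- The number of corners of the face `Φ` at the internal vertex `a`, counted by means of the edges
that bound them from below. This counts the corner above `a` twice, once on either side, and does
not count the corner below `a`; the last two terms correct this. -/
noncomputable def corners (Φ : Set (ℝ × ℝ)) (a : ι) : ℤ :=
  ∑ e : G.Edge with e.1.1 = Sum.inr a, indic Φ ((arr hG hl).upE e) +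
    ∑ e : G.Edge with e.1.2 = Sum.inr a, indic Φ ((arr hG hl).upE e) -
    indic Φ ((arr hG hl).upV (Sum.inr a)) + indic Φ ((arr hG hl).dnV (Sum.inr a))

/-- Every corner is bounded by two edges. -/
lemma two_mul_corners (Φ : Set (ℝ × ℝ)) (a : ι) : 2 * corners hG hl Φ a =
    ∑ e : G.Edge with e.1.1 = Sum.inr a, border hG hl Φ e +
      ∑ e : G.Edge with e.1.2 = Sum.inr a, border hG hl Φ e := by
  have h1 := (arr hG hl).upV_sub_dnV (indic Φ) a true
  have h2 := (arr hG hl).upV_sub_dnV (indic Φ) a false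
  have h3 := sum_edges_at hG hl ((arr hG hl).jump (indic Φ)) (Sum.inr a)
  rw [Fintype.sum_bool, ← h1, ← h2] at h3
  simp only [jump, Finset.sum_sub_distrib] at h3
  simp only [corners, border, Finset.sum_add_distrib]
  linarith

lemma mem_frontier_iff_exists_border {p : ℝ × ℝ} {Ω : Set (ℝ × ℝ)}
    (hΩ : shear l '' Ω = (arr hG hl).face p) {v : Vert n ι}
    (hv : ∃ e : G.Edge, e.1.1 = v ∨ e.1.2 = v) :
    G.pos v ∈ frontier Ω ↔
      ∃ e : G.Edge, (e.1.1 = v ∨ e.1.2 = v) ∧ border hG hl (shear l '' Ω) e = 1 := by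
  have hex : ∀ e : G.Edge, (∃ b, (arr hG hl).endp b e = v) ↔ (e.1.1 = v ∨ e.1.2 = v) := fun e => by
    rw [← lv_or_rv_iff hG hl, Bool.exists_bool, or_comm]
    simp only [endp, if_true, Bool.false_eq_true, if_false]
  have hv' : ∃ b e, (arr hG hl).endp b e = v := by
    obtain ⟨e, he⟩ := hv
    obtain ⟨b, hb⟩ := (hex e).2 he
    exact ⟨b, e, hb⟩
  rw [mem_frontier_iff_shear l, hΩ]
  refine ((arr hG hl).vertex_mem_frontier_iff hv').trans ?_
  rw [exists_comm]
  refine exists_congr fun e => ?_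
  rw [exists_and_right, hex, border_eq]
  refine and_congr_right fun _ => ⟨fun h => if_pos h, fun h => ?_⟩
  by_contra hne
  simp [if_neg hne] at h

/-- A face has at most one corner at an internal vertex, as no edge borders on it twice and two
corners would need four edges. -/
lemma corners_eq {p : ℝ × ℝ} {Ω : Set (ℝ × ℝ)} (hΩ : shear l '' Ω = (arr hG hl).face p) (a : ι) :
    corners hG hl (shear l '' Ω) a = if G.pos (Sum.inr a) ∈ frontier Ω then 1 else 0 := by
  set Φ := shear l '' Ω
  have h2 := two_mul_corners hG hl Φ a
  have hd := hG.internal_deg a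
  have hb : ∀ s : Finset G.Edge, ∑ e ∈ s, border hG hl Φ e ≤ s.card := fun s => by
    simpa using Finset.sum_le_card_nsmul s (border hG hl Φ) 1 fun e _ => border_le_one hG hl Φ e
  have h3 := hb (Finset.univ.filter fun e : G.Edge => e.1.1 = Sum.inr a)
  have h4 := hb (Finset.univ.filter fun e : G.Edge => e.1.2 = Sum.inr a)
  have n3 := Finset.sum_nonneg (s := Finset.univ.filter fun e : G.Edge => e.1.1 = Sum.inr a)
    fun e _ => border_nonneg hG hl Φ e
  have n4 := Finset.sum_nonneg (s := Finset.univ.filter fun e : G.Edge => e.1.2 = Sum.inr a)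
    fun e _ => border_nonneg hG hl Φ e
  have hc3 := card_tail_eq (G := G) (Sum.inr a)
  have hc4 := card_head_eq (G := G) (Sum.inr a)
  rw [hc3] at h3
  rw [hc4] at h4
  unfold deg at hd
  have hv : ∃ e : G.Edge, e.1.1 = Sum.inr a ∨ e.1.2 = Sum.inr a := by
    by_contra! hne
    rw [Finset.filter_false_of_mem fun e _ => (hne e).1, Finset.card_empty] at hc3
    rw [Finset.filter_false_of_mem fun e _ => (hne e).2, Finset.card_empty] at hc4
    omega
  have hiff := mem_frontier_iff_exists_border hG hl hΩ hv
  split_ifs with hfr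
  · obtain ⟨e, he, hbe⟩ := hiff.1 hfr
    have : 1 ≤ ∑ e : G.Edge with e.1.1 = Sum.inr a, border hG hl Φ e +
        ∑ e : G.Edge with e.1.2 = Sum.inr a, border hG hl Φ e := by
      rcases he with he | he
      · have := Finset.single_le_sum (f := border hG hl Φ)
          (s := Finset.univ.filter fun e : G.Edge => e.1.1 = Sum.inr a)
          (fun e _ => border_nonneg hG hl Φ e) (Finset.mem_filter.2 ⟨Finset.mem_univ e, he⟩)
        rw [hbe] at this
        linarith
      · have := Finset.single_le_sum (f := border hG hl Φ)
          (s := Finset.univ.filter fun e : G.Edge => e.1.2 = Sum.inr a)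
          (fun e _ => border_nonneg hG hl Φ e) (Finset.mem_filter.2 ⟨Finset.mem_univ e, he⟩)
        rw [hbe] at this
        linarith
    omega
  · have hz : ∀ e : G.Edge, (e.1.1 = Sum.inr a ∨ e.1.2 = Sum.inr a) → border hG hl Φ e = 0 :=
      fun e he => by
        have h1 := border_nonneg hG hl Φ e
        have h2 := border_le_one hG hl Φ e
        have h3 : border hG hl Φ e ≠ 1 := fun h => hfr (hiff.2 ⟨e, he, h⟩)
        omega
    rw [Finset.sum_eq_zero fun e he => hz e (Or.inl (Finset.mem_filter.1 he).2),
      Finset.sum_eq_zero fun e he => hz e (Or.inr (Finset.mem_filter.1 he).2)] at h2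
    omega

end Corners

end DrawnDigraph

/-! ### The signature at internal vertices -/

namespace DrawnDigraph

open Arrangement

variable {n : ℕ} {ι : Type*} {G : DrawnDigraph n ι}

section Local

open Classical

variable [Fintype ι] (hG : G.IsPBDTP) {l : ℝ × ℝ} (hl : G.IsGaugeRay l)

omit [Fintype ι] in
include hG in
lemma inDeg_eq_one_of_white {a : ι} (h : G.white a) : G.inDeg (Sum.inr a) = 1 := by
  have h1 := hG.color a
  have h2 := hG.internal_deg a
  have h3 := hG.perfect a
  unfold deg at h1 h2
  by_contra h4
  have h5 : ¬ G.inDeg (Sum.inr a) + G.outDeg (Sum.inr a) = 3 := fun h5 => h4 ((h1 h5).1 h)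
  omega

omit [Fintype ι] in
include hG in
lemma outDeg_eq_one_of_black {a : ι} (h : ¬ G.white a) : G.outDeg (Sum.inr a) = 1 := by
  have h1 := hG.color a
  have h2 := hG.internal_deg a
  have h3 := hG.perfect a
  unfold deg at h1 h2
  by_contra h4
  have h5 : ¬ (G.inDeg (Sum.inr a) + G.outDeg (Sum.inr a) = 3 ∧ G.inDeg (Sum.inr a) = 1) :=
    fun h5 => h ((h1 h5.1).2 h5.2)
  omega

lemma border_cast_eq_jump (Φ : Set (ℝ × ℝ)) (e : G.Edge) : (border hG hl Φ e : ZMod 2) =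
    (arr hG hl).jump (fun S => (indic Φ S : ZMod 2)) e := by
  rw [jump, border, Int.cast_add, CharTwo.sub_eq_add]

omit [Fintype ι] in
lemma not_above_self [Finite ι] (v : Vert n ι) (e : G.Edge) : ¬ (arr hG hl).Above v e e :=
  fun ⟨_, _, _, h⟩ => lt_irrefl _ h

omit [Fintype ι] in
lemma Above.incident [Finite ι] {v : Vert n ι} {g e : G.Edge} (h : (arr hG hl).Above v g e) :
    (g.1.1 = v ∨ g.1.2 = v) ∧ (e.1.1 = v ∨ e.1.2 = v) := by
  obtain ⟨b, h1, h2, -⟩ := h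
  rw [← lv_or_rv_iff hG hl, ← lv_or_rv_iff hG hl]
  cases b
  · exact ⟨Or.inr (by simpa [endp] using h1), Or.inr (by simpa [endp] using h2)⟩
  · exact ⟨Or.inl (by simpa [endp] using h1), Or.inl (by simpa [endp] using h2)⟩

/-- The contribution of an internal vertex `a` to the signature of a face, modulo 2: it is given by
the balance `d` between the outgoing and the incoming sides of the face at `a`, and by the faces
directly above `a` and above the incoming edges. -/
lemma exists_local_balance {p : ℝ × ℝ} {Ω : Set (ℝ × ℝ)}
    (hΩ : shear l '' Ω = (arr hG hl).face p) (a : ι) : ∃ d : ℤ,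
    2 * d = ∑ e : G.Edge with e.1.1 = Sum.inr a, border hG hl (shear l '' Ω) e -
      ∑ e : G.Edge with e.1.2 = Sum.inr a, border hG hl (shear l '' Ω) e ∧
    ∑ e : G.Edge with e.1.2 = Sum.inr a,
        (border hG hl (shear l '' Ω) e : ZMod 2) * G.headTerm l e.1.1 (Sum.inr a) +
      ∑ e : G.Edge with e.1.1 = Sum.inr a,
        (border hG hl (shear l '' Ω) e : ZMod 2) * G.tailTerm l e.1.2 (Sum.inr a) +
      (if G.white a ∧ G.pos (Sum.inr a) ∈ frontier Ω then 1 else 0) =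
    d + indic (shear l '' Ω) ((arr hG hl).upV (Sum.inr a)) +
      ∑ e : G.Edge with e.1.2 = Sum.inr a,
        (indic (shear l '' Ω) ((arr hG hl).upE e) : ZMod 2) := by
  have hS := corners_eq hG hl hΩ a
  set Φ := shear l '' Ω
  have h2 := two_mul_corners hG hl Φ a
  have htwo : (2 : ZMod 2) = 0 := rfl
  by_cases hw : G.white a
  · have hdeg := inDeg_eq_one_of_white hG hw
    obtain ⟨g, hg⟩ := Finset.card_eq_one.1 ((card_head_eq (G := G) (Sum.inr a)).trans hdeg)
    have hgt : g.1.2 = Sum.inr a := by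
      have : g ∈ Finset.univ.filter fun e : G.Edge => e.1.2 = Sum.inr a := by rw [hg]; simp
      exact (Finset.mem_filter.1 this).2
    have hgadj : G.Adj g.1.1 (Sum.inr a) := hgt ▸ g.2
    refine ⟨corners hG hl Φ a - border hG hl Φ g, ?_, ?_⟩
    · rw [hg, Finset.sum_singleton] at h2 ⊢
      linarith
    have hgeq : (⟨(g.1.1, Sum.inr a), hgadj⟩ : G.Edge) = g := Subtype.ext (Prod.ext rfl hgt.symm)
    -- the winding numbers select the edges above the incoming edge `g`
    have htail : ∑ e : G.Edge with e.1.1 = Sum.inr a,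
        (border hG hl Φ e : ZMod 2) * G.tailTerm l e.1.2 (Sum.inr a) =
        (indic Φ ((arr hG hl).upV (Sum.inr a)) : ZMod 2) - indic Φ ((arr hG hl).upE g) := by
      rw [(arr hG hl).upV_sub_upE_eq_sum_above (fun S => (indic Φ S : ZMod 2))
        ((lv_or_rv_iff hG hl g (Sum.inr a)).2 (Or.inr hgt)), Finset.sum_filter, Finset.sum_filter]
      refine Finset.sum_congr rfl fun e _ => ?_
      rw [← border_cast_eq_jump]
      by_cases he : e.1.1 = Sum.inr a
      · have headj : G.Adj (Sum.inr a) e.1.2 := he ▸ e.2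
        have heeq : (⟨(Sum.inr a, e.1.2), headj⟩ : G.Edge) = e :=
          Subtype.ext (Prod.ext he.symm rfl)
        have hf : (Finset.univ.filter fun w => G.Adj w (Sum.inr a)) = {g.1.1} := by
          ext w
          simp only [Finset.mem_filter, Finset.mem_univ, true_and, Finset.mem_singleton]
          exact ⟨fun h => eq_of_inDeg_le_one hdeg.le h hgadj, fun h => h ▸ hgadj⟩
        rw [if_pos he, tailTerm, if_pos hw, hf, Finset.sum_singleton,
          localWind_eq_above hG hl hgadj headj, hgeq, heeq, mul_ite, mul_one, mul_zero]
      · rw [if_neg he, if_neg]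
        intro h
        rcases (Above.incident hG hl h).2 with h' | h'
        · exact he h'
        · have : e ∈ ({g} : Finset G.Edge) := by rw [← hg]; simpa using h'
          rw [Finset.mem_singleton.1 this] at h
          exact not_above_self hG hl _ _ h
    rw [htail, hg, Finset.sum_singleton, Finset.sum_singleton, headTerm, if_pos hw]
    have hS' : (if G.white a ∧ G.pos (Sum.inr a) ∈ frontier Ω then (1 : ZMod 2) else 0) =
        (corners hG hl Φ a : ZMod 2) := by
      rw [hS]; simp [hw]
    rw [hS', Int.cast_sub]
    linear_combination ((border hG hl Φ g : ZMod 2) - indic Φ ((arr hG hl).upE g)) * htwo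
  · have hdeg := outDeg_eq_one_of_black hG hw
    obtain ⟨g, hg⟩ := Finset.card_eq_one.1 ((card_tail_eq (G := G) (Sum.inr a)).trans hdeg)
    have hgt : g.1.1 = Sum.inr a := by
      have : g ∈ Finset.univ.filter fun e : G.Edge => e.1.1 = Sum.inr a := by rw [hg]; simp
      exact (Finset.mem_filter.1 this).2
    have hgadj : G.Adj (Sum.inr a) g.1.2 := hgt ▸ g.2
    refine ⟨border hG hl Φ g - corners hG hl Φ a, ?_, ?_⟩
    · rw [hg, Finset.sum_singleton] at h2 ⊢
      linarith
    have hgeq : (⟨(Sum.inr a, g.1.2), hgadj⟩ : G.Edge) = g := Subtype.ext (Prod.ext hgt.symm rfl)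
    -- the winding numbers select the edges below the outgoing edge `g`
    have hhead : ∑ e : G.Edge with e.1.2 = Sum.inr a,
        (border hG hl Φ e : ZMod 2) * G.headTerm l e.1.1 (Sum.inr a) =
        (indic Φ ((arr hG hl).dnE g) : ZMod 2) - indic Φ ((arr hG hl).dnV (Sum.inr a)) := by
      rw [(arr hG hl).dnE_sub_dnV_eq_sum_above (fun S => (indic Φ S : ZMod 2))
        ((lv_or_rv_iff hG hl g (Sum.inr a)).2 (Or.inl hgt)), Finset.sum_filter, Finset.sum_filter]
      refine Finset.sum_congr rfl fun e _ => ?_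
      rw [← border_cast_eq_jump]
      by_cases he : e.1.2 = Sum.inr a
      · have headj : G.Adj e.1.1 (Sum.inr a) := he ▸ e.2
        have heeq : (⟨(e.1.1, Sum.inr a), headj⟩ : G.Edge) = e :=
          Subtype.ext (Prod.ext rfl he.symm)
        have hf : (Finset.univ.filter fun w => G.Adj (Sum.inr a) w) = {g.1.2} := by
          ext w
          simp only [Finset.mem_filter, Finset.mem_univ, true_and, Finset.mem_singleton]
          exact ⟨fun h => eq_of_outDeg_le_one hdeg.le h hgadj, fun h => h ▸ hgadj⟩
        rw [if_pos he, headTerm, if_neg hw, hf, Finset.sum_singleton,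
          localWind_eq_above hG hl headj hgadj, hgeq, heeq, mul_ite, mul_one, mul_zero]
      · rw [if_neg he, if_neg]
        intro h
        rcases (Above.incident hG hl h).1 with h' | h'
        · have : e ∈ ({g} : Finset G.Edge) := by rw [← hg]; simpa using h'
          rw [Finset.mem_singleton.1 this] at h
          exact not_above_self hG hl _ _ h
        · exact he h'
    have htail : ∑ e : G.Edge with e.1.1 = Sum.inr a,
        (border hG hl Φ e : ZMod 2) * G.tailTerm l e.1.2 (Sum.inr a) = 0 :=
      Finset.sum_eq_zero fun e _ => by rw [tailTerm, if_neg hw, mul_zero]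
    rw [hhead, htail, if_neg fun h => hw h.1, corners, hg, Finset.sum_singleton, border]
    push_cast
    linear_combination -(indic Φ ((arr hG hl).upV (Sum.inr a)) : ZMod 2) * htwo

end Local

end DrawnDigraph

/-! ### The signature at boundary vertices and along gauge rays -/

namespace DrawnDigraph

open Arrangement

variable {n : ℕ} {ι : Type*} {G : DrawnDigraph n ι}

section Boundary

open Classical

variable [Fintype ι] (hG : G.IsPBDTP) {l : ℝ × ℝ} (hl : G.IsGaugeRay l)

include hG in
/-- A boundary vertex is either a source or a sink, with just one edge. -/
lemma boundary_cases (j : Fin n) :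
    (∃ e : G.Edge, (Finset.univ.filter fun e : G.Edge => e.1.1 = Sum.inl j) = {e} ∧
      (Finset.univ.filter fun e : G.Edge => e.1.2 = Sum.inl j) = ∅ ∧ G.IsSource j) ∨
    ∃ e : G.Edge, (Finset.univ.filter fun e : G.Edge => e.1.1 = Sum.inl j) = ∅ ∧
      (Finset.univ.filter fun e : G.Edge => e.1.2 = Sum.inl j) = {e} ∧ ¬ G.IsSource j := by
  have h1 := hG.boundary_deg j
  have h2 := card_tail_eq (G := G) (Sum.inl j)
  have h3 := card_head_eq (G := G) (Sum.inl j)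
  unfold deg at h1
  rcases Nat.add_eq_one_iff.1 h1 with ⟨h4, h5⟩ | ⟨h4, h5⟩
  · rw [h5] at h2
    rw [h4] at h3
    obtain ⟨e, he⟩ := Finset.card_eq_one.1 h2
    refine Or.inl ⟨e, he, Finset.card_eq_zero.1 h3, e.1.2, ?_⟩
    have : e ∈ Finset.univ.filter fun e : G.Edge => e.1.1 = Sum.inl j := by rw [he]; simp
    rw [← (Finset.mem_filter.1 this).2]
    exact e.2
  · rw [h5] at h2
    rw [h4] at h3
    obtain ⟨e, he⟩ := Finset.card_eq_one.1 h3
    refine Or.inr ⟨e, Finset.card_eq_zero.1 h2, he, fun ⟨v, hv⟩ => ?_⟩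
    exact (outDeg_pos hv).ne' h5

lemma indic_upV_eq_upE (Φ : Set (ℝ × ℝ)) {j : Fin n} {e : G.Edge}
    (he : ∀ e' : G.Edge, (e'.1.1 = Sum.inl j ∨ e'.1.2 = Sum.inl j) ↔ e' = e) :
    indic Φ ((arr hG hl).upV (Sum.inl j)) = indic Φ ((arr hG hl).upE e) := by
  have h := (arr hG hl).upV_sub_upE_eq_sum_above (indic Φ)
    ((lv_or_rv_iff hG hl e (Sum.inl j)).2 ((he e).2 rfl))
  rw [Finset.sum_eq_zero, sub_eq_zero] at h
  · exact h
  · intro e' h'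
    have h' := (Finset.mem_filter.1 h').2
    rw [(he e').1 (Above.incident hG hl h').2] at h'
    exact absurd h' (not_above_self hG hl _ _)

/-- What a boundary vertex sees of a face: the gaps next to it and the face above it. -/
lemma boundary_vertex {p : ℝ × ℝ} {Ω : Set (ℝ × ℝ)} (hΩ : shear l '' Ω = (arr hG hl).face p)
    (j : Fin n) :
    indic (shear l '' Ω) ((arr hG hl).upG j.castSucc) +
        indic (shear l '' Ω) ((arr hG hl).upG j.succ) =
      ∑ e : G.Edge with e.1.1 = Sum.inl j, border hG hl (shear l '' Ω) e +
        ∑ e : G.Edge with e.1.2 = Sum.inl j, border hG hl (shear l '' Ω) e ∧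
    ∑ e : G.Edge with e.1.2 = Sum.inl j, indic (shear l '' Ω) ((arr hG hl).upE e) =
      (if G.IsSource j then 0 else indic (shear l '' Ω) ((arr hG hl).upV (Sum.inl j))) ∧
    ∑ e : G.Edge with e.1.1 = Sum.inl j, border hG hl (shear l '' Ω) e =
      if G.IsSource j ∧ G.pos (Sum.inl j) ∈ frontier Ω then 1 else 0 := by
  have hfr := mem_frontier_iff_exists_border hG hl hΩ (v := Sum.inl j)
  set Φ := shear l '' Ω
  have h1 := (arr hG hl).upV_sub_upG (indic Φ) j true
  have h2 := (arr hG hl).upV_sub_upG (indic Φ) j false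
  have h3 := sum_edges_at hG hl ((arr hG hl).jump (indic Φ)) (Sum.inl j)
  rw [Fintype.sum_bool, ← h1, ← h2] at h3
  simp only [gapAt, if_true, Bool.false_eq_true, if_false] at h3
  have hmem : ∀ e' : G.Edge, (e'.1.1 = Sum.inl j ∨ e'.1.2 = Sum.inl j) ↔
      e' ∈ (Finset.univ.filter fun e : G.Edge => e.1.1 = Sum.inl j) ∪
        Finset.univ.filter fun e : G.Edge => e.1.2 = Sum.inl j := fun e' => by simp
  rcases boundary_cases hG j with ⟨e, hs, ht, hsrc⟩ | ⟨e, hs, ht, hsrc⟩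
  · have he : ∀ e' : G.Edge, (e'.1.1 = Sum.inl j ∨ e'.1.2 = Sum.inl j) ↔ e' = e := fun e' => by
      rw [hmem, hs, ht]; simp
    have hA := indic_upV_eq_upE hG hl Φ he
    rw [hs, ht, Finset.sum_singleton, Finset.sum_empty, jump] at h3
    rw [hs, ht, Finset.sum_singleton, Finset.sum_empty, Finset.sum_empty, if_pos hsrc]
    refine ⟨by rw [border]; linarith, rfl, ?_⟩
    have hfr := hfr ⟨e, (he e).2 rfl⟩
    simp only [he, exists_eq_left] at hfr
    split_ifs with h
    · exact hfr.1 h.2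
    · have := border_nonneg hG hl Φ e
      have := border_le_one hG hl Φ e
      have : border hG hl Φ e ≠ 1 := fun h' => h ⟨hsrc, hfr.2 h'⟩
      omega
  · have he : ∀ e' : G.Edge, (e'.1.1 = Sum.inl j ∨ e'.1.2 = Sum.inl j) ↔ e' = e := fun e' => by
      rw [hmem, hs, ht]; simp
    have hA := indic_upV_eq_upE hG hl Φ he
    rw [hs, ht, Finset.sum_singleton, Finset.sum_empty, jump] at h3
    rw [hs, ht, Finset.sum_singleton, Finset.sum_singleton, Finset.sum_empty, if_neg hsrc,
      if_neg fun h => hsrc h.1]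
    exact ⟨by rw [border]; linarith, hA.symm, rfl⟩

omit [Fintype ι] in
/-- In the coordinates in which the gauge rays are vertical, an edge meets the ray from `b_i` if
and only if it passes over `b_i`. -/
lemma edgeInt_eq [Finite ι] (e : G.Edge) : G.edgeInt l e.1.1 e.1.2 =
    (Finset.univ.filter fun i => G.IsSource i ∧ (arr hG hl).x (Sum.inl i) ∈
      Ioo ((arr hG hl).x ((arr hG hl).lv e)) ((arr hG hl).x ((arr hG hl).rv e))).card := by
  have hl2 := hl.inward
  rw [edgeInt, ← ncard_coe_finset]
  congr 1
  ext i
  simp only [mem_ofPred_eq, Finset.coe_filter, Finset.mem_univ, true_and]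
  refine and_congr_right fun _ => ?_
  have hsh : ∀ t : ℝ, shear l (G.pos (Sum.inl i) + t • l) =
      ((arr hG hl).x (Sum.inl i), t * l.2) := fun t => by
    have h0 := hG.planar.boundary_line i
    refine Prod.ext ?_ (by simp [shear_apply, h0])
    simp only [shear_apply, arr, absc, Prod.fst_add, Prod.snd_add, Prod.smul_fst, Prod.smul_snd,
      smul_eq_mul, h0]
    field_simp
    ring
  simp only [← on_arr_iff hG hl, hsh]
  constructor
  · rintro ⟨t, ht, h1, h2, h3⟩
    simp only at h1 h2 h3
    have hpos := mul_pos ht hl2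
    rw [h3] at hpos
    have hne : ∀ v, 0 < (arr hG hl).y v → (arr hG hl).x (Sum.inl i) ≠ (arr hG hl).x v := by
      rintro (j | a) hv
      · exact absurd ((arr hG hl).y_inl j) hv.ne'
      · exact (arr hG hl).x_inl_ne i a
    refine ⟨lt_of_le_of_ne h1 fun h => hne _ ?_ h.symm, lt_of_le_of_ne h2 fun h => hne _ ?_ h⟩
    · rwa [← h, Arrangement.height_lv] at hpos
    · rwa [h, Arrangement.height_rv] at hpos
  · intro h
    exact ⟨_, div_pos ((arr hG hl).height_pos h) hl2, h.1.le, h.2.le, div_mul_cancel₀ _ hl2.ne'⟩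

/-- The sum over all edges, arranged by their starting points or by their end points. -/
lemma sum_edges {M : Type*} [AddCommMonoid M] (F : G.Edge → M) (s : G.Edge → Vert n ι) :
    ∑ e, F e = ∑ j, ∑ e with s e = Sum.inl j, F e + ∑ a, ∑ e with s e = Sum.inr a, F e := by
  rw [← Finset.sum_fiberwise Finset.univ s F, Fintype.sum_sum_type]

lemma faceSign_eq {p : ℝ × ℝ} {Ω : Set (ℝ × ℝ)} (hΩ : shear l '' Ω = (arr hG hl).face p)
    (ε : Vert n ι → Vert n ι → ZMod 2) : G.faceSign ε Ω =
      ∑ e : G.Edge, (border hG hl (shear l '' Ω) e : ZMod 2) * ε e.1.1 e.1.2 := by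
  rw [faceSign, Finset.sum_filter, ← Finset.sum_subset
    (Finset.subset_univ (Finset.univ.filter fun e : Vert n ι × Vert n ι => G.Adj e.1 e.2)),
    Finset.sum_subtype (p := fun e : Vert n ι × Vert n ι => G.Adj e.1 e.2) _ (by simp)]
  · refine Finset.sum_congr rfl fun e _ => ?_
    have h := seg_subset_frontier_iff hG hl e (Ω := Ω)
    rw [hΩ, (arr hG hl).on_subset_frontier_iff, ← hΩ] at h
    rw [border_eq]
    by_cases hb : (arr hG hl).upE e = shear l '' Ω ∨ (arr hG hl).dnE e = shear l '' Ω
    · rw [if_pos ⟨e.2, h.2 hb⟩, if_pos hb, Int.cast_one, one_mul]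
    · rw [if_neg fun h' => hb (h.1 h'.2), if_neg hb, Int.cast_zero, zero_mul]
  · intro e _ he
    exact if_neg fun h => he (Finset.mem_filter.2 ⟨Finset.mem_univ e, h.1⟩)

end Boundary

end DrawnDigraph

/-! ### The total signature of a face -/

namespace DrawnDigraph

open Arrangement

variable {n : ℕ} {ι : Type*} {G : DrawnDigraph n ι}

section Total

open Classical

variable [Fintype ι] (hG : G.IsPBDTP) {l : ℝ × ℝ} (hl : G.IsGaugeRay l)

/-- The Euler characteristic of a face: it lies above one more cell than vertices. -/
lemma euler_face {p : ℝ × ℝ} (hp : p ∈ (arr hG hl).free) {Φ : Set (ℝ × ℝ)}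
    (hΦ : Φ = (arr hG hl).face p) :
    ∑ e, indic Φ ((arr hG hl).upE e) + ∑ i, indic Φ ((arr hG hl).upG i) =
      ∑ j, indic Φ ((arr hG hl).upV (Sum.inl j)) +
        ∑ a, indic Φ ((arr hG hl).upV (Sum.inr a)) + 1 := by
  have h := ((arr hG hl).euler (reflTransGen_joined hG hl)).1 Φ
    (hΦ ▸ (arr hG hl).face_mem_faces hp)
  have h1 : (((arr hG hl).cellsBelow Φ).card : ℤ) =
      ∑ e, indic Φ ((arr hG hl).upE e) + ∑ i, indic Φ ((arr hG hl).upG i) := by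
    rw [cellsBelow, Finset.card_filter, Nat.cast_sum, Fintype.sum_sum_type]
    simp only [indic, upE, upG, Nat.cast_ite, Nat.cast_one, Nat.cast_zero]
    congr!
  have h2 : (((arr hG hl).vertsBelow Φ).card : ℤ) =
      ∑ j, indic Φ ((arr hG hl).upV (Sum.inl j)) +
        ∑ a, indic Φ ((arr hG hl).upV (Sum.inr a)) := by
    rw [vertsBelow, Finset.card_filter, Nat.cast_sum, Fintype.sum_sum_type]
    simp only [indic, Nat.cast_ite, Nat.cast_one, Nat.cast_zero]
  rw [← h1, ← h2]
  exact_mod_cast h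

/-- The total number of intersections of the boundary of a face with the gauge rays, modulo 2. -/
lemma sum_border_mul_edgeInt (Φ : Set (ℝ × ℝ)) :
    ∑ e : G.Edge, (border hG hl Φ e : ZMod 2) * (G.edgeInt l e.1.1 e.1.2 : ZMod 2) =
      G.numSources * (indic Φ (arr hG hl).top : ZMod 2) -
        ∑ j, if G.IsSource j then (indic Φ ((arr hG hl).upV (Sum.inl j)) : ZMod 2) else 0 := by
  have h1 : (G.numSources : ZMod 2) = ∑ j, if G.IsSource j then 1 else 0 := by
    rw [numSources, ncard_eq_toFinset_card', toFinset_ofPred, Finset.card_filter, Nat.cast_sum]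
    simp only [Nat.cast_ite, Nat.cast_one, Nat.cast_zero]
  rw [h1, Finset.sum_mul, ← Finset.sum_sub_distrib]
  simp only [edgeInt_eq hG hl, Finset.card_filter, Nat.cast_sum, Nat.cast_ite, Nat.cast_one,
    Nat.cast_zero, Finset.mul_sum]
  rw [Finset.sum_comm]
  refine Finset.sum_congr rfl fun j _ => ?_
  by_cases hj : G.IsSource j
  · rw [if_pos hj, if_pos hj, one_mul,
      (arr hG hl).top_sub_upV (fun S => (indic Φ S : ZMod 2)), Finset.sum_filter]
    refine Finset.sum_congr rfl fun e _ => ?_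
    simp only [hj, true_and, border_cast_eq_jump, mul_ite, mul_one, mul_zero]
  · simp [hj]

/-- Gauge transformations do not change the signature of a face. -/
lemma sum_border_mul_gauge (η : ι → ZMod 2) (Φ : Set (ℝ × ℝ)) :
    ∑ e : G.Edge, (border hG hl Φ e : ZMod 2) * (Sum.elim (fun _ => 0) η e.1.1 +
      Sum.elim (fun _ => 0) η e.1.2) = 0 := by
  have key : ∀ s : G.Edge → Vert n ι, ∑ e : G.Edge, (border hG hl Φ e : ZMod 2) *
      Sum.elim (fun _ => 0) η (s e) =
      ∑ a, (∑ e : G.Edge with s e = Sum.inr a, (border hG hl Φ e : ZMod 2)) * η a := fun s => by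
    rw [sum_edges _ s, Finset.sum_eq_zero, zero_add]
    · refine Finset.sum_congr rfl fun a _ => ?_
      rw [Finset.sum_mul]
      refine Finset.sum_congr rfl fun e he => ?_
      rw [(Finset.mem_filter.1 he).2, Sum.elim_inr]
    · intro j _
      refine Finset.sum_eq_zero fun e he => ?_
      rw [(Finset.mem_filter.1 he).2, Sum.elim_inl, mul_zero]
  simp only [mul_add, Finset.sum_add_distrib]
  rw [key fun e => e.1.1, key fun e => e.1.2, ← Finset.sum_add_distrib]
  refine Finset.sum_eq_zero fun a _ => ?_
  have h := congrArg (Int.cast (R := ZMod 2)) (two_mul_corners hG hl Φ a)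
  push_cast at h
  rw [← add_mul, ← h, show (2 : ZMod 2) = 0 from rfl, zero_mul, zero_mul]

/-- The total signature of a face; `τ` is `1` for the infinite face and `0` for the others. -/
lemma total_signature {p : ℝ × ℝ} (hp : p ∈ (arr hG hl).free) {Ω : Set (ℝ × ℝ)}
    (hΩ : shear l '' Ω = (arr hG hl).face p) {ε : Vert n ι → Vert n ι → ZMod 2}
    (hε : G.SignEquiv (G.raySignature l) ε) {τ : ZMod 2}
    (hτ : (indic (shear l '' Ω) (arr hG hl).top : ZMod 2) = τ) :
    G.faceSign ε Ω + (G.numWhite Ω : ZMod 2) + (G.numFaceSources Ω : ZMod 2) =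
      G.numSources * τ + 1 - τ := by
  have hsign := faceSign_eq hG hl hΩ ε
  have heuler := congrArg (Int.cast (R := ZMod 2)) (euler_face hG hl hp hΩ)
  choose d hd hloc using exists_local_balance hG hl hΩ
  choose hgap hin hout using boundary_vertex hG hl hΩ
  set Φ := shear l '' Ω
  obtain ⟨η, hη⟩ := hε
  -- the signature of the face, arranged by vertices
  have hsum : G.faceSign ε Ω =
      ∑ e : G.Edge, (border hG hl Φ e : ZMod 2) * (G.edgeInt l e.1.1 e.1.2 : ZMod 2) +
      ∑ a, (∑ e : G.Edge with e.1.2 = Sum.inr a,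
        (border hG hl Φ e : ZMod 2) * G.headTerm l e.1.1 (Sum.inr a)) +
      ∑ a, (∑ e : G.Edge with e.1.1 = Sum.inr a,
        (border hG hl Φ e : ZMod 2) * G.tailTerm l e.1.2 (Sum.inr a)) := by
    have h1 : ∑ e : G.Edge, (border hG hl Φ e : ZMod 2) * G.headTerm l e.1.1 e.1.2 =
        ∑ a, (∑ e : G.Edge with e.1.2 = Sum.inr a,
          (border hG hl Φ e : ZMod 2) * G.headTerm l e.1.1 (Sum.inr a)) := by
      rw [sum_edges _ fun e : G.Edge => e.1.2, Finset.sum_eq_zero, zero_add]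
      · refine Finset.sum_congr rfl fun a _ => Finset.sum_congr rfl fun e he => ?_
        rw [(Finset.mem_filter.1 he).2]
      · refine fun j _ => Finset.sum_eq_zero fun e he => ?_
        rw [(Finset.mem_filter.1 he).2, headTerm, mul_zero]
    have h2 : ∑ e : G.Edge, (border hG hl Φ e : ZMod 2) * G.tailTerm l e.1.2 e.1.1 =
        ∑ a, (∑ e : G.Edge with e.1.1 = Sum.inr a,
          (border hG hl Φ e : ZMod 2) * G.tailTerm l e.1.2 (Sum.inr a)) := by
      rw [sum_edges _ fun e : G.Edge => e.1.1, Finset.sum_eq_zero, zero_add]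
      · refine Finset.sum_congr rfl fun a _ => Finset.sum_congr rfl fun e he => ?_
        rw [(Finset.mem_filter.1 he).2]
      · refine fun j _ => Finset.sum_eq_zero fun e he => ?_
        rw [(Finset.mem_filter.1 he).2, tailTerm, mul_zero]
    have h3 := sum_border_mul_gauge hG hl η Φ
    rw [hsign, ← h1, ← h2, ← Finset.sum_add_distrib, ← Finset.sum_add_distrib, ← sub_eq_zero,
      ← Finset.sum_sub_distrib, ← h3]
    refine Finset.sum_congr rfl fun e _ => ?_
    rw [hη _ _ e.2, raySignature]
    ring
  have hwhite : (G.numWhite Ω : ZMod 2) =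
      ∑ a, if G.white a ∧ G.pos (Sum.inr a) ∈ frontier Ω then 1 else 0 := by
    rw [numWhite, ncard_eq_toFinset_card', toFinset_ofPred, Finset.card_filter, Nat.cast_sum]
    simp only [Nat.cast_ite, Nat.cast_one, Nat.cast_zero]
  have hsrc : (G.numFaceSources Ω : ℤ) =
      ∑ j, ∑ e : G.Edge with e.1.1 = Sum.inl j, border hG hl Φ e := by
    rw [numFaceSources, ncard_eq_toFinset_card', toFinset_ofPred, Finset.card_filter,
      Nat.cast_sum]
    simp only [hout, Nat.cast_ite, Nat.cast_one, Nat.cast_zero]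
  have hloc' := Finset.sum_congr rfl fun a (_ : a ∈ Finset.univ) => hloc a
  simp only [Finset.sum_add_distrib] at hloc'
  rw [← hwhite] at hloc'
  -- the edges and the boundary vertices below the face, arranged by end points and by sources
  have hup : ∑ e, (indic Φ ((arr hG hl).upE e) : ZMod 2) =
      ∑ j, (if G.IsSource j then 0 else (indic Φ ((arr hG hl).upV (Sum.inl j)) : ZMod 2)) +
      ∑ a, ∑ e : G.Edge with e.1.2 = Sum.inr a, (indic Φ ((arr hG hl).upE e) : ZMod 2) := by
    rw [sum_edges _ fun e : G.Edge => e.1.2]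
    congr 1
    refine Finset.sum_congr rfl fun j _ => ?_
    have := congrArg (Int.cast (R := ZMod 2)) (hin j)
    rw [Int.cast_sum, Int.cast_ite, Int.cast_zero] at this
    exact this
  have hsplit : ∑ j, (indic Φ ((arr hG hl).upV (Sum.inl j)) : ZMod 2) =
      ∑ j, (if G.IsSource j then (indic Φ ((arr hG hl).upV (Sum.inl j)) : ZMod 2) else 0) +
      ∑ j, (if G.IsSource j then 0 else (indic Φ ((arr hG hl).upV (Sum.inl j)) : ZMod 2)) := by
    rw [← Finset.sum_add_distrib]
    refine Finset.sum_congr rfl fun j _ => ?_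
    split_ifs <;> simp
  -- the gaps to the right of the boundary vertices are all but the last, those to the left all but
  -- the first
  have hg : ∑ i, indic Φ ((arr hG hl).upG i) =
      indic Φ (arr hG hl).top + G.numFaceSources Ω + ∑ a, d a := by
    have e1 := sum_edges (border hG hl Φ) fun e => e.1.1
    have e2 := sum_edges (border hG hl Φ) fun e => e.1.2
    have e3 := Finset.sum_congr rfl fun a (_ : a ∈ Finset.univ) => hd a
    have e4 := Finset.sum_congr rfl fun j (_ : j ∈ Finset.univ) => hgap j
    simp only [Finset.sum_add_distrib, Finset.sum_sub_distrib] at e3 e4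
    rw [← Finset.mul_sum] at e3
    have e5 := Fin.sum_univ_castSucc fun i => indic Φ ((arr hG hl).upG i)
    have e6 := Fin.sum_univ_succ fun i => indic Φ ((arr hG hl).upG i)
    rw [upG_last] at e5
    rw [upG_zero] at e6
    rw [← hsrc] at e1 e4
    linarith
  have hg' := congrArg (Int.cast (R := ZMod 2)) hg
  have hint := sum_border_mul_edgeInt hG hl Φ
  push_cast at hg' heuler
  rw [hτ] at hg' hint
  have htwo : (2 : ZMod 2) = 0 := rfl
  rw [hsum, hint]
  linear_combination hloc' - hup + hsplit + heuler - hg' +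
    (∑ a, (indic Φ ((arr hG hl).upV (Sum.inr a)) : ZMod 2)) * htwo

end Total

/-- The infinite face is the face at infinity. -/
lemma outerArc_subset_frontier_iff [Finite ι] [Fintype G.Edge] (hG : G.IsPBDTP) {l : ℝ × ℝ}
    (hl : G.IsGaugeRay l) {p : ℝ × ℝ} {Ω : Set (ℝ × ℝ)}
    (hΩ : shear l '' Ω = (arr hG hl).face p) :
    G.outerArc ⊆ frontier Ω ↔ (arr hG hl).top = shear l '' Ω := by
  have hline : ∀ q : ℝ × ℝ, q.2 = 0 → absc l q = q.1 := fun q hq => by simp [absc, hq]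
  have hmem : ∀ q, q ∈ G.outerArc ↔ shear l q ∈ (arr hG hl).outer := fun q => by
    simp only [outerArc, outer, mem_ofPred_eq, shear_apply, arr]
    refine and_congr_right fun hq => ?_
    simp only [hline _ (hG.planar.boundary_line _), hline q hq]
  rw [eq_comm, hΩ, ← (arr hG hl).outer_subset_frontier_iff, ← hΩ]
  constructor
  · intro h q hq
    obtain ⟨q, rfl⟩ := (shear l).surjective q
    exact (mem_frontier_iff_shear l).1 (h ((hmem q).2 hq))
  · exact fun h q hq => (mem_frontier_iff_shear l).2 (h ((hmem q).1 hq))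

end DrawnDigraph

end FaceSignatures

theorem mainTheorem3 {n k : ℕ} {ι : Type*} [Fintype ι] (G : DrawnDigraph n ι) (hG : G.IsPBDTP)
    (hk : G.numSources = k) (ε : Vert n ι → Vert n ι → ZMod 2) (hε : G.IsGeometricSignature ε)
    (Ω : Set (ℝ × ℝ)) :
    (G.IsInternalFace Ω → G.faceSign ε Ω = (G.numWhite Ω : ZMod 2) - 1) ∧
    (G.IsFiniteBoundaryFace Ω →
      G.faceSign ε Ω + (G.numWhite Ω : ZMod 2) + (G.numFaceSources Ω : ZMod 2) = 1) ∧
    (G.IsInfiniteFace Ω →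
      G.faceSign ε Ω + (G.numWhite Ω : ZMod 2) + (G.numFaceSources Ω : ZMod 2) = (k : ZMod 2)) := by
  classical
  obtain ⟨l, hl, hε⟩ := hε
  have key : G.IsFace Ω → G.faceSign ε Ω + (G.numWhite Ω : ZMod 2) +
      (G.numFaceSources Ω : ZMod 2) = if G.outerArc ⊆ frontier Ω then (k : ZMod 2) else 1 := by
    intro h
    obtain ⟨p, hp, hΩ⟩ := h.exists_eq_face hG hl
    rw [DrawnDigraph.total_signature hG hl hp hΩ hε rfl, hk,
      DrawnDigraph.outerArc_subset_frontier_iff hG hl hΩ, DrawnDigraph.indic]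
    split_ifs <;> simp
  refine ⟨fun h => ?_, fun h => ?_, fun h => ?_⟩
  · -- an internal face has no boundary sources, and its boundary does not contain the outer arc
    have hline : ∀ q ∈ frontier Ω, q.2 ≠ 0 := fun q hq h0 => by
      have : q ∈ frontier Ω ∩ {p | p.2 = 0} := ⟨hq, h0⟩
      rwa [h.2] at this
    have hno : G.numFaceSources Ω = 0 := by
      rw [DrawnDigraph.numFaceSources, Set.ncard_eq_zero, Set.eq_empty_iff_forall_notMem]
      exact fun j hj => hline _ hj.2 (hG.planar.boundary_line j)
    have houter : ¬ G.outerArc ⊆ frontier Ω := fun hsub => by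
      obtain ⟨M, hM⟩ := (Set.finite_range fun j : Fin n => (G.pos (Sum.inl j)).1).bddAbove
      exact hline (M, 0) (hsub ⟨rfl, fun ⟨_, j, _, hj⟩ =>
        (hM (Set.mem_range_self j)).not_gt hj⟩) rfl
    have hfin := key h.1
    rw [hno, if_neg houter, Nat.cast_zero, add_zero] at hfin
    rw [← hfin, sub_add_cancel_right, CharTwo.neg_eq]
  · rw [key h.1.1, if_neg fun hsub => h.2 ⟨h.1, hsub⟩]
  · rw [key h.1.1, if_pos h.2]
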